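/- Let $n\ge 3$, let $\Omega\subset\mathbb{R}^n$ be a bounded open set, and let $\widetilde\Omega\subset\mathbb{R}^n$ be an open set with $\overline{\Omega}\subset\widetilde\Omega$. Write $D=i^{-1}\nabla$ and, for $A=(A_1,\dots,A_n)\in L^\infty(\Omega,\mathbb{C}^n)$ and $q\in L^\infty(\Omega,\mathbb{C})$, let $$L_{A,q}w=\sum_{j=1}^n (D_j+A_j)^2w+qw ,\qquad w\in H^1(\Omega),$$ understood in the sense of distributions on $\Omega$. A real function $\varphi\in C^\infty(\widetilde\Omega,\mathbb{R})$ is a limiting Carleman weight for the semiclassical Laplacian $-h^2\Delta$ on $\widetilde\Omega$ if $\nabla\varphi\neq 0$ in $\widetilde\Omega$ and, with $p_\varphi(x,\xi)=|\xi|^2+2i\nabla\varphi(x)\cdot\xi-|\nabla\varphi(x)|^2$, the Poisson bracket satisfies $\{\operatorname{Re}p_\varphi,\operatorname{Im}p_\varphi\}(x,\xi)=0$ at every $(x,\xi)\in\widetilde\Omega\times\mathbb{R}^n$ with $p_\varphi(x,\xi)=0$. For $h>0$, $u\in H^1(\Omega)$ and $v\in H^{-1}(\Omega)$ (the linear functionals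 on $C_0^\infty(\Omega)$ that are bounded for the $H^1(\Omega)$ norm) put $$\|u\|_{H^1_{\rm scl}(\Omega)}^2=\|u\|_{L^2(\Omega)}^2+\|hDu\|_{L^2(\Omega)}^2,\qquad \|v\|_{H^{-1}_{\rm scl}(\Omega)}=\sup_{0\ne\psi\in C_0^\infty(\Omega)}\frac{|\langle v,\psi\rangle_\Omega|}{\|\psi\|_{H^1_{\rm scl}(\Omega)}} .$$ Proposition. Let $A\in L^\infty(\Omega,\mathbb{C}^n)$, $q\in L^\infty(\Omega,\mathbb{C})$, and let $\varphi$ be a limiting Carleman weight for the semiclassical Laplacian on $\widetilde\Omega$. Then there are constants $C>0$ and $h_0>0$, depending only on $n,\Omega,\widetilde\Omega,\varphi,A,q$, such that for every $0<h\le h_0$ and every $v\in H^{-1}(\Omega)$ there is a solution $u\in H^1(\Omega)$ of $$e^{\varphi/h}\,(h^2L_{A,q})\,e^{-\varphi/h}u=v\quad\text{in }\Omega$$ in the sense of distributions, which satisfies $$\|u\|_{H^1_{\rm scl}(\Omega)}\le \frac{C}{h}\,\|v\|_{H^{-1}_{\rm scl}(\Omega)} .$$ -/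

import Mathlib

open Set MeasureTheory TopologicalSpace
open scoped Distributions ContDiff ENNReal

noncomputable section

namespace MagneticSchrodinger

variable {n : ℕ} {Ω : Opens (EuclideanSpace ℝ (Fin n))}

/-! ### Test functions and distributions on an open set -/

/-- Lebesgue measure on the open set `Ω ⊆ ℝⁿ`. -/
abbrev vol (Ω : Opens (EuclideanSpace ℝ (Fin n))) : Measure (EuclideanSpace ℝ (Fin n)) :=
  volume.restrict (Ω : Set (EuclideanSpace ℝ (Fin n)))

/-- Complex linear functionals on the space `𝓓(Ω, ℂ)` of complex-valued test functions,
the value `T ψ` being the bilinear pairing `⟨T, ψ⟩_Ω`. The distributions on `Ω` are among them;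
every functional used below (the distributions given by `L²` functions and their derivatives, and
the elements of `H⁻¹`) is bounded by a Sobolev norm of the test function on each compact set,
hence continuous. -/
abbrev Functional (Ω : Opens (EuclideanSpace ℝ (Fin n))) : Type := 𝓓(Ω, ℂ) →ₗ[ℂ] ℂ

/-- The `j`-th standard basis vector of `ℝⁿ`. -/
abbrev stdVec (j : Fin n) : EuclideanSpace ℝ (Fin n) := EuclideanSpace.single j (1 : ℝ)

/-- `D_j = i⁻¹ ∂_j` on test functions. -/
def testD (j : Fin n) : 𝓓(Ω, ℂ) →ₗ[ℂ] 𝓓(Ω, ℂ) :=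
  (Complex.I)⁻¹ •
    (TestFunction.lineDerivCLM ℂ (n := ⊤) (k := ⊤) (Ω := Ω) (F := ℂ) (stdVec j)).toLinearMap

lemma testFunction_differentiableAt (ψ : 𝓓(Ω, ℂ)) (x : EuclideanSpace ℝ (Fin n)) :
    DifferentiableAt ℝ ψ x :=
  (ψ.contDiff.differentiable (by simp)).differentiableAt

lemma testD_apply (j : Fin n) (ψ : 𝓓(Ω, ℂ)) (x : EuclideanSpace ℝ (Fin n)) :
    testD j ψ x = (Complex.I)⁻¹ * fderiv ℝ ψ x (stdVec j) := by
  have h : testD j ψ x = (Complex.I)⁻¹ *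
    (TestFunction.lineDerivCLM ℂ (n := ⊤) (k := ⊤) (Ω := Ω) (F := ℂ) (stdVec j) ψ) x := rfl
  rw [h, TestFunction.lineDerivCLM_apply_of_le (by simp),
    (testFunction_differentiableAt ψ x).lineDeriv_eq_fderiv]

/-- `D_j` on distributions: `⟨D_j T, ψ⟩ = -⟨T, D_j ψ⟩`. -/
def distD (j : Fin n) (T : Functional Ω) : Functional Ω := -(T ∘ₗ testD j)

lemma testFunction_memLp (ψ : 𝓓(Ω, ℂ)) : MemLp ψ 2 (vol Ω) :=
  ψ.continuous.memLp_of_hasCompactSupport ψ.hasCompactSupport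

lemma integrable_mul_test (f : Lp ℂ 2 (vol Ω)) (ψ : 𝓓(Ω, ℂ)) :
    Integrable (fun x => f x * ψ x) (vol Ω) :=
  (Lp.memLp f).integrable_mul (testFunction_memLp ψ)

/-- The distribution on `Ω` given by an `L²` function: `⟨f, ψ⟩ = ∫_Ω f ψ dx`. -/
def ofL2 (f : Lp ℂ 2 (vol Ω)) : Functional Ω where
  toFun ψ := ∫ x, f x * ψ x ∂(vol Ω)
  map_add' ψ χ := by
    rw [← integral_add (integrable_mul_test f ψ) (integrable_mul_test f χ)]
    exact integral_congr_ae (.of_forall fun x => mul_add _ _ _)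
  map_smul' c ψ := by
    rw [RingHom.id_apply, smul_eq_mul, ← integral_const_mul]
    exact integral_congr_ae (.of_forall fun x => mul_left_comm _ _ _)

lemma ofL2_apply (f : Lp ℂ 2 (vol Ω)) (ψ : 𝓓(Ω, ℂ)) :
    ofL2 f ψ = ∫ x, f x * ψ x ∂(vol Ω) := rfl

/-! ### The Sobolev spaces `H¹(Ω)` and `H⁻¹(Ω)` -/

/-- The Sobolev space `H¹(Ω)`: a function `u ∈ L²(Ω)` together with its (unique) weak derivatives
`D_j u ∈ L²(Ω)`. -/
structure H1 (Ω : Opens (EuclideanSpace ℝ (Fin n))) where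
  /-- the function -/
  fn : Lp ℂ 2 (vol Ω)
  /-- its weak derivatives `D_j u` -/
  D : Fin n → Lp ℂ 2 (vol Ω)
  distD_eq : ∀ j, distD j (ofL2 fn) = ofL2 (D j)

/-- `‖u‖²_{H¹_scl(Ω)} = ‖u‖²_{L²(Ω)} + ‖h D u‖²_{L²(Ω)}`. -/
def H1.sclNorm (h : ℝ) (u : H1 Ω) : ℝ :=
  Real.sqrt (‖u.fn‖ ^ 2 + ∑ j, ‖(h : ℂ) • u.D j‖ ^ 2)

/-- A test function on `Ω` as an element of `H¹(Ω)`. -/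
def testH1 (ψ : 𝓓(Ω, ℂ)) : H1 Ω where
  fn := (testFunction_memLp ψ).toLp ψ
  D j := (testFunction_memLp (testD j ψ)).toLp (testD j ψ)
  distD_eq j := by
    have key : ∀ χ η : 𝓓(Ω, ℂ), ofL2 ((testFunction_memLp χ).toLp χ) η = ∫ x, χ x * η x := by
      intro χ η
      rw [ofL2_apply]
      have h1 : ∫ x, ((testFunction_memLp χ).toLp χ) x * η x ∂(vol Ω)
          = ∫ x, χ x * η x ∂(vol Ω) := by
        refine integral_congr_ae ?_
        filter_upwards [(testFunction_memLp χ).coeFn_toLp] with x hx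
        rw [hx]
      rw [h1]
      refine setIntegral_eq_integral_of_forall_compl_eq_zero fun x hx => ?_
      rw [image_eq_zero_of_notMem_tsupport fun h => hx (η.tsupport_subset h), mul_zero]
    ext η
    change -(ofL2 _ (testD j η)) = _
    rw [key, key]
    have hint : ∀ χ η : 𝓓(Ω, ℂ), Integrable (fun x => χ x * η x) := fun χ η =>
      (χ.continuous.mul η.continuous).integrable_of_hasCompactSupport
        (η.hasCompactSupport.mul_left)
    have hfd : ∀ χ : 𝓓(Ω, ℂ), ∀ x, fderiv ℝ χ x (stdVec j) = Complex.I * testD j χ x := by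
      intro χ x
      rw [testD_apply, ← mul_assoc, mul_inv_cancel₀ Complex.I_ne_zero, one_mul]
    have ibp := integral_mul_fderiv_eq_neg_fderiv_mul_of_integrable (μ := volume)
      (f := (ψ : EuclideanSpace ℝ (Fin n) → ℂ)) (g := (η : EuclideanSpace ℝ (Fin n) → ℂ))
      (v := stdVec j)
      (by
        have := (hint (testD j ψ) η).const_mul Complex.I
        refine this.congr (.of_forall fun x => ?_)
        simp only [hfd, mul_assoc])
      (by
        have := (hint ψ (testD j η)).const_mul Complex.I
        refine this.congr (.of_forall fun x => ?_)
        simp only [hfd]; ring)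
      (hint ψ η) (fun x _ => testFunction_differentiableAt ψ x)
      (fun x _ => testFunction_differentiableAt η x)
    simp only [hfd, mul_assoc, mul_left_comm _ Complex.I] at ibp
    rw [integral_const_mul, integral_const_mul, ← mul_neg] at ibp
    have := mul_left_cancel₀ Complex.I_ne_zero ibp
    rw [this, neg_neg]

/-- `v ∈ H⁻¹(Ω)`: the functional `v` on `C₀^∞(Ω)` is bounded for the norm of `H¹(Ω)`. -/
def MemHNegOne (v : Functional Ω) : Prop :=
  ∃ K : ℝ, ∀ ψ : 𝓓(Ω, ℂ), ‖v ψ‖ ≤ K * (testH1 ψ).sclNorm 1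

/-- `‖v‖_{H⁻¹_scl(Ω)} = sup_{0 ≠ ψ ∈ C₀^∞(Ω)} |⟨v, ψ⟩_Ω| / ‖ψ‖_{H¹_scl(Ω)}`, for `v ∈ H⁻¹(Ω)`. -/
def sclNormNegOne (h : ℝ) (v : Functional Ω) : ℝ :=
  ⨆ ψ : {ψ : 𝓓(Ω, ℂ) // ψ ≠ 0}, ‖v ψ.1‖ / (testH1 ψ.1).sclNorm h

/-! ### The magnetic Schrödinger operator -/

/-- `L_{A,q} w = ∑_j (D_j + A_j)² w + q w`, as a distribution on `Ω`, for `w ∈ H¹(Ω)`,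
`A ∈ L^∞(Ω, ℂⁿ)` and `q ∈ L^∞(Ω, ℂ)`. -/
def magneticOp (A : Fin n → Lp ℂ ∞ (vol Ω)) (q : Lp ℂ ∞ (vol Ω)) (w : H1 Ω) : Functional Ω :=
  let g : Fin n → Lp ℂ 2 (vol Ω) := fun j => w.D j + (A j • w.fn : Lp ℂ 2 (vol Ω))
  ∑ j, (distD j (ofL2 (g j)) + ofL2 (A j • g j : Lp ℂ 2 (vol Ω)))
    + ofL2 (q • w.fn : Lp ℂ 2 (vol Ω))

/-! ### Multiplication by smooth functions -/

/-- `a` is smooth on an open neighbourhood of the closure of `Ω`. -/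
def SmoothNear (Ω : Opens (EuclideanSpace ℝ (Fin n))) (a : EuclideanSpace ℝ (Fin n) → ℂ) : Prop :=
  ∃ U : Opens (EuclideanSpace ℝ (Fin n)),
    closure (Ω : Set (EuclideanSpace ℝ (Fin n))) ⊆ U ∧ ContDiffOn ℝ ∞ a U

lemma SmoothNear.contDiffAt {a : EuclideanSpace ℝ (Fin n) → ℂ} (ha : SmoothNear Ω a)
    {x : EuclideanSpace ℝ (Fin n)} (hx : x ∈ closure (Ω : Set (EuclideanSpace ℝ (Fin n)))) :
    ContDiffAt ℝ ∞ a x := by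
  obtain ⟨U, hU, h⟩ := ha
  exact h.contDiffAt (U.isOpen.mem_nhds (hU hx))

/-- The test function `a ψ`. -/
def mulTest (a : EuclideanSpace ℝ (Fin n) → ℂ) (ha : SmoothNear Ω a) :
    𝓓(Ω, ℂ) →ₗ[ℂ] 𝓓(Ω, ℂ) where
  toFun ψ :=
    { toFun := fun x => a x * ψ x
      contDiff' := by
        refine contDiff_iff_contDiffAt.2 fun x => ?_
        by_cases hx : x ∈ tsupport ψ
        · exact (ha.contDiffAt (subset_closure (ψ.tsupport_subset hx))).mul ψ.contDiff.contDiffAt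
        · refine (contDiffAt_const (c := (0 : ℂ))).congr_of_eventuallyEq ?_
          filter_upwards [notMem_tsupport_iff_eventuallyEq.1 hx] with y hy
          rw [hy, Pi.zero_apply, mul_zero]
      hasCompactSupport' := ψ.hasCompactSupport.mul_left
      tsupport_subset' := (tsupport_mul_subset_right (f := a)).trans ψ.tsupport_subset }
  map_add' ψ χ := by
    ext x
    exact mul_add _ _ _
  map_smul' c ψ := by
    ext x
    exact mul_left_comm _ _ _

lemma mulTest_apply {a : EuclideanSpace ℝ (Fin n) → ℂ} (ha : SmoothNear Ω a) (ψ : 𝓓(Ω, ℂ))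
    (x : EuclideanSpace ℝ (Fin n)) : mulTest a ha ψ x = a x * ψ x := rfl

/-- The product `a T` of a smooth function and a distribution: `⟨a T, ψ⟩ = ⟨T, a ψ⟩`. -/
def mulDist (a : EuclideanSpace ℝ (Fin n) → ℂ) (ha : SmoothNear Ω a) (T : Functional Ω) :
    Functional Ω := T ∘ₗ mulTest a ha

lemma memLp_top_of_continuousOn (hΩ : Bornology.IsBounded (Ω : Set (EuclideanSpace ℝ (Fin n))))
    {f : EuclideanSpace ℝ (Fin n) → ℂ}
    (hf : ContinuousOn f (closure (Ω : Set (EuclideanSpace ℝ (Fin n))))) :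
    MemLp f ∞ (vol Ω) := by
  obtain ⟨K, hK⟩ := hΩ.isCompact_closure.exists_bound_of_continuousOn hf
  refine memLp_top_of_bound
    ((hf.mono subset_closure).aestronglyMeasurable Ω.isOpen.measurableSet) K ?_
  filter_upwards [ae_restrict_mem Ω.isOpen.measurableSet] with x hx
  exact hK x (subset_closure hx)

lemma SmoothNear.memLp_top {a : EuclideanSpace ℝ (Fin n) → ℂ} (ha : SmoothNear Ω a)
    (hΩ : Bornology.IsBounded (Ω : Set (EuclideanSpace ℝ (Fin n)))) : MemLp a ∞ (vol Ω) :=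
  memLp_top_of_continuousOn hΩ fun _ hx => (ha.contDiffAt hx).continuousAt.continuousWithinAt

lemma SmoothNear.memLp_top_deriv {a : EuclideanSpace ℝ (Fin n) → ℂ} (ha : SmoothNear Ω a)
    (hΩ : Bornology.IsBounded (Ω : Set (EuclideanSpace ℝ (Fin n)))) (j : Fin n) :
    MemLp (fun x => (Complex.I)⁻¹ * fderiv ℝ a x (stdVec j)) ∞ (vol Ω) := by
  refine memLp_top_of_continuousOn hΩ fun x hx => ContinuousAt.continuousWithinAt ?_
  have h := (ha.contDiffAt hx).continuousAt_fderiv (by simp)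
  exact continuousAt_const.mul (h.clm_apply continuousAt_const)

/-- The product `a u ∈ H¹(Ω)` of `u ∈ H¹(Ω)` and a function `a` that is smooth near the closure of
the bounded set `Ω`, with `D_j (a u) = a D_j u + (D_j a) u`. -/
def mulH1 (hΩ : Bornology.IsBounded (Ω : Set (EuclideanSpace ℝ (Fin n))))
    (a : EuclideanSpace ℝ (Fin n) → ℂ) (ha : SmoothNear Ω a) (u : H1 Ω) : H1 Ω where
  fn := ((ha.memLp_top hΩ).toLp a • u.fn : Lp ℂ 2 (vol Ω))
  D j := ((ha.memLp_top hΩ).toLp a • u.D j : Lp ℂ 2 (vol Ω))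
    + ((ha.memLp_top_deriv hΩ j).toLp _ • u.fn : Lp ℂ 2 (vol Ω))
  distD_eq j := by
    have hm : ∀ (b : EuclideanSpace ℝ (Fin n) → ℂ) (hb : MemLp b ∞ (vol Ω)) (f : Lp ℂ 2 (vol Ω)),
        (hb.toLp b • f : Lp ℂ 2 (vol Ω)) =ᵐ[vol Ω] fun x => b x * f x := by
      intro b hb f
      filter_upwards [Lp.coeFn_lpSMul (r := 2) (hb.toLp b) f, hb.coeFn_toLp] with x h1 h2
      rw [h1, Pi.smul_apply', h2, smul_eq_mul]
    ext ψ
    have hu := LinearMap.congr_fun (u.distD_eq j) (mulTest a ha ψ)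
    change -(ofL2 u.fn (testD j (mulTest a ha ψ))) = _ at hu
    change -(ofL2 _ (testD j ψ)) = _
    rw [ofL2_apply, ofL2_apply] at hu ⊢
    set b : EuclideanSpace ℝ (Fin n) → ℂ := fun x => (Complex.I)⁻¹ * fderiv ℝ a x (stdVec j)
      with hb
    set f1 : Lp ℂ 2 (vol Ω) := (ha.memLp_top hΩ).toLp a • u.fn with hf1
    set f2 : Lp ℂ 2 (vol Ω) := (ha.memLp_top hΩ).toLp a • u.D j with hf2
    set f3 : Lp ℂ 2 (vol Ω) := (ha.memLp_top_deriv hΩ j).toLp _ • u.fn with hf3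
    have e1 : ∫ x, u.fn x * (testD j (mulTest a ha ψ)) x ∂(vol Ω)
        = ∫ x, f1 x * testD j ψ x ∂(vol Ω) + ∫ x, f3 x * ψ x ∂(vol Ω) := by
      rw [← integral_add (integrable_mul_test f1 _) (integrable_mul_test f3 _)]
      refine integral_congr_ae ?_
      filter_upwards [hm a (ha.memLp_top hΩ) u.fn, hm b (ha.memLp_top_deriv hΩ j) u.fn,
        ae_restrict_mem Ω.isOpen.measurableSet] with x h1 h3 hx
      have hda : DifferentiableAt ℝ a x :=
        (ha.contDiffAt (subset_closure hx)).differentiableAt (by simp)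
      have hfd : fderiv ℝ (mulTest a ha ψ) x = a x • fderiv ℝ ψ x + ψ x • fderiv ℝ a x :=
        fderiv_mul hda (testFunction_differentiableAt ψ x)
      rw [h1, h3, testD_apply, testD_apply, hfd, hb]
      simp only [add_apply, smul_apply, smul_eq_mul]
      ring
    have e2 : ∫ x, u.D j x * (mulTest a ha ψ) x ∂(vol Ω) = ∫ x, f2 x * ψ x ∂(vol Ω) := by
      refine integral_congr_ae ?_
      filter_upwards [hm a (ha.memLp_top hΩ) (u.D j)] with x h1
      rw [h1, mulTest_apply]
      ring
    have e3 : ∫ x, (f2 + f3) x * ψ x ∂(vol Ω)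
        = ∫ x, f2 x * ψ x ∂(vol Ω) + ∫ x, f3 x * ψ x ∂(vol Ω) := by
      rw [← integral_add (integrable_mul_test f2 _) (integrable_mul_test f3 _)]
      refine integral_congr_ae ?_
      filter_upwards [Lp.coeFn_add f2 f3] with x hx
      rw [hx, Pi.add_apply]
      ring
    rw [e1, e2] at hu
    rw [e3, ← hu]
    ring

/-! ### Limiting Carleman weights and the conjugated operator -/

/-- The semiclassical principal symbol
`p_φ(x, ξ) = |ξ|² + 2i ∇φ(x)·ξ - |∇φ(x)|²` of `e^{φ/h} (-h²Δ) e^{-φ/h}`. -/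
def carlemanSymbol (φ : EuclideanSpace ℝ (Fin n) → ℝ) (x ξ : EuclideanSpace ℝ (Fin n)) : ℂ :=
  ((‖ξ‖ ^ 2 : ℝ) : ℂ) + 2 * Complex.I * ((inner ℝ (gradient φ x) ξ : ℝ) : ℂ)
    - ((‖gradient φ x‖ ^ 2 : ℝ) : ℂ)

/-- The Poisson bracket `{a, b} = ∑_j (∂_{ξ_j} a ∂_{x_j} b - ∂_{x_j} a ∂_{ξ_j} b)` at `(x, ξ)`. -/
def poissonBracket (a b : EuclideanSpace ℝ (Fin n) → EuclideanSpace ℝ (Fin n) → ℝ)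
    (x ξ : EuclideanSpace ℝ (Fin n)) : ℝ :=
  ∑ j, (fderiv ℝ (fun η => a x η) ξ (stdVec j) * fderiv ℝ (fun y => b y ξ) x (stdVec j)
    - fderiv ℝ (fun y => a y ξ) x (stdVec j) * fderiv ℝ (fun η => b x η) ξ (stdVec j))

/-- `φ ∈ C^∞(U, ℝ)` is a limiting Carleman weight for `-h²Δ` on the open set `U`. -/
structure IsLimitingCarlemanWeight (U : Opens (EuclideanSpace ℝ (Fin n)))
    (φ : EuclideanSpace ℝ (Fin n) → ℝ) : Prop where
  smooth : ContDiffOn ℝ ∞ φ U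
  gradient_ne_zero : ∀ x ∈ U, gradient φ x ≠ 0
  poissonBracket_eq_zero : ∀ x ∈ U, ∀ ξ : EuclideanSpace ℝ (Fin n), carlemanSymbol φ x ξ = 0 →
    poissonBracket (fun y η => (carlemanSymbol φ y η).re) (fun y η => (carlemanSymbol φ y η).im)
      x ξ = 0

/-- The function `e^{t φ}`. -/
def expWeight (φ : EuclideanSpace ℝ (Fin n) → ℝ) (t : ℝ) (x : EuclideanSpace ℝ (Fin n)) : ℂ :=
  ((Real.exp (t * φ x) : ℝ) : ℂ)

lemma smoothNear_expWeight {U : Opens (EuclideanSpace ℝ (Fin n))}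
    (hU : closure (Ω : Set (EuclideanSpace ℝ (Fin n))) ⊆ U)
    {φ : EuclideanSpace ℝ (Fin n) → ℝ} (hφ : ContDiffOn ℝ ∞ φ U) (t : ℝ) :
    SmoothNear Ω (expWeight φ t) :=
  ⟨U, hU, Complex.ofRealCLM.contDiff.comp_contDiffOn
    (Real.contDiff_exp.comp_contDiffOn (contDiffOn_const.mul hφ))⟩

/-- The conjugated operator `e^{φ/h} (h² L_{A,q}) e^{-φ/h}` applied to `u ∈ H¹(Ω)`,
as a distribution on `Ω`; here `Ω` is bounded and `φ` is smooth on an open set `U` containing the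
closure of `Ω`. -/
def conjugatedOp (hΩ : Bornology.IsBounded (Ω : Set (EuclideanSpace ℝ (Fin n))))
    {U : Opens (EuclideanSpace ℝ (Fin n))}
    (hU : closure (Ω : Set (EuclideanSpace ℝ (Fin n))) ⊆ U)
    {φ : EuclideanSpace ℝ (Fin n) → ℝ} (hφ : ContDiffOn ℝ ∞ φ U)
    (A : Fin n → Lp ℂ ∞ (vol Ω)) (q : Lp ℂ ∞ (vol Ω)) (h : ℝ) (u : H1 Ω) : Functional Ω :=
  mulDist (expWeight φ (1 / h)) (smoothNear_expWeight hU hφ _)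
    ((h ^ 2 : ℂ) • magneticOp A q
      (mulH1 hΩ (expWeight φ (-1 / h)) (smoothNear_expWeight hU hφ _) u))

end MagneticSchrodinger

end

open Set MeasureTheory TopologicalSpace
open scoped Distributions ContDiff ENNReal

noncomputable section

namespace MagneticSchrodinger

/-! The equation is solved by duality. Paired with a test function θ, the operator `e^{φ/h} (-h²Δ)
e^{-φ/h}` becomes `P_ψ = e^{ψ/h} (-h²Δ) e^{-ψ/h}` acting on θ, with ψ = -φ, so an a priori bound for
`P_ψ` on test functions yields solutions. A bound of size 1/h alone is not enough: in weak form the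
magnetic terms are O(h), and O(h) · O(1/h) need not be small. The weight is therefore convexified to
ψ = f + (h/ε) f²/2, with f = -φ near the closure of Ω, which gains a factor √ε.

Carleman estimate (`carleman_estimate_real`). Write `P_ψ = S + K` with S symmetric and K
antisymmetric, so that `∫ (S u + K u)²` contains the commutator term `∫ 2 (S u)(K u)`, a quadratic
form in the Hessian of ψ. The bracket condition determines the Hessian of f on vectors orthogonal to
∇f: it is -ν|p|², where ν|∇f|² = f''(∇f, ∇f) (`lcwIdentity_of_bracket`). Hence the commutator is a
multiple of |h∇u|² - |∇ψ|²u², which Green's identity trades for S u, plus a term containing ∇f·h∇u,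
which K u controls, plus terms of nonnegative sign from the convexification, one of them of size
(h²/ε) u². For small ε that one absorbs all O(h²) u² errors. The result is ‖θ‖ ≤ C(√ε/h)‖P_ψ θ‖ in
L².

From L² to H¹ (`exists_conjLap_solution`). Riesz representation writes v in H⁻¹ as (1 - h²Δ)u₀ with
u₀ in H¹. The transpose of `P_ψ` differs from 1 - h²Δ by an operator of order one, so the error left
by u₀ is in L². It is extended by zero to a larger set Ω' and solved there in L² by the Carleman
estimate. Testing the equation with χη, where (1 - h²Δ)η = hD_jθ and χ = 1 on Ω, bounds the
derivatives of that solution on Ω (`norm_integral_mul_testD_le`).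

Conclusion. The solution norm is O(√ε/h) and the magnetic terms are O(h), both with constants
independent of ε; once ε is small, successive approximation (`exists_solution_of_approximate`)
solves the magnetic equation. Now ε is fixed and `e^{ψ/h} = e^{f/h} e^{σ}` with σ = f²/(2ε)
independent of h, so removing the convexification costs only a constant (`conjugatedOp_mulH1`,
`exists_mulH1_bound`). -/

/-! ### Partial derivatives of smooth functions -/

/-- `ℝⁿ` with its Euclidean norm. -/
abbrev Euc (n : ℕ) : Type := EuclideanSpace ℝ (Fin n)

/-- The partial derivative `∂_j f`. -/
def pd {n : ℕ} {F : Type*} [NormedAddCommGroup F] [NormedSpace ℝ F] (j : Fin n) (f : Euc n → F) :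
    Euc n → F := fun x => fderiv ℝ f x (stdVec j)

section Calculus

variable {n : ℕ} {R : Type*} [NormedCommRing R] [NormedAlgebra ℝ R]

lemma contDiff_pd {F : Type*} [NormedAddCommGroup F] [NormedSpace ℝ F]
    {f : Euc n → F}
    (hf : ContDiff ℝ ∞ f) (j : Fin n) : ContDiff ℝ ∞ (pd j f) :=
  (hf.fderiv_right (m := ∞) (by simp)).clm_apply contDiff_const

lemma differentiableAt_of_contDiff {F : Type*} [NormedAddCommGroup F] [NormedSpace ℝ F]
    {f : Euc n → F}
    (hf : ContDiff ℝ ∞ f) (x : Euc n) : DifferentiableAt ℝ f x :=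
  (hf.differentiable (by simp)).differentiableAt

lemma pd_mul {f g : Euc n → R} (hf : ContDiff ℝ ∞ f) (hg : ContDiff ℝ ∞ g) (j : Fin n)
    (x : Euc n) : pd j (fun y => f y * g y) x = pd j f x * g x + f x * pd j g x := by
  have := fderiv_fun_mul (differentiableAt_of_contDiff hf x) (differentiableAt_of_contDiff hg x)
  simp only [pd, this, add_apply, smul_apply, smul_eq_mul]
  ring

lemma pd_add {F : Type*} [NormedAddCommGroup F] [NormedSpace ℝ F] {f g : Euc n → F}
    (hf : ContDiff ℝ ∞ f) (hg : ContDiff ℝ ∞ g) (j : Fin n)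
    (x : Euc n) : pd j (fun y => f y + g y) x = pd j f x + pd j g x := by
  simp only [pd, fderiv_fun_add (differentiableAt_of_contDiff hf x)
    (differentiableAt_of_contDiff hg x), add_apply]

lemma pd_sub {F : Type*} [NormedAddCommGroup F] [NormedSpace ℝ F] {f g : Euc n → F}
    (hf : ContDiff ℝ ∞ f) (hg : ContDiff ℝ ∞ g) (j : Fin n)
    (x : Euc n) : pd j (fun y => f y - g y) x = pd j f x - pd j g x := by
  simp only [pd, fderiv_fun_sub (differentiableAt_of_contDiff hf x)
    (differentiableAt_of_contDiff hg x), sub_apply]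

lemma pd_neg {F : Type*} [NormedAddCommGroup F] [NormedSpace ℝ F] (f : Euc n → F) (j : Fin n)
    (x : Euc n) : pd j (fun y => -f y) x = -pd j f x := by
  simp only [pd, fderiv_fun_neg, neg_apply]

lemma pd_const_mul {f : Euc n → R} (hf : ContDiff ℝ ∞ f) (c : R) (j : Fin n) (x : Euc n) :
    pd j (fun y => c * f y) x = c * pd j f x := by
  simp only [pd, fderiv_const_mul (differentiableAt_of_contDiff hf x), smul_apply, smul_eq_mul]

lemma pd_sum {F : Type*} [NormedAddCommGroup F] [NormedSpace ℝ F] {ι : Type*} (s : Finset ι)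
    {f : ι → Euc n → F} (hf : ∀ i, ContDiff ℝ ∞ (f i)) (j : Fin n)
    (x : Euc n) : pd j (fun y => ∑ i ∈ s, f i y) x = ∑ i ∈ s, pd j (f i) x := by
  simp only [pd, fderiv_fun_sum (fun i _ => differentiableAt_of_contDiff (hf i) x), sum_apply]

lemma pd_comm {F : Type*} [NormedAddCommGroup F] [NormedSpace ℝ F]
    {f : Euc n → F}
    (hf : ContDiff ℝ ∞ f) (j k : Fin n) (x : Euc n) : pd j (pd k f) x = pd k (pd j f) x := by
  have hd : DifferentiableAt ℝ (fderiv ℝ f) x :=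
    differentiableAt_of_contDiff (hf.fderiv_right (m := ∞) (by simp)) x
  have h : ∀ v : Euc n, fderiv ℝ (fun y => fderiv ℝ f y v) x
      = (fderiv ℝ (fderiv ℝ f) x).flip v := by
    intro v
    rw [fderiv_clm_apply hd (differentiableAt_const v)]
    simp
  change fderiv ℝ (fun y => fderiv ℝ f y (stdVec k)) x (stdVec j)
    = fderiv ℝ (fun y => fderiv ℝ f y (stdVec j)) x (stdVec k)
  rw [h, h]
  refine (hf.contDiffAt.isSymmSndFDerivAt ?_) _ _
  rw [minSmoothness_of_isRCLikeNormedField]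
  exact WithTop.coe_le_coe.2 le_top

lemma tsupport_pd_subset {F : Type*} [NormedAddCommGroup F] [NormedSpace ℝ F] (f : Euc n → F)
    (j : Fin n) : tsupport (pd j f) ⊆ tsupport f := by
  refine closure_minimal ?_ (isClosed_tsupport f)
  intro x hx
  by_contra h
  apply hx
  have : f =ᶠ[nhds x] fun _ => 0 := notMem_tsupport_iff_eventuallyEq.1 h
  simp [pd, this.fderiv_eq]

lemma hasCompactSupport_pd {F : Type*} [NormedAddCommGroup F] [NormedSpace ℝ F]
    {f : Euc n → F}
    (hf : HasCompactSupport f) (j : Fin n) : HasCompactSupport (pd j f) :=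
  hf.of_isClosed_subset (isClosed_tsupport _) (tsupport_pd_subset f j)

lemma integral_pd_eq_zero {f : Euc n → ℝ} (hf : ContDiff ℝ ∞ f)
    (hc : HasCompactSupport f) (j : Fin n) : ∫ x, pd j f x = 0 := by
  have hi : Integrable f := hf.continuous.integrable_of_hasCompactSupport hc
  have hi' : Integrable (pd j f) :=
    (contDiff_pd hf j).continuous.integrable_of_hasCompactSupport (hasCompactSupport_pd hc j)
  have := integral_mul_fderiv_eq_neg_fderiv_mul_of_integrable (μ := volume)
    (f := fun _ : Euc n => (1 : ℝ)) (g := f) (v := stdVec j) (by simp)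
    (by simp only [one_mul]; exact hi') (by simpa using hi) (fun x _ => differentiableAt_const _)
    (fun x _ => differentiableAt_of_contDiff hf x)
  simpa [pd] using this

/-- Integrable functions with vanishing integral. -/
def NullIntegral (f : Euc n → ℝ) : Prop := Integrable f ∧ ∫ x, f x = 0

lemma NullIntegral.add {f g : Euc n → ℝ} (hf : NullIntegral f) (hg : NullIntegral g) :
    NullIntegral fun x => f x + g x :=
  ⟨hf.1.add hg.1, by rw [integral_add hf.1 hg.1, hf.2, hg.2, add_zero]⟩

lemma NullIntegral.const_mul {f : Euc n → ℝ} (hf : NullIntegral f) (c : ℝ) :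
    NullIntegral fun x => c * f x :=
  ⟨hf.1.const_mul c, by rw [integral_const_mul, hf.2, mul_zero]⟩

lemma NullIntegral.sum {ι : Type*} (s : Finset ι) {f : ι → Euc n → ℝ}
    (hf : ∀ i, NullIntegral (f i)) : NullIntegral fun x => ∑ i ∈ s, f i x :=
  ⟨integrable_finsetSum _ fun i _ => (hf i).1, by
    rw [integral_finsetSum _ fun i _ => (hf i).1]
    exact Finset.sum_eq_zero fun i _ => (hf i).2⟩

lemma NullIntegral.congr {f g : Euc n → ℝ} (hf : NullIntegral f) (h : ∀ x, g x = f x) :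
    NullIntegral g := by
  rwa [show g = f from funext h]

lemma nullIntegral_pd {f : Euc n → ℝ} (hf : ContDiff ℝ ∞ f) (hc : HasCompactSupport f)
    (j : Fin n) : NullIntegral (pd j f) :=
  ⟨(contDiff_pd hf j).continuous.integrable_of_hasCompactSupport (hasCompactSupport_pd hc j),
    integral_pd_eq_zero hf hc j⟩

end Calculus

/-! ### Divergence identities for the conjugated Laplacian -/

section Identities

variable {n : ℕ} {u ψ g m : Euc n → ℝ}

/-- The integrand is -4 ∂_j(u_j ψ_k u_k) + 2 ∂_k(u_j² ψ_k); the weights -4 and 2 cancel the mixed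
derivative u_jk, so that only the Hessian of ψ survives next to the second derivative u_jj. -/
lemma nullIntegral_second_order_transport (hu : ContDiff ℝ ∞ u) (hc : HasCompactSupport u)
    (hψ : ContDiff ℝ ∞ ψ) (j k : Fin n) :
    NullIntegral fun x => -4 * pd j (pd j u) x * pd k ψ x * pd k u x
      - 4 * pd j u x * pd j (pd k ψ) x * pd k u x + 2 * pd k (pd k ψ) x * pd j u x ^ 2 := by
  have uj := contDiff_pd hu j
  have uk := contDiff_pd hu k
  have ψk := contDiff_pd hψ k
  have h1 := nullIntegral_pd (f := fun x => pd j u x * (pd k ψ x * pd k u x))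
    (uj.mul (ψk.mul uk)) ((hasCompactSupport_pd hc j).mul_right) j
  have h2 := nullIntegral_pd (f := fun x => pd j u x * (pd j u x * pd k ψ x))
    (uj.mul (uj.mul ψk)) ((hasCompactSupport_pd hc j).mul_right) k
  refine ((h1.const_mul (-4)).add (h2.const_mul 2)).congr fun x => ?_
  rw [pd_mul uj (ψk.mul uk), pd_mul ψk uk, pd_mul uj (uj.mul ψk), pd_mul uj ψk,
    pd_comm hu k j]
  ring

/-- The integrand is -2 ∂_j(u_j g u) + ∂_j(u² ∂_j g). It serves twice: with g = ∂_k²ψ in the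
commutator, and with g a multiplier in Green's identity. -/
lemma nullIntegral_second_order_potential (hu : ContDiff ℝ ∞ u) (hc : HasCompactSupport u)
    (hg : ContDiff ℝ ∞ g) (j : Fin n) :
    NullIntegral fun x => -2 * pd j (pd j u) x * g x * u x
      - 2 * g x * pd j u x ^ 2 + pd j (pd j g) x * u x ^ 2 := by
  have uj := contDiff_pd hu j
  have gj := contDiff_pd hg j
  have h1 := nullIntegral_pd (f := fun x => pd j u x * (g x * u x))
    (uj.mul (hg.mul hu)) ((hasCompactSupport_pd hc j).mul_right) j
  have h2 := nullIntegral_pd (f := fun x => u x * (u x * pd j g x))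
    (hu.mul (hu.mul gj)) (hc.mul_right) j
  refine ((h1.const_mul (-2)).add (h2.const_mul 1)).congr fun x => ?_
  rw [pd_mul uj (hg.mul hu), pd_mul hg hu, pd_mul hu (hu.mul gj), pd_mul hu gj]
  ring

/-- The integrand is -2 ∂_k(u² g ∂_kψ). With g = |∇ψ|² it produces the term ψ''(∇ψ, ∇ψ) u² of the
commutator. -/
lemma nullIntegral_zero_order_transport (hu : ContDiff ℝ ∞ u) (hc : HasCompactSupport u)
    (hψ : ContDiff ℝ ∞ ψ) (hg : ContDiff ℝ ∞ g) (k : Fin n) :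
    NullIntegral fun x => -4 * g x * pd k ψ x * pd k u x * u x
      - 2 * g x * pd k (pd k ψ) x * u x ^ 2 - 2 * pd k g x * pd k ψ x * u x ^ 2 := by
  have ψk := contDiff_pd hψ k
  have h1 := nullIntegral_pd (f := fun x => u x * (u x * (g x * pd k ψ x)))
    (hu.mul (hu.mul (hg.mul ψk))) (hc.mul_right) k
  refine (h1.const_mul (-2)).congr fun x => ?_
  rw [pd_mul hu (hu.mul (hg.mul ψk)), pd_mul hu (hg.mul ψk), pd_mul hg ψk]
  ring

/-- The squared length of the gradient. -/
def gradSq (ψ : Euc n → ℝ) (x : Euc n) : ℝ := ∑ j, pd j ψ x ^ 2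

/-- The Laplacian. -/
def lap {F : Type*} [NormedAddCommGroup F] [NormedSpace ℝ F] (ψ : Euc n → F) (x : Euc n) : F :=
  ∑ j, pd j (pd j ψ) x

/-- The Hessian quadratic form. -/
def hess (ψ : Euc n → ℝ) (x : Euc n) (p q : Fin n → ℝ) : ℝ :=
  ∑ j, ∑ k, pd j (pd k ψ) x * p j * q k

/-- The symmetric part of `e^{ψ/h} (-h²Δ) e^{-ψ/h}`. -/
def conjSym (ψ : Euc n → ℝ) (h : ℝ) (u : Euc n → ℝ) (x : Euc n) : ℝ :=
  -h ^ 2 * lap u x - gradSq ψ x * u x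

/-- The antisymmetric part of `e^{ψ/h} (-h²Δ) e^{-ψ/h}`. -/
def conjSkew (ψ : Euc n → ℝ) (h : ℝ) (u : Euc n → ℝ) (x : Euc n) : ℝ :=
  h * (2 * ∑ j, pd j ψ x * pd j u x + lap ψ x * u x)

lemma contDiff_gradSq (hψ : ContDiff ℝ ∞ ψ) : ContDiff ℝ ∞ (gradSq ψ) :=
  ContDiff.sum fun j _ => (contDiff_pd hψ j).pow 2

lemma contDiff_lap {F : Type*} [NormedAddCommGroup F] [NormedSpace ℝ F]
    {f : Euc n → F}
    (hf : ContDiff ℝ ∞ f) : ContDiff ℝ ∞ (lap f) :=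
  ContDiff.sum fun j _ => contDiff_pd (contDiff_pd hf j) j

lemma pd_gradSq (hψ : ContDiff ℝ ∞ ψ) (k : Fin n) (x : Euc n) :
    pd k (gradSq ψ) x = 2 * ∑ j, pd j ψ x * pd j (pd k ψ) x := by
  have : gradSq ψ = fun y => ∑ j, pd j ψ y * pd j ψ y := by
    funext y; simp [gradSq, sq]
  rw [this, pd_sum _ fun i => (contDiff_pd hψ i).mul (contDiff_pd hψ i), Finset.mul_sum]
  refine Finset.sum_congr rfl fun j _ => ?_
  rw [pd_mul (contDiff_pd hψ j) (contDiff_pd hψ j), pd_comm hψ k j]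
  ring

lemma lap_lap_eq (hψ : ContDiff ℝ ∞ ψ) (x : Euc n) :
    lap (lap ψ) x = ∑ j, ∑ k, pd j (pd j (pd k (pd k ψ))) x := by
  have h2 : ∀ k, ContDiff ℝ ∞ (pd k (pd k ψ)) := fun k => contDiff_pd (contDiff_pd hψ k) k
  refine Finset.sum_congr rfl fun j _ => ?_
  have : pd j (lap ψ) = fun y => ∑ k, pd j (pd k (pd k ψ)) y := by
    funext y
    exact pd_sum _ h2 j y
  rw [this, pd_sum _ fun k => contDiff_pd (h2 k) j]

/-- The commutator identity: twice the product of the symmetric and the antisymmetric part. -/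
lemma nullIntegral_conjSym_mul_conjSkew (hu : ContDiff ℝ ∞ u) (hc : HasCompactSupport u)
    (hψ : ContDiff ℝ ∞ ψ) (h : ℝ) :
    NullIntegral fun x => 2 * conjSym ψ h u x * conjSkew ψ h u x
      - h * (4 * h ^ 2 * hess ψ x (fun j => pd j u x) (fun j => pd j u x)
        + 4 * hess ψ x (fun j => pd j ψ x) (fun j => pd j ψ x) * u x ^ 2
        - h ^ 2 * lap (lap ψ) x * u x ^ 2) := by
  have h2 : ∀ k, ContDiff ℝ ∞ (pd k (pd k ψ)) := fun k => contDiff_pd (contDiff_pd hψ k) k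
  -- The factor h³ belongs to -h²Δu times the antisymmetric part, the factor h to -|∇ψ|²u times it.
  -- In the h³ group the terms ∂_k²ψ (∂_j u)² of the two divergences cancel.
  have key := ((NullIntegral.sum Finset.univ fun j => NullIntegral.sum Finset.univ fun k =>
    (nullIntegral_second_order_transport hu hc hψ j k).add
      (nullIntegral_second_order_potential hu hc (h2 k) j)).const_mul (h ^ 3)).add
    ((NullIntegral.sum Finset.univ fun k =>
      nullIntegral_zero_order_transport hu hc hψ (contDiff_gradSq hψ) k).const_mul h)
  refine key.congr fun x => ?_
  have e1 : ∑ j, ∑ k, (-4 * pd j (pd j u) x * pd k ψ x * pd k u x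
      - 4 * pd j u x * pd j (pd k ψ) x * pd k u x + 2 * pd k (pd k ψ) x * pd j u x ^ 2
      + (-2 * pd j (pd j u) x * pd k (pd k ψ) x * u x - 2 * pd k (pd k ψ) x * pd j u x ^ 2
        + pd j (pd j (pd k (pd k ψ))) x * u x ^ 2))
      = -4 * lap u x * (∑ k, pd k ψ x * pd k u x) - 2 * lap u x * lap ψ x * u x
        - 4 * hess ψ x (fun j => pd j u x) (fun j => pd j u x) + lap (lap ψ) x * u x ^ 2 := by
    have h1 : lap u x * (∑ k, pd k ψ x * pd k u x)
        = ∑ j, ∑ k, pd j (pd j u) x * (pd k ψ x * pd k u x) := Finset.sum_mul_sum ..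
    have h2 : lap u x * lap ψ x = ∑ j, ∑ k, pd j (pd j u) x * pd k (pd k ψ) x :=
      Finset.sum_mul_sum ..
    rw [lap_lap_eq hψ, mul_assoc (-4 : ℝ), mul_assoc (2 : ℝ), h1, h2, hess]
    simp only [Finset.mul_sum, Finset.sum_mul, ← Finset.sum_sub_distrib,
      ← Finset.sum_add_distrib]
    refine Finset.sum_congr rfl fun j _ => Finset.sum_congr rfl fun k _ => ?_
    ring
  have e2 : ∑ k, (-4 * gradSq ψ x * pd k ψ x * pd k u x * u x
      - 2 * gradSq ψ x * pd k (pd k ψ) x * u x ^ 2 - 2 * pd k (gradSq ψ) x * pd k ψ x * u x ^ 2)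
      = -4 * gradSq ψ x * (∑ k, pd k ψ x * pd k u x) * u x - 2 * gradSq ψ x * lap ψ x * u x ^ 2
        - 4 * hess ψ x (fun j => pd j ψ x) (fun j => pd j ψ x) * u x ^ 2 := by
    have h1 : hess ψ x (fun j => pd j ψ x) (fun j => pd j ψ x)
        = ∑ k, ∑ j, pd j (pd k ψ) x * pd j ψ x * pd k ψ x := Finset.sum_comm
    rw [h1, lap]
    simp only [pd_gradSq hψ, Finset.mul_sum, Finset.sum_mul, ← Finset.sum_sub_distrib]
    refine Finset.sum_congr rfl fun k _ => congrArg₂ _ (by ring) ?_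
    refine Finset.sum_congr rfl fun j _ => ?_
    ring
  rw [e1, e2, conjSym, conjSkew]
  ring

/-- Green's identity with a real multiplier `m`. -/
lemma nullIntegral_conjSym_mul (hu : ContDiff ℝ ∞ u) (hc : HasCompactSupport u)
    (hm : ContDiff ℝ ∞ m) (h : ℝ) :
    NullIntegral fun x => m x * (h ^ 2 * (∑ j, pd j u x ^ 2) - gradSq ψ x * u x ^ 2)
      - (m x * conjSym ψ h u x * u x + h ^ 2 / 2 * lap m x * u x ^ 2) := by
  refine ((NullIntegral.sum Finset.univ fun j =>
    nullIntegral_second_order_potential hu hc hm j).const_mul (-h ^ 2 / 2)).congr fun x => ?_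
  have e : ∑ j, (-2 * pd j (pd j u) x * m x * u x - 2 * m x * pd j u x ^ 2
      + pd j (pd j m) x * u x ^ 2)
      = -2 * lap u x * m x * u x - 2 * m x * (∑ j, pd j u x ^ 2) + lap m x * u x ^ 2 := by
    simp only [lap, Finset.mul_sum, Finset.sum_mul, ← Finset.sum_sub_distrib,
      ← Finset.sum_add_distrib]
  rw [e, conjSym]
  ring

end Identities

/-! ### The Carleman estimate with a convexified weight -/

section Carleman

variable {n : ℕ}

/-- The convexified weight `φ + κ φ² / 2`. -/
def convexify (φ : Euc n → ℝ) (κ : ℝ) (x : Euc n) : ℝ := φ x + κ * (1 / 2 * (φ x * φ x))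

lemma contDiff_convexify {φ : Euc n → ℝ} (hφ : ContDiff ℝ ∞ φ) (κ : ℝ) :
    ContDiff ℝ ∞ (convexify φ κ) :=
  hφ.add (contDiff_const.mul (contDiff_const.mul (hφ.mul hφ)))

lemma pd_convexify {φ : Euc n → ℝ} (hφ : ContDiff ℝ ∞ φ) (κ : ℝ) (j : Fin n) (x : Euc n) :
    pd j (convexify φ κ) x = (1 + κ * φ x) * pd j φ x := by
  unfold convexify
  rw [pd_add hφ (contDiff_const.mul (contDiff_const.mul (hφ.mul hφ))),
    pd_const_mul (contDiff_const.mul (hφ.mul hφ)), pd_const_mul (hφ.mul hφ), pd_mul hφ hφ]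
  ring

lemma pd_pd_convexify {φ : Euc n → ℝ} (hφ : ContDiff ℝ ∞ φ) (κ : ℝ) (j k : Fin n) (x : Euc n) :
    pd j (pd k (convexify φ κ)) x
      = (1 + κ * φ x) * pd j (pd k φ) x + κ * (pd j φ x * pd k φ x) := by
  have hc : ContDiff ℝ ∞ fun x => 1 + κ * φ x := contDiff_const.add (contDiff_const.mul hφ)
  rw [show pd k (convexify φ κ) = fun y => (1 + κ * φ y) * pd k φ y from
    funext fun y => pd_convexify hφ κ k y, pd_mul hc (contDiff_pd hφ k),
    pd_add contDiff_const (contDiff_const.mul hφ), pd_const_mul hφ]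
  simp only [pd, fderiv_const_apply, zero_apply]
  ring

lemma lap_add_const_mul {f g : Euc n → ℝ} (hf : ContDiff ℝ ∞ f) (hg : ContDiff ℝ ∞ g) (κ : ℝ) :
    lap (fun y => f y + κ * g y) = fun y => lap f y + κ * lap g y := by
  funext x
  have h1 : ∀ j, pd j (fun y => f y + κ * g y) = fun y => pd j f y + κ * pd j g y := fun j => by
    funext y
    rw [pd_add hf (contDiff_const.mul hg), pd_const_mul hg]
  simp only [lap, h1]
  simp only [Finset.mul_sum, ← Finset.sum_add_distrib]
  refine Finset.sum_congr rfl fun j _ => ?_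
  rw [pd_add (contDiff_pd hf j) (contDiff_const.mul (contDiff_pd hg j)),
    pd_const_mul (contDiff_pd hg j)]

lemma gradSq_convexify {φ : Euc n → ℝ} (hφ : ContDiff ℝ ∞ φ) (κ : ℝ) (x : Euc n) :
    gradSq (convexify φ κ) x = (1 + κ * φ x) ^ 2 * gradSq φ x := by
  simp only [gradSq, pd_convexify hφ, Finset.mul_sum, mul_pow]

/-- Differentiating the factor 1 + κφ produces the rank-one term, which is nonnegative on the
diagonal p = q. It is the only source of the gain in the Carleman estimate. -/
lemma hess_convexify {φ : Euc n → ℝ} (hφ : ContDiff ℝ ∞ φ) (κ : ℝ) (x : Euc n)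
    (p q : Fin n → ℝ) :
    hess (convexify φ κ) x p q = (1 + κ * φ x) * hess φ x p q
      + κ * (∑ j, pd j φ x * p j) * (∑ j, pd j φ x * q j) := by
  rw [mul_assoc κ, Finset.sum_mul_sum]
  simp only [hess, pd_pd_convexify hφ, Finset.mul_sum, ← Finset.sum_add_distrib]
  refine Finset.sum_congr rfl fun j _ => Finset.sum_congr rfl fun k _ => ?_
  ring

lemma hess_smul (φ : Euc n → ℝ) (x : Euc n) (a : ℝ) (p q : Fin n → ℝ) :
    hess φ x (fun j => a * p j) (fun j => a * q j) = a ^ 2 * hess φ x p q := by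
  simp only [hess, Finset.mul_sum]
  refine Finset.sum_congr rfl fun j _ => Finset.sum_congr rfl fun k _ => ?_
  ring

/-- The elementary inequality behind the Carleman estimate, at one point. -/
lemma carleman_pointwise {S K u Th Y Zh f ν G L B M b c ε h : ℝ} (hc : 0 < c) (hε : 0 < ε)
    (hh : 0 < h) (hh1 : h ≤ 1) (hb : 0 ≤ b) (hY : 0 ≤ Y) (hK : K = 2 * f * Th + h * L * u)
    (hZ : Zh ^ 2 ≤ b * Y) (hG : c ≤ G) (hf : 1 / 4 ≤ f ^ 2) (hL : L ^ 2 ≤ b) (hB : |B| ≤ b)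
    (hm : (-4 * ν * f) ^ 2 ≤ b) (hM : |M| ≤ b) (hg : f ^ 2 * G ≤ b)
    (hεb : ε * (3 * b + (16 * b / c ^ 2) ^ 2 + 16 * b / c ^ 2 * b) ≤ c ^ 2 / 2) :
    h ^ 2 / ε * (c ^ 2 / 2) * u ^ 2
      + (2 * S * K - h * (4 * (f * (-ν * Y + 2 * Th * Zh / G) + h / ε * Th ^ 2)
        + 4 * (f ^ 2 * (f * ν * G + h / ε * G ^ 2)) * u ^ 2 - h ^ 2 * B * u ^ 2))
      + h * (-4 * ν * f * (Y - f ^ 2 * G * u ^ 2)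
        - (-4 * ν * f * S * u + h ^ 2 / 2 * M * u ^ 2))
      - 16 * b / c ^ 2 * h ^ 2 * (Y - f ^ 2 * G * u ^ 2 - S * u)
      ≤ (S + K) ^ 2 := by
  -- In the application S and K are the two parts of the conjugated Laplacian at a point, Th =
  -- ∇φ·h∇u, Y = |h∇u|², Zh = φ''(∇φ, h∇u), f = 1 + κφ with κ = h/ε, G = |∇φ|², L = Δψ, B = Δ²ψ, M =
  -- Δ(-4νf). The three groups added on the left, after the first summand, then integrate to zero.
  have hGp : 0 < G := hc.trans_le hG
  -- The value of C comes from the cross term: 2 f Th = K - hLu, and completing the square costs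
  -- K²/2, h²bu²/2 and 16h²(Zh/G)², the last being at most C h² Y. Green's identity with the
  -- constant multiplier -C h² pays for C h² Y.
  set C := 16 * b / c ^ 2 with hC
  have hC0 : 0 ≤ C := by positivity
  set m := -4 * ν * f with hmdef
  -- the cross term
  have cross : -(1 / 2 * K ^ 2) - 1 / 2 * h ^ 2 * b * u ^ 2 - C * h ^ 2 * Y
      ≤ 8 * h * f * Th * Zh / G := by
    have e : 8 * h * f * Th * Zh / G = 4 * h * (K - h * L * u) * (Zh / G) := by
      rw [hK]; ring
    have h1 : (Zh / G) ^ 2 ≤ b * Y / c ^ 2 := by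
      rw [div_pow]
      gcongr
    have h2 : 16 * h ^ 2 * (Zh / G) ^ 2 ≤ C * h ^ 2 * Y := by
      calc 16 * h ^ 2 * (Zh / G) ^ 2 ≤ 16 * h ^ 2 * (b * Y / c ^ 2) := by gcongr
        _ = C * h ^ 2 * Y := by rw [hC]; ring
    have h3 : h ^ 2 * u ^ 2 * L ^ 2 ≤ h ^ 2 * u ^ 2 * b := by gcongr
    rw [e]
    linarith [sq_nonneg (1 / 2 * (K - h * L * u) + 4 * h * (Zh / G)), sq_nonneg (K + h * L * u)]
  -- Both Green identities leave a product of S and u. Each is absorbed by a quarter of S² and an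
  -- O(h²) u² error.
  have t1 : -(1 / 4 * S ^ 2) - h ^ 2 * b * u ^ 2 ≤ h * m * S * u := by
    have h3 : h ^ 2 * u ^ 2 * m ^ 2 ≤ h ^ 2 * u ^ 2 * b := by gcongr
    linarith [sq_nonneg (1 / 2 * S + h * m * u)]
  have t2 : -(1 / 4 * S ^ 2) - C ^ 2 * h ^ 2 * u ^ 2 ≤ -(C * h ^ 2 * (S * u)) := by
    have h3 : h ^ 2 * (h ^ 2 * (C ^ 2 * u ^ 2)) ≤ 1 * (h ^ 2 * (C ^ 2 * u ^ 2)) := by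
      gcongr; exact pow_le_one₀ hh.le hh1
    linarith [sq_nonneg (1 / 2 * S - C * h ^ 2 * u)]
  have t3 : h ^ 2 * h * B * u ^ 2 ≤ h ^ 2 * b * u ^ 2 := by
    have : h * B ≤ 1 * b := by
      calc h * B ≤ h * b := by gcongr; exact (le_abs_self B).trans hB
        _ ≤ 1 * b := by gcongr
    nlinarith [mul_nonneg (sq_nonneg h) (sq_nonneg u)]
  have t4 : -(h ^ 2 * b * u ^ 2) ≤ h ^ 2 * h * M * u ^ 2 := by
    have : -(1 * b) ≤ h * M := by
      have : h * (-M) ≤ 1 * b := by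
        calc h * (-M) ≤ h * b := by gcongr; exact (neg_le_abs M).trans hM
          _ ≤ 1 * b := by gcongr
      linarith
    nlinarith [mul_nonneg (sq_nonneg h) (sq_nonneg u)]
  have t5 : C * h ^ 2 * (f ^ 2 * G * u ^ 2) ≤ C * h ^ 2 * (b * u ^ 2) := by gcongr
  have t6 : 0 ≤ 4 * h * (h / ε) * Th ^ 2 := by positivity
  -- The gain from convexity, using f² ≥ 1/4 and G ≥ c. Half of it stays in the conclusion. The
  -- other half, in `t8`, pays for the accumulated errors (3b + C² + Cb) h²u² of the cross term and
  -- of `t1` to `t5`; this is the smallness condition on ε.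
  have t7 : h ^ 2 / ε * c ^ 2 * u ^ 2 ≤ 4 * h * (h / ε) * f ^ 2 * G ^ 2 * u ^ 2 := by
    have : c ^ 2 ≤ 4 * f ^ 2 * G ^ 2 := by
      have : c ^ 2 ≤ G ^ 2 := by gcongr
      nlinarith [sq_nonneg G]
    calc h ^ 2 / ε * c ^ 2 * u ^ 2 ≤ h ^ 2 / ε * (4 * f ^ 2 * G ^ 2) * u ^ 2 := by gcongr
      _ = _ := by ring
  have t8 : (3 * b + C ^ 2 + C * b) * (h ^ 2 * u ^ 2) ≤ h ^ 2 / ε * (c ^ 2 / 2) * u ^ 2 := by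
    have : 3 * b + C ^ 2 + C * b ≤ c ^ 2 / 2 / ε := by
      rw [le_div_iff₀ hε]; linarith
    calc (3 * b + C ^ 2 + C * b) * (h ^ 2 * u ^ 2) ≤ c ^ 2 / 2 / ε * (h ^ 2 * u ^ 2) := by gcongr
      _ = _ := by ring
  have hfin : h * (4 * (f * (2 * Th * Zh / G))) = 8 * h * f * Th * Zh / G := by ring
  have hmm : h * (4 * (f * (-ν * Y))) + h * (4 * (f ^ 2 * (f * ν * G)) * u ^ 2)
      = h * (m * (Y - f ^ 2 * G * u ^ 2)) := by rw [hmdef]; ring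
  linarith [cross, t1, t2, t3, t4, t5, t6, t7, t8, hfin, hmm, sq_nonneg K, sq_nonneg S]

end Carleman

/-! ### The bracket condition as an identity for the Hessian, and the integrated estimate. -/

section Carleman

variable {n : ℕ}

/-- The pointwise algebraic form of the limiting Carleman weight condition: with `N = ∇φ`,
`|N|² φ''(p, p) = -ν |N|² |p|² + 2 (N·p) φ''(N, p)`. -/
def LCWIdentity (φ ν : Euc n → ℝ) (x : Euc n) : Prop :=
  ∀ p : Fin n → ℝ, gradSq φ x * hess φ x p p = -ν x * gradSq φ x * (∑ j, p j ^ 2)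
    + 2 * (∑ j, pd j φ x * p j) * hess φ x (fun j => pd j φ x) p

lemma sq_hess_le (φ : Euc n → ℝ) (x : Euc n) (q p : Fin n → ℝ) :
    hess φ x q p ^ 2 ≤ (∑ k, (∑ j, pd j (pd k φ) x * q j) ^ 2) * ∑ k, p k ^ 2 := by
  have : hess φ x q p = ∑ k, (∑ j, pd j (pd k φ) x * q j) * p k := by
    rw [hess, Finset.sum_comm]
    simp only [Finset.sum_mul]
  rw [this]
  exact Finset.sum_mul_sq_le_sq_mul_sq _ _ _

lemma apply_eq_zero_of_notMem {F : Type*} [NormedAddCommGroup F] [NormedSpace ℝ F]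
    {f : Euc n → F} {x : Euc n} (hx : x ∉ tsupport f) :
    f x = 0 ∧ (∀ j, pd j f x = 0) ∧ ∀ j, pd j (pd j f) x = 0 :=
  ⟨image_eq_zero_of_notMem_tsupport hx,
    fun _ => image_eq_zero_of_notMem_tsupport fun h => hx (tsupport_pd_subset _ _ h),
    fun _ => image_eq_zero_of_notMem_tsupport fun h =>
      hx (tsupport_pd_subset _ _ (tsupport_pd_subset _ _ h))⟩

lemma hasCompactSupport_of_notMem {f : Euc n → ℝ} {u : Euc n → ℝ} (hu : HasCompactSupport u)
    (h : ∀ x, x ∉ tsupport u → f x = 0) : HasCompactSupport f :=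
  HasCompactSupport.intro hu fun x hx => h x hx

lemma contDiff_conjSym_add_conjSkew {u ψ : Euc n → ℝ} (hu : ContDiff ℝ ∞ u)
    (hψ : ContDiff ℝ ∞ ψ) (h : ℝ) :
    ContDiff ℝ ∞ fun x => conjSym ψ h u x + conjSkew ψ h u x := by
  have h1 : ContDiff ℝ ∞ fun x => ∑ j, pd j ψ x * pd j u x :=
    ContDiff.sum fun j _ => (contDiff_pd hψ j).mul (contDiff_pd hu j)
  unfold conjSym conjSkew
  exact ((contDiff_const.mul (contDiff_lap hu)).sub ((contDiff_gradSq hψ).mul hu)).add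
    (contDiff_const.mul ((contDiff_const.mul h1).add ((contDiff_lap hψ).mul hu)))

lemma gradSq_nonneg (φ : Euc n → ℝ) (x : Euc n) : 0 ≤ gradSq φ x :=
  Finset.sum_nonneg fun _ _ => sq_nonneg _

/-- A common bound on a compact set for all coefficients occurring in the Carleman estimate. -/
lemma exists_coefficient_bound {φ ν : Euc n → ℝ} (hφ : ContDiff ℝ ∞ φ) (hν : ContDiff ℝ ∞ ν)
    {K : Set (Euc n)} (hK : IsCompact K) :
    ∃ b : ℝ, 1 ≤ b ∧ ∀ κ : ℝ, 0 ≤ κ → κ * b ≤ 1 / 2 → ∀ x ∈ K,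
      1 / 4 ≤ (1 + κ * φ x) ^ 2 ∧ lap (convexify φ κ) x ^ 2 ≤ b ∧
      |lap (lap (convexify φ κ)) x| ≤ b ∧ (-4 * ν x * (1 + κ * φ x)) ^ 2 ≤ b ∧
      |lap (fun y => -4 * ν y * (1 + κ * φ y)) x| ≤ b ∧ (1 + κ * φ x) ^ 2 * gradSq φ x ≤ b ∧
      (∑ k, (∑ j, pd j (pd k φ) x * pd j φ x) ^ 2) ≤ b := by
  set g : Euc n → ℝ := fun x => 1 / 2 * (φ x * φ x) with hg
  have hgs : ContDiff ℝ ∞ g := contDiff_const.mul (hφ.mul hφ)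
  set m0 : Euc n → ℝ := fun x => -4 * ν x
  set m1 : Euc n → ℝ := fun x => -4 * ν x * φ x
  have hm0 : ContDiff ℝ ∞ m0 := contDiff_const.mul hν
  have hm1 : ContDiff ℝ ∞ m1 := hm0.mul hφ
  set w : Euc n → ℝ := fun x => ∑ k, (∑ j, pd j (pd k φ) x * pd j φ x) ^ 2
  have hw : ContDiff ℝ ∞ w := ContDiff.sum fun k _ => (ContDiff.sum fun j _ =>
    (contDiff_pd (contDiff_pd hφ k) j).mul (contDiff_pd hφ j)).pow 2
  -- The Laplacian and bi-Laplacian of the convexified weight, the multiplier -4ν(1 + κφ) and its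
  -- Laplacian are affine in κ, with coefficients from this list. It is therefore enough to bound
  -- the list on the compact set.
  set F : Fin 11 → Euc n → ℝ := ![lap φ, lap g, lap (lap φ), lap (lap g), m0, m1, lap m0, lap m1,
    gradSq φ, w, φ]
  have hF : ∀ i, ContDiff ℝ ∞ (F i) := by
    intro i
    fin_cases i
    exacts [contDiff_lap hφ, contDiff_lap hgs, contDiff_lap (contDiff_lap hφ),
      contDiff_lap (contDiff_lap hgs), hm0, hm1, contDiff_lap hm0, contDiff_lap hm1,
      contDiff_gradSq hφ, hw, hφ]
  have hFb : ∀ i, ∃ B, ∀ x ∈ K, ‖F i x‖ ≤ B := fun i =>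
    hK.exists_bound_of_continuousOn (hF i).continuous.continuousOn
  choose B hB using hFb
  set a : ℝ := 1 + ∑ i, |B i| with ha
  have ha1 : 1 ≤ a := le_add_of_nonneg_right (Finset.sum_nonneg fun _ _ => abs_nonneg _)
  have hFa : ∀ i, ∀ x ∈ K, |F i x| ≤ a := fun i x hx =>
    ((hB i x hx).trans (le_abs_self _)).trans
      ((Finset.single_le_sum (f := fun i => |B i|) (fun _ _ => abs_nonneg _)
        (Finset.mem_univ i)).trans (by linarith))
  -- An affine expression s + κt is at most 2a in absolute value and its square at most 4a². As 4a²
  -- dominates 1 and |φ|, the assumption κb ≤ 1/2 also gives κ ≤ 1 and |κφ| ≤ 1/2.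
  refine ⟨4 * a ^ 2, by nlinarith, fun κ hκ hκb x hx => ?_⟩
  have hκ1 : κ ≤ 1 := by nlinarith
  have two : ∀ s t : ℝ, |s| ≤ a → |t| ≤ a → |s + κ * t| ≤ 2 * a := fun s t hs ht => by
    calc |s + κ * t| ≤ |s| + |κ * t| := abs_add_le _ _
      _ = |s| + κ * |t| := by rw [abs_mul, abs_of_nonneg hκ]
      _ ≤ a + 1 * a := by gcongr
      _ = 2 * a := by ring
  have twosq : ∀ s t : ℝ, |s| ≤ a → |t| ≤ a → (s + κ * t) ^ 2 ≤ 4 * a ^ 2 := fun s t hs ht => by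
    rw [← sq_abs]
    calc |s + κ * t| ^ 2 ≤ (2 * a) ^ 2 := by gcongr; exact two s t hs ht
      _ = _ := by ring
  have le4 : 2 * a ≤ 4 * a ^ 2 := by nlinarith
  have hφa : |κ * φ x| ≤ 1 / 2 := by
    rw [abs_mul, abs_of_nonneg hκ]
    calc κ * |φ x| ≤ κ * (4 * a ^ 2) := by
          gcongr; exact (hFa 10 x hx).trans (by nlinarith)
      _ ≤ 1 / 2 := hκb
  obtain ⟨hφ1, hφ2⟩ := abs_le.1 hφa
  have e1 : lap (convexify φ κ) = fun y => lap φ y + κ * lap g y := lap_add_const_mul hφ hgs κ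
  have e2 : (fun y => -4 * ν y * (1 + κ * φ y)) = fun y => m0 y + κ * m1 y := by
    funext y; simp only [m0, m1]; ring
  have e3 : -4 * ν x * (1 + κ * φ x) = m0 x + κ * m1 x := congrFun e2 x
  refine ⟨by nlinarith, ?_, ?_, ?_, ?_, ?_, ?_⟩
  · rw [e1]; exact twosq _ _ (hFa 0 x hx) (hFa 1 x hx)
  · rw [e1, lap_add_const_mul (contDiff_lap hφ) (contDiff_lap hgs)]
    exact (two _ _ (hFa 2 x hx) (hFa 3 x hx)).trans le4
  · rw [e3]; exact twosq _ _ (hFa 4 x hx) (hFa 5 x hx)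
  · rw [e2, lap_add_const_mul hm0 hm1]
    exact (two _ _ (hFa 6 x hx) (hFa 7 x hx)).trans le4
  · have hGa : gradSq φ x ≤ a := (le_abs_self _).trans (hFa 8 x hx)
    calc (1 + κ * φ x) ^ 2 * gradSq φ x ≤ 4 * a := by
          gcongr
          · exact gradSq_nonneg φ x
          · nlinarith
      _ ≤ 4 * a ^ 2 := by nlinarith
  · exact ((le_abs_self _).trans (hFa 9 x hx)).trans (by nlinarith)

/-- The Carleman estimate for real functions, with a gain of `1 / ε` from convexification. -/
theorem carleman_estimate_real {φ ν : Euc n → ℝ} (hφ : ContDiff ℝ ∞ φ) (hν : ContDiff ℝ ∞ ν)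
    {K : Set (Euc n)} (hK : IsCompact K) {c : ℝ} (hc : 0 < c) (hG : ∀ x ∈ K, c ≤ gradSq φ x)
    (hid : ∀ x ∈ K, LCWIdentity φ ν x) :
    ∃ C : ℝ, 0 < C ∧ ∃ ε₀ : ℝ, 0 < ε₀ ∧ ∀ ε : ℝ, 0 < ε → ε ≤ ε₀ → ∃ h₀ : ℝ, 0 < h₀ ∧
      ∀ h : ℝ, 0 < h → h ≤ h₀ → ∀ u : Euc n → ℝ, ContDiff ℝ ∞ u → HasCompactSupport u →
        tsupport u ⊆ K → h ^ 2 / ε * ∫ x, u x ^ 2 ≤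
          C * ∫ x, (conjSym (convexify φ (h / ε)) h u x
            + conjSkew (convexify φ (h / ε)) h u x) ^ 2 := by
  obtain ⟨b, hb1, hb⟩ := exists_coefficient_bound hφ hν hK
  set D : ℝ := 3 * b + (16 * b / c ^ 2) ^ 2 + 16 * b / c ^ 2 * b with hD
  have hD0 : 0 < D := by positivity
  -- The constant 2/c² inverts the factor c²/2 left by the pointwise inequality, and ε₀ is its
  -- smallness condition on ε. The bound on h chosen next ensures h ≤ 1 and κb ≤ 1/2 for κ = h/ε.
  refine ⟨2 / c ^ 2, by positivity, c ^ 2 / 2 / D, by positivity, fun ε hε hεD => ?_⟩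
  refine ⟨min 1 (ε / (2 * b)), by positivity, fun h hh hh0 u hu huc huK => ?_⟩
  have hh1 : h ≤ 1 := hh0.trans (min_le_left _ _)
  have hκb : h / ε * b ≤ 1 / 2 := by
    have : h ≤ ε / (2 * b) := hh0.trans (min_le_right _ _)
    rw [le_div_iff₀ (by positivity)] at this
    rw [div_mul_eq_mul_div, div_le_iff₀ hε]
    linarith
  set κ := h / ε with hκ
  have hκ0 : 0 ≤ κ := by positivity
  have hεb : ε * D ≤ c ^ 2 / 2 := by rwa [le_div_iff₀ hD0] at hεD
  set ψ := convexify φ κ with hψdef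
  have hψ : ContDiff ℝ ∞ ψ := contDiff_convexify hφ κ
  set m : Euc n → ℝ := fun y => -4 * ν y * (1 + κ * φ y) with hm
  have hms : ContDiff ℝ ∞ m :=
    (contDiff_const.mul hν).mul (contDiff_const.add (contDiff_const.mul hφ))
  -- The commutator identity, Green's identity with multiplier m = -4ν(1 + κφ) times h (it removes
  -- the part of the Hessian form without a sign), and Green's identity with multiplier 1 times -C
  -- h² (it controls |h∇u|²).
  have N := ((nullIntegral_conjSym_mul_conjSkew hu huc hψ h).add
    ((nullIntegral_conjSym_mul (ψ := ψ) hu huc hms h).const_mul h)).add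
    ((nullIntegral_conjSym_mul (ψ := ψ) hu huc (contDiff_const (c := (1 : ℝ))) h).const_mul
      (-(16 * b / c ^ 2 * h ^ 2)))
  have hlap1 : ∀ x, lap (fun _ : Euc n => (1 : ℝ)) x = 0 := fun x => by
    have : ∀ j : Fin n, pd j (fun _ : Euc n => (1 : ℝ)) = fun _ => 0 := fun j => by
      funext y; simp [pd]
    simp [lap, this, pd]
  obtain ⟨d, hd, N⟩ : ∃ d, d = _ ∧ NullIntegral d := ⟨_, rfl, N⟩
  have main : ∀ x, h ^ 2 / ε * (c ^ 2 / 2) * u x ^ 2 + d x ≤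
      (conjSym ψ h u x + conjSkew ψ h u x) ^ 2 := by
    intro x
    rw [hd]
    beta_reduce
    by_cases hx : x ∈ tsupport u
    · have hxK := huK hx
      obtain ⟨b1, b2, b3, b4, b5, b6, b7⟩ := hb κ hκ0 hκb x hxK
      have hGx := hG x hxK
      have hGp : 0 < gradSq φ x := hc.trans_le hGx
      have hQ : ∀ p : Fin n → ℝ, hess φ x p p = -ν x * (∑ j, p j ^ 2)
          + 2 * (∑ j, pd j φ x * p j) * hess φ x (fun j => pd j φ x) p / gradSq φ x := by
        intro p
        field_simp
        linarith [hid x hxK p]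
      have hQN : hess φ x (fun j => pd j φ x) (fun j => pd j φ x) = ν x * gradSq φ x := by
        have h1 := hid x hxK (fun j => pd j φ x)
        have h2 : ∑ j, pd j φ x * pd j φ x = gradSq φ x := by simp [gradSq, sq]
        have h3 : ∑ j, pd j φ x ^ 2 = gradSq φ x := rfl
        rw [h2, h3] at h1
        have : gradSq φ x * hess φ x (fun j => pd j φ x) (fun j => pd j φ x)
          = gradSq φ x * (ν x * gradSq φ x) := by linarith
        exact mul_left_cancel₀ hGp.ne' this
      set p : Fin n → ℝ := fun j => h * pd j u x with hp
      have hpY : ∑ j, p j ^ 2 = h ^ 2 * ∑ j, pd j u x ^ 2 := by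
        simp only [hp, mul_pow, Finset.mul_sum]
      have hpT : ∑ j, pd j φ x * p j = h * ∑ j, pd j φ x * pd j u x := by
        simp only [hp, Finset.mul_sum]
        exact Finset.sum_congr rfl fun _ _ => by ring
      have key := carleman_pointwise (S := conjSym ψ h u x) (K := conjSkew ψ h u x) (u := u x)
        (Th := ∑ j, pd j φ x * p j) (Y := ∑ j, p j ^ 2)
        (Zh := hess φ x (fun j => pd j φ x) p) (f := 1 + κ * φ x) (ν := ν x) (G := gradSq φ x)
        (L := lap ψ x) (B := lap (lap ψ) x) (M := lap m x) (b := b) hc hε hh hh1 (by linarith)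
        (Finset.sum_nonneg fun _ _ => sq_nonneg _)
        (by
          rw [hpT, conjSkew, hψdef]
          simp only [pd_convexify hφ, mul_assoc, ← Finset.mul_sum]
          ring)
        ((sq_hess_le φ x _ p).trans (by gcongr)) hGx b1 b2 b3 b4 b5 b6 hεb
      refine le_trans (le_of_eq ?_) key
      have hH1 : h ^ 2 * hess ψ x (fun j => pd j u x) (fun j => pd j u x)
          = (1 + κ * φ x) * (-ν x * (∑ j, p j ^ 2)
          + 2 * (∑ j, pd j φ x * p j) * hess φ x (fun j => pd j φ x) p / gradSq φ x)
          + κ * (∑ j, pd j φ x * p j) ^ 2 := by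
        rw [← hQ, ← hess_smul, hψdef, hess_convexify hφ, sq, mul_assoc κ]
      have hH2 : hess ψ x (fun j => pd j ψ x) (fun j => pd j ψ x)
          = (1 + κ * φ x) ^ 2 * ((1 + κ * φ x) * ν x * gradSq φ x + κ * gradSq φ x ^ 2) := by
        have h2 : ∑ j, pd j φ x * pd j φ x = gradSq φ x := by simp [gradSq, sq]
        simp only [hψdef, pd_convexify hφ]
        rw [hess_smul, hess_convexify hφ, hQN, h2]
        ring
      rw [mul_assoc (4 : ℝ) (h ^ 2), hH1, hH2, hlap1, hψdef, gradSq_convexify hφ, ← hψdef, hpY]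
      simp only [hm]
      ring
    -- Off the support of u the weight hypotheses may fail, but there both sides of the inequality
    -- vanish.
    · obtain ⟨h0, h1, h2⟩ := apply_eq_zero_of_notMem hx
      have hS : conjSym ψ h u x = 0 := by simp [conjSym, lap, h0, h2]
      have hKz : conjSkew ψ h u x = 0 := by simp [conjSkew, h0, h1]
      rw [hS, hKz, h0]
      simp [h1, hess]
  have hi1 : Integrable fun x => u x ^ 2 :=
    (hu.pow 2).continuous.integrable_of_hasCompactSupport
      (hasCompactSupport_of_notMem huc fun x hx => by
        simp [(apply_eq_zero_of_notMem hx).1])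
  have hi2 : Integrable fun x => (conjSym ψ h u x + conjSkew ψ h u x) ^ 2 :=
    ((contDiff_conjSym_add_conjSkew hu hψ h).pow 2).continuous.integrable_of_hasCompactSupport
      (hasCompactSupport_of_notMem huc fun x hx => by
        obtain ⟨h0, h1, h2⟩ := apply_eq_zero_of_notMem hx
        simp [conjSym, conjSkew, lap, h0, h1, h2])
  have fin := integral_mono ((hi1.const_mul (h ^ 2 / ε * (c ^ 2 / 2))).add N.1) hi2 main
  simp only [Pi.add_apply] at fin
  rw [integral_add (hi1.const_mul _) N.1, N.2, add_zero, integral_const_mul] at fin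
  calc h ^ 2 / ε * ∫ x, u x ^ 2
      = 2 / c ^ 2 * (h ^ 2 / ε * (c ^ 2 / 2) * ∫ x, u x ^ 2) := by field_simp
    _ ≤ _ := by gcongr

end Carleman

/-! ### The semiclassical resolvent on Schwartz functions -/

section Resolvent

open FourierTransform Laplacian LineDeriv Real
open scoped SchwartzMap

variable {n : ℕ}

/-- The `L²` norm of a function, as a real number. -/
def l2 (μ : Measure (Euc n)) (f : Euc n → ℂ) : ℝ := (eLpNorm f 2 μ).toReal

lemma l2_nonneg (μ : Measure (Euc n)) (f : Euc n → ℂ) : 0 ≤ l2 μ f := ENNReal.toReal_nonneg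

lemma l2_schwartz (f : 𝓢(Euc n, ℂ)) : l2 volume f = ‖f.toLp 2‖ := SchwartzMap.norm_toLp.symm

lemma l2_le_of_norm_le {μ : Measure (Euc n)} {f g : Euc n → ℂ} (hg : MemLp g 2 μ) {c : ℝ}
    (hc : 0 ≤ c) (h : ∀ᵐ x ∂μ, ‖f x‖ ≤ c * ‖g x‖) : l2 μ f ≤ c * l2 μ g := by
  have := eLpNorm_le_mul_eLpNorm_of_ae_le_mul h 2
  have h2 := ENNReal.toReal_mono (ENNReal.mul_ne_top ENNReal.ofReal_ne_top hg.2.ne) this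
  rwa [ENNReal.toReal_mul, ENNReal.toReal_ofReal hc] at h2

lemma l2_fourier (f : 𝓢(Euc n, ℂ)) : l2 volume (𝓕 f : 𝓢(Euc n, ℂ)) = l2 volume f := by
  rw [l2_schwartz, l2_schwartz, SchwartzMap.norm_fourier_toL2_eq]

lemma l2_fourierMultiplier_le {g : Euc n → ℝ} (hg : g.HasTemperateGrowth) (hb : ∀ x, |g x| ≤ 1)
    (f : 𝓢(Euc n, ℂ)) : l2 volume (SchwartzMap.fourierMultiplierCLM ℂ g f) ≤ l2 volume f := by
  rw [← l2_fourier, ← l2_fourier f, SchwartzMap.fourierMultiplierCLM_apply,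
    FourierTransform.fourier_fourierInv_eq]
  have := l2_le_of_norm_le (μ := volume) (f := SchwartzMap.smulLeftCLM ℂ g (𝓕 f))
    (g := (𝓕 f : 𝓢(Euc n, ℂ))) ((𝓕 f : 𝓢(Euc n, ℂ)).memLp 2) zero_le_one
    (.of_forall fun x => by
      rw [SchwartzMap.smulLeftCLM_apply_apply hg, norm_smul]
      exact mul_le_mul_of_nonneg_right (hb x) (norm_nonneg _))
  rwa [one_mul] at this

lemma fourier_fourierMultiplier_apply {g : Euc n → ℝ} (hg : g.HasTemperateGrowth)
    (f : 𝓢(Euc n, ℂ)) (ξ : Euc n) :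
    (𝓕 (SchwartzMap.fourierMultiplierCLM ℂ g f : 𝓢(Euc n, ℂ)) : 𝓢(Euc n, ℂ)) ξ
      = g ξ • (𝓕 f : 𝓢(Euc n, ℂ)) ξ := by
  rw [SchwartzMap.fourierMultiplierCLM_apply, FourierTransform.fourier_fourierInv_eq,
    SchwartzMap.smulLeftCLM_apply_apply hg]

lemma lineDeriv_schwartz_apply (f : 𝓢(Euc n, ℂ)) (j : Fin n) (x : Euc n) :
    (∂_{stdVec j} f) x = pd j f x := SchwartzMap.lineDerivOp_apply_eq_fderiv ..

lemma laplacian_schwartz_apply (f : 𝓢(Euc n, ℂ)) (x : Euc n) : (Δ f) x = lap f x := by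
  rw [SchwartzMap.laplacian_eq_sum (EuclideanSpace.basisFun (Fin n) ℝ), lap, sum_apply]
  refine Finset.sum_congr rfl fun j _ => ?_
  rw [EuclideanSpace.basisFun_apply, lineDeriv_schwartz_apply]
  congr 1

/-- For a Schwartz function `θ`, the equation `(1 - h²Δ) η = h D_j θ` has a Schwartz solution whose
semiclassical `H¹` norm is controlled by the `L²` norm of `θ`. -/
lemma exists_resolvent (θ : 𝓢(Euc n, ℂ)) (h : ℝ) (j : Fin n) :
    ∃ η : 𝓢(Euc n, ℂ), (∀ x, η x - (h : ℂ) ^ 2 * lap η x = h * ((Complex.I)⁻¹ * pd j θ x)) ∧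
      l2 volume η ≤ l2 volume θ ∧ ∀ k, l2 volume (fun x => h * pd k η x) ≤ l2 volume θ := by
  -- With the normalization e^{-2πi x·ξ} of the Fourier transform, a is the symbol of hD_j and d
  -- that of (1 - h²Δ)⁻¹, so η is θ with the multiplier a d applied. Since |t| ≤ 1 + t², this
  -- multiplier is bounded by 1.
  set a : Euc n → ℝ := fun x => 2 * π * h * inner ℝ x (stdVec j) with ha
  set d : Euc n → ℝ := fun x => (1 + ‖(2 * π * h) • x‖ ^ 2) ^ (-1 : ℝ) with hd
  have hdt : d.HasTemperateGrowth :=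
    (Function.hasTemperateGrowth_one_add_norm_sq_rpow (Euc n) (-1)).comp
      (((2 * π * h) • ContinuousLinearMap.id ℝ (Euc n)).hasTemperateGrowth)
  have hit : ∀ k, (fun x : Euc n => inner ℝ x (stdVec k)).HasTemperateGrowth := fun k =>
    Function.hasTemperateGrowth_inner_left (stdVec k)
  have hat : a.HasTemperateGrowth := (Function.HasTemperateGrowth.const _).mul (hit j)
  have hnt : (fun x : Euc n => ‖x‖ ^ 2).HasTemperateGrowth :=
    Function.hasTemperateGrowth_norm_sq (H := Euc n)
  have hpos : ∀ x : Euc n, 0 < 1 + ‖(2 * π * h) • x‖ ^ 2 := fun x => by positivity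
  have hdx : ∀ x, d x = (1 + ‖(2 * π * h) • x‖ ^ 2)⁻¹ := fun x => Real.rpow_neg_one _
  have hin : ∀ (k : Fin n) (x : Euc n), |2 * π * h * inner ℝ x (stdVec k)| ≤ ‖(2 * π * h) • x‖ := by
    intro k x
    rw [← real_inner_smul_left]
    refine (abs_real_inner_le_norm _ _).trans_eq ?_
    simp
  have hab : ∀ x, |(a * d) x| ≤ 1 := fun x => by
    rw [Pi.mul_apply, abs_mul, hdx, abs_inv, abs_of_pos (hpos x), ← div_eq_mul_inv,
      div_le_one (hpos x)]
    nlinarith [hin j x, sq_nonneg (‖(2 * π * h) • x‖ - 1), norm_nonneg ((2 * π * h) • x)]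
  refine ⟨SchwartzMap.fourierMultiplierCLM ℂ (a * d) θ, ?_,
    l2_fourierMultiplier_le (hat.mul hdt) hab θ, ?_⟩
  · intro x
    have key : (SchwartzMap.fourierMultiplierCLM ℂ (a * d) θ : 𝓢(Euc n, ℂ))
        - (h : ℂ) ^ 2 • Δ (SchwartzMap.fourierMultiplierCLM ℂ (a * d) θ : 𝓢(Euc n, ℂ))
        = (h : ℂ) • (Complex.I)⁻¹ • ∂_{stdVec j} θ := by
      have hinj : Function.Injective (𝓕 : 𝓢(Euc n, ℂ) → 𝓢(Euc n, ℂ)) :=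
        (fourierEquiv ℂ 𝓢(Euc n, ℂ)).injective
      apply hinj
      ext ξ
      rw [SchwartzMap.laplacian_eq_fourierMultiplierCLM,
        SchwartzMap.lineDeriv_eq_fourierMultiplierCLM]
      simp only [sub_eq_add_neg, FourierTransform.fourier_add, FourierTransform.fourier_smul,
        FourierTransform.fourier_neg, neg_smul, neg_apply, add_apply, smul_apply]
      rw [fourier_fourierMultiplier_apply hnt, fourier_fourierMultiplier_apply (hat.mul hdt),
        fourier_fourierMultiplier_apply (hit j), Pi.mul_apply, hdx, ha]
      have hp := (hpos ξ).ne'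
      rw [norm_smul, mul_pow, Real.norm_eq_abs, sq_abs] at hp ⊢
      have hp' : (1 + (2 * π * h) ^ 2 * (‖ξ‖ : ℂ) ^ 2) ≠ 0 := by exact_mod_cast hp
      simp only [Complex.real_smul, smul_eq_mul]
      push_cast
      rw [Complex.inv_I]
      linear_combination (2 * π * h * ((inner ℝ ξ (stdVec j) : ℝ) : ℂ)
        * (𝓕 θ : 𝓢(Euc n, ℂ)) ξ) * (mul_inv_cancel₀ hp')
        + (2 * π * h * ((inner ℝ ξ (stdVec j) : ℝ) : ℂ) * (𝓕 θ : 𝓢(Euc n, ℂ)) ξ) * Complex.I_sq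
    have := congrArg (fun f : 𝓢(Euc n, ℂ) => f x) key
    simpa only [sub_apply, smul_apply, smul_eq_mul, laplacian_schwartz_apply,
      lineDeriv_schwartz_apply] using this
  · intro k
    set ak : Euc n → ℝ := fun x => 2 * π * h * inner ℝ x (stdVec k) with hak
    have hakt : ak.HasTemperateGrowth := (Function.HasTemperateGrowth.const _).mul (hit k)
    -- One more factor hD_k is affordable: |st| ≤ 1 + r² when |s| and |t| are at most r.
    have hb : ∀ x, |(ak * (a * d)) x| ≤ 1 := fun x => by
      rw [Pi.mul_apply, Pi.mul_apply, hdx, ← mul_assoc, abs_mul, abs_inv, abs_of_pos (hpos x),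
        abs_mul, ← div_eq_mul_inv, div_le_one (hpos x)]
      nlinarith [mul_le_mul (hin k x) (hin j x) (abs_nonneg _) (norm_nonneg _)]
    have hle := l2_fourierMultiplier_le (hakt.mul (hat.mul hdt)) hb θ
    have e : ak * (a * d) = (2 * π * h) • ((fun x : Euc n => inner ℝ x (stdVec k)) * (a * d)) := by
      funext x
      simp only [hak, Pi.mul_apply, Pi.smul_apply, smul_eq_mul, mul_assoc]
    have e2 : ∀ x, (h : ℂ) * pd k (SchwartzMap.fourierMultiplierCLM ℂ (a * d) θ) x
        = Complex.I * SchwartzMap.fourierMultiplierCLM ℂ (ak * (a * d)) θ x := by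
      intro x
      rw [← lineDeriv_schwartz_apply, SchwartzMap.lineDeriv_eq_fourierMultiplierCLM,
        SchwartzMap.fourierMultiplierCLM_fourierMultiplierCLM_apply (hit k) (hat.mul hdt), e,
        SchwartzMap.fourierMultiplierCLM_smul ((hit k).mul (hat.mul hdt))]
      simp only [smul_apply, smul_eq_mul, Complex.real_smul]
      push_cast
      ring
    generalize SchwartzMap.fourierMultiplierCLM ℂ (ak * (a * d)) θ = ζ at e2 hle
    have := l2_le_of_norm_le (f := fun x => (h : ℂ) * pd k
      (SchwartzMap.fourierMultiplierCLM ℂ (a * d) θ) x) (ζ.memLp 2 volume) zero_le_one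
      (.of_forall fun x => by rw [e2, norm_mul, Complex.norm_I])
    rw [one_mul] at this
    exact this.trans hle

end Resolvent

/-! ### The conjugated Laplacian on test functions -/

section ConjugatedLaplacian

variable {n : ℕ} {Ω : Opens (Euc n)}

lemma smoothNear_of_contDiff {a : Euc n → ℂ} (ha : ContDiff ℝ ∞ a) : SmoothNear Ω a :=
  ⟨⊤, fun _ _ => trivial, ha.contDiffOn⟩

lemma contDiff_I_mul_pd {ψ : Euc n → ℝ} (hψ : ContDiff ℝ ∞ ψ) (j : Fin n) :
    ContDiff ℝ ∞ fun x => Complex.I * ((pd j ψ x : ℝ) : ℂ) :=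
  contDiff_const.mul (Complex.ofRealCLM.contDiff.comp (contDiff_pd hψ j))

/-- The first-order operator `-(h D_j + i ∂_j ψ)` on test functions. -/
def conjD {ψ : Euc n → ℝ} (hψ : ContDiff ℝ ∞ ψ) (h : ℝ) (j : Fin n) : 𝓓(Ω, ℂ) →ₗ[ℂ] 𝓓(Ω, ℂ) :=
  -((h : ℂ) • testD j
    + mulTest (fun x => Complex.I * ((pd j ψ x : ℝ) : ℂ))
      (smoothNear_of_contDiff (contDiff_I_mul_pd hψ j)))

/-- The conjugated operator `∑_j (h D_j + i ∂_j ψ)² = e^{ψ/h} (-h²Δ) e^{-ψ/h}` on test functions. -/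
def conjLap {ψ : Euc n → ℝ} (hψ : ContDiff ℝ ∞ ψ) (h : ℝ) : 𝓓(Ω, ℂ) →ₗ[ℂ] 𝓓(Ω, ℂ) :=
  ∑ j, conjD hψ h j ∘ₗ conjD hψ h j

lemma contDiff_test (θ : 𝓓(Ω, ℂ)) : ContDiff ℝ ∞ θ := θ.contDiff

lemma testD_apply' (j : Fin n) (θ : 𝓓(Ω, ℂ)) (x : Euc n) :
    testD j θ x = (Complex.I)⁻¹ * pd j θ x := testD_apply j θ x

lemma conjD_apply {ψ : Euc n → ℝ} (hψ : ContDiff ℝ ∞ ψ) (h : ℝ) (j : Fin n) (θ : 𝓓(Ω, ℂ))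
    (x : Euc n) : conjD hψ h j θ x = Complex.I * (h * pd j θ x - pd j ψ x * θ x) := by
  have : conjD hψ h j θ x = -((h : ℂ) * testD j θ x + Complex.I * ((pd j ψ x : ℝ) : ℂ) * θ x) := rfl
  rw [this, testD_apply', Complex.inv_I]
  ring

lemma conjLap_apply {ψ : Euc n → ℝ} (hψ : ContDiff ℝ ∞ ψ) (h : ℝ) (θ : 𝓓(Ω, ℂ)) (x : Euc n) :
    conjLap hψ h θ x = -(h : ℂ) ^ 2 * lap θ x - gradSq ψ x * θ x
      + h * (2 * (∑ j, pd j ψ x * pd j θ x) + lap ψ x * θ x) := by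
  have hψc : ∀ j, ContDiff ℝ ∞ fun y => ((pd j ψ y : ℝ) : ℂ) := fun j =>
    Complex.ofRealCLM.contDiff.comp (contDiff_pd hψ j)
  have hpdc : ∀ j, pd j (fun y => ((pd j ψ y : ℝ) : ℂ)) x = ((pd j (pd j ψ) x : ℝ) : ℂ) :=
      fun j => by
    have := (Complex.ofRealCLM.hasFDerivAt.comp x
      (differentiableAt_of_contDiff (contDiff_pd hψ j) x).hasFDerivAt).fderiv
    change fderiv ℝ (Complex.ofRealCLM ∘ pd j ψ) x _ = _
    rw [this]
    rfl
  have h1 : conjLap hψ h θ x = ∑ j, conjD hψ h j (conjD hψ h j θ) x := by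
    rw [conjLap, LinearMap.sum_apply, sum_apply]
    rfl
  have h2 : ∀ j, conjD hψ h j (conjD hψ h j θ) x = -(h : ℂ) ^ 2 * pd j (pd j θ) x
      - ((pd j ψ x : ℝ) : ℂ) ^ 2 * θ x
      + h * (2 * (pd j ψ x * pd j θ x) + ((pd j (pd j ψ) x : ℝ) : ℂ) * θ x) := by
    intro j
    have e : (conjD hψ h j θ : Euc n → ℂ)
        = fun y => Complex.I * (h * pd j θ y - pd j ψ y * θ y) := funext (conjD_apply hψ h j θ)
    have θj := contDiff_pd (contDiff_test θ) j
    rw [conjD_apply, e, pd_const_mul ((contDiff_const.mul θj).sub ((hψc j).mul (contDiff_test θ))),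
      pd_sub (contDiff_const.mul θj) ((hψc j).mul (contDiff_test θ)), pd_const_mul θj,
      pd_mul (hψc j) (contDiff_test θ), hpdc]
    beta_reduce
    generalize pd j ψ x = a
    generalize pd j (pd j ψ) x = b
    linear_combination (h * (h * pd j (pd j θ) x - (b * θ x + a * pd j θ x))
      - a * (h * pd j θ x - a * θ x)) * Complex.I_sq
  rw [h1, Finset.sum_congr rfl fun j _ => h2 j]
  simp only [lap, gradSq, Finset.sum_add_distrib, Finset.sum_sub_distrib, ← Finset.mul_sum,
    ← Finset.sum_mul, Complex.ofReal_sum, Complex.ofReal_pow]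

lemma pd_re {θ : Euc n → ℂ} (hθ : ContDiff ℝ ∞ θ) (j : Fin n) :
    pd j (fun y => (θ y).re) = fun x => (pd j θ x).re := by
  funext x
  have := (Complex.reCLM.hasFDerivAt.comp x (differentiableAt_of_contDiff hθ x).hasFDerivAt).fderiv
  change fderiv ℝ (Complex.reCLM ∘ θ) x _ = _
  rw [this]
  rfl

lemma pd_im {θ : Euc n → ℂ} (hθ : ContDiff ℝ ∞ θ) (j : Fin n) :
    pd j (fun y => (θ y).im) = fun x => (pd j θ x).im := by
  funext x
  have := (Complex.imCLM.hasFDerivAt.comp x (differentiableAt_of_contDiff hθ x).hasFDerivAt).fderiv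
  change fderiv ℝ (Complex.imCLM ∘ θ) x _ = _
  rw [this]
  rfl

/-- The second-order operator has real coefficients, although its first-order factors do not. It
therefore acts on real and imaginary parts separately, and the estimate for real functions suffices.
-/
lemma conjLap_re {ψ : Euc n → ℝ} (hψ : ContDiff ℝ ∞ ψ) (h : ℝ) (θ : 𝓓(Ω, ℂ)) (x : Euc n) :
    (conjLap hψ h θ x).re
      = conjSym ψ h (fun y => (θ y).re) x + conjSkew ψ h (fun y => (θ y).re) x := by
  have hθ := contDiff_test θ
  simp only [conjLap_apply, conjSym, conjSkew, lap, pd_re hθ, pd_re (contDiff_pd hθ _),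
    ← Complex.ofReal_pow, ← Complex.ofReal_neg, Complex.add_re, Complex.sub_re,
    Complex.re_ofReal_mul, Complex.re_sum]
  rw [show (2 : ℂ) = ((2 : ℝ) : ℂ) by norm_num, Complex.re_ofReal_mul]
  simp only [Complex.re_sum, Complex.re_ofReal_mul]

lemma conjLap_im {ψ : Euc n → ℝ} (hψ : ContDiff ℝ ∞ ψ) (h : ℝ) (θ : 𝓓(Ω, ℂ)) (x : Euc n) :
    (conjLap hψ h θ x).im
      = conjSym ψ h (fun y => (θ y).im) x + conjSkew ψ h (fun y => (θ y).im) x := by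
  have hθ := contDiff_test θ
  simp only [conjLap_apply, conjSym, conjSkew, lap, pd_im hθ, pd_im (contDiff_pd hθ _),
    ← Complex.ofReal_pow, ← Complex.ofReal_neg, Complex.add_im, Complex.sub_im,
    Complex.im_ofReal_mul, Complex.im_sum]
  rw [show (2 : ℂ) = ((2 : ℝ) : ℂ) by norm_num, Complex.im_ofReal_mul]
  simp only [Complex.im_sum, Complex.im_ofReal_mul]

lemma test_memLp (μ : Measure (Euc n)) [IsFiniteMeasureOnCompacts μ] (θ : 𝓓(Ω, ℂ)) : MemLp θ 2 μ :=
  θ.continuous.memLp_of_hasCompactSupport θ.hasCompactSupport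

lemma l2_sq {μ : Measure (Euc n)} {f : Euc n → ℂ} (hf : MemLp f 2 μ) :
    l2 μ f ^ 2 = ∫ x, ‖f x‖ ^ 2 ∂μ := by
  have h := hf.eLpNorm_eq_integral_rpow_norm (by norm_num) (by norm_num)
  have h0 : 0 ≤ ∫ x, ‖f x‖ ^ 2 ∂μ := integral_nonneg fun _ => by positivity
  simp only [ENNReal.toReal_ofNat, Real.rpow_ofNat] at h
  rw [l2, h, ENNReal.toReal_ofReal (by positivity), ← Real.rpow_natCast, ← Real.rpow_mul h0]
  norm_num

lemma integral_norm_sq_test (θ : 𝓓(Ω, ℂ)) :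
    l2 volume θ ^ 2 = (∫ x, (θ x).re ^ 2) + ∫ x, (θ x).im ^ 2 := by
  have hi : ∀ f : ℂ →L[ℝ] ℝ, Integrable fun x => (f (θ x)) ^ 2 := fun f =>
    ((f.continuous.comp θ.continuous).pow 2).integrable_of_hasCompactSupport
      (HasCompactSupport.intro θ.hasCompactSupport fun x hx => by
        simp [image_eq_zero_of_notMem_tsupport hx])
  rw [l2_sq (test_memLp volume θ)]
  refine Eq.trans (integral_congr_ae (.of_forall fun x => ?_))
    (integral_add (hi Complex.reCLM) (hi Complex.imCLM))
  change ‖θ x‖ ^ 2 = (θ x).re ^ 2 + (θ x).im ^ 2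
  rw [Complex.sq_norm, Complex.normSq_apply]
  ring

/-- The Carleman estimate passes from real to complex test functions. -/
lemma carleman_estimate_complex {ψ : Euc n → ℝ} (hψ : ContDiff ℝ ∞ ψ) {h α C : ℝ}
    (H : ∀ u : Euc n → ℝ, ContDiff ℝ ∞ u → HasCompactSupport u → tsupport u ⊆ closure Ω →
      α * ∫ x, u x ^ 2 ≤ C * ∫ x, (conjSym ψ h u x + conjSkew ψ h u x) ^ 2) (θ : 𝓓(Ω, ℂ)) :
    α * l2 volume θ ^ 2 ≤ C * l2 volume (conjLap hψ h θ) ^ 2 := by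
  have hs : ∀ f : ℂ →L[ℝ] ℝ, HasCompactSupport (fun y => f (θ y)) ∧
      tsupport (fun y => f (θ y)) ⊆ closure Ω := fun f => by
    have : tsupport (fun y => f (θ y)) ⊆ tsupport θ :=
      tsupport_comp_subset (g := f) (map_zero f) θ
    exact ⟨θ.hasCompactSupport.of_isClosed_subset (isClosed_tsupport _) this,
      (this.trans θ.tsupport_subset).trans subset_closure⟩
  have h1 := H (fun y => (θ y).re) (Complex.reCLM.contDiff.comp (contDiff_test θ))
    (hs Complex.reCLM).1 (hs Complex.reCLM).2
  have h2 := H (fun y => (θ y).im) (Complex.imCLM.contDiff.comp (contDiff_test θ))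
    (hs Complex.imCLM).1 (hs Complex.imCLM).2
  rw [integral_norm_sq_test, integral_norm_sq_test]
  simp only [conjLap_re, conjLap_im]
  linarith

end ConjugatedLaplacian

/-! ### Riesz representation on the closure of a range -/

section Riesz

variable {V H : Type*} [AddCommGroup V] [Module ℂ V] [NormedAddCommGroup H] [InnerProductSpace ℂ H]
  [CompleteSpace H]

/-- The bound makes ℓ a function of T v alone, and since T is conjugate-linear the conjugate of ℓ is
a bounded linear functional on the range of T. Hahn–Banach and Riesz then give a vector. Membership
in the closure of the range is retained because it later shows that the representative of an H⁻¹
functional lies in H¹. -/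
lemma exists_riesz_representative (T : V →ₛₗ[starRingEnd ℂ] H) (ℓ : V →ₗ[ℂ] ℂ) {M : ℝ}
    (hM0 : 0 ≤ M) (hM : ∀ v, ‖ℓ v‖ ≤ M * ‖T v‖) :
    ∃ W : H, W ∈ closure (Set.range T) ∧ ‖W‖ ≤ M ∧ ∀ v, ℓ v = inner ℂ (T v) W := by
  set p : Submodule ℂ H := LinearMap.range T with hp
  have hwd : ∀ v v', T v = T v' → ℓ v = ℓ v' := fun v v' hv => by
    have := hM (v - v')
    rw [map_sub, map_sub, hv, sub_self, norm_zero, mul_zero] at this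
    exact sub_eq_zero.1 (norm_le_zero_iff.1 this)
  have hpre : ∀ s : p, ∃ v, T v = s := fun s => s.2
  choose pre hpre using hpre
  let f₀ : p →ₗ[ℂ] ℂ :=
    { toFun := fun s => starRingEnd ℂ (ℓ (pre s))
      map_add' := fun s t => by
        rw [← map_add, ← map_add]
        congr 1
        exact hwd _ _ (by rw [map_add, hpre, hpre, hpre]; rfl)
      map_smul' := fun c s => by
        rw [RingHom.id_apply, smul_eq_mul, ← Complex.conj_conj c, ← map_mul, ← smul_eq_mul,
          ← map_smul, Complex.conj_conj]
        congr 1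
        exact hwd _ _ (by rw [map_smulₛₗ, hpre, hpre, Complex.conj_conj]; rfl) }
  let f : p →L[ℂ] ℂ := f₀.mkContinuous M fun s => by
    change ‖starRingEnd ℂ (ℓ (pre s))‖ ≤ _
    rw [RCLike.norm_conj]
    refine (hM _).trans_eq ?_
    rw [hpre]
    rfl
  have hf : ‖f‖ ≤ M := f₀.mkContinuous_norm_le hM0 _
  obtain ⟨g, hg, hgn⟩ := exists_extension_norm_eq p f
  set W₀ : H := (InnerProductSpace.toDual ℂ H).symm g with hW₀
  set q := p.topologicalClosure with hq
  have : CompleteSpace q := p.isClosed_topologicalClosure.completeSpace_coe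
  -- Projecting onto the closure of the range changes no pairing with the vectors T v and does not
  -- increase the norm.
  refine ⟨q.starProjection W₀, ?_, ?_, fun v => ?_⟩
  · have : q.starProjection W₀ ∈ q := Submodule.starProjection_apply_mem _ _
    have hc : (q : Set H) = closure (Set.range T) := by
      rw [hq, Submodule.topologicalClosure_coe, hp, LinearMap.coe_range]
    rw [← hc]
    exact this
  · calc ‖q.starProjection W₀‖ ≤ ‖W₀‖ := Submodule.norm_starProjection_apply_le _ _
      _ = ‖f‖ := by rw [hW₀, LinearIsometryEquiv.norm_map, hgn]
      _ ≤ M := hf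
  · have hTv : T v ∈ q := p.le_topologicalClosure ⟨v, rfl⟩
    have h1 : inner ℂ (T v) (q.starProjection W₀) = inner ℂ (T v) W₀ := by
      rw [← Submodule.inner_starProjection_left_eq_right,
        Submodule.starProjection_eq_self_iff.2 hTv]
    have h2 : g (T v) = starRingEnd ℂ (ℓ v) := by
      have := hg ⟨T v, v, rfl⟩
      rw [this]
      change starRingEnd ℂ (ℓ (pre _)) = _
      congr 1
      exact hwd _ _ (hpre _)
    rw [h1, ← inner_conj_symm, hW₀, InnerProductSpace.toDual_symm_apply, h2, Complex.conj_conj]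

end Riesz

/-! ### Weak solutions in `L²` and their interior regularity -/

section WeakSolutions

variable {n : ℕ} {Ω Ω' : Opens (Euc n)}

/-- The complex conjugate of a test function, as an element of `L²`. -/
def toL2conj (μ : Measure (Euc n)) [IsFiniteMeasureOnCompacts μ] :
    𝓓(Ω, ℂ) →ₛₗ[starRingEnd ℂ] Lp ℂ 2 μ where
  toFun θ := (test_memLp μ θ).star.toLp
  map_add' θ η := by
    rw [← MemLp.toLp_add]
    exact MemLp.toLp_congr _ _ (.of_forall fun x => star_add _ _)
  map_smul' c θ := by
    rw [← MemLp.toLp_const_smul]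
    exact MemLp.toLp_congr _ _ (.of_forall fun x => by simp)

lemma coeFn_toL2conj (μ : Measure (Euc n)) [IsFiniteMeasureOnCompacts μ] (θ : 𝓓(Ω, ℂ)) :
    toL2conj μ θ =ᵐ[μ] fun x => starRingEnd ℂ (θ x) :=
  MemLp.coeFn_toLp (test_memLp μ θ).star

lemma norm_toL2conj (μ : Measure (Euc n)) [IsFiniteMeasureOnCompacts μ] (θ : 𝓓(Ω, ℂ)) :
    ‖toL2conj μ θ‖ = l2 μ θ := by
  rw [Lp.norm_def, l2]
  congr 1
  refine eLpNorm_congr_norm_ae ?_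
  filter_upwards [coeFn_toL2conj μ θ] with x hx
  rw [hx, RCLike.norm_conj]

lemma inner_toL2conj (μ : Measure (Euc n)) [IsFiniteMeasureOnCompacts μ] (θ : 𝓓(Ω, ℂ))
    (W : Lp ℂ 2 μ) : inner ℂ (toL2conj μ θ) W = ∫ x, W x * θ x ∂μ := by
  rw [L2.inner_def]
  refine integral_congr_ae ?_
  filter_upwards [coeFn_toL2conj μ θ] with x hx
  rw [hx, RCLike.inner_apply, Complex.conj_conj]

/-- Solvability in `L²`, by duality from an a priori estimate. -/
lemma exists_weak_solution {ψ : Euc n → ℝ} (hψ : ContDiff ℝ ∞ ψ) {h N F : ℝ} (hN : 0 ≤ N)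
    (hF : 0 ≤ F) (est : ∀ θ : 𝓓(Ω, ℂ), l2 volume θ ≤ N * l2 volume (conjLap hψ h θ))
    (ℓ : 𝓓(Ω, ℂ) →ₗ[ℂ] ℂ) (hℓ : ∀ θ, ‖ℓ θ‖ ≤ F * l2 volume θ) :
    ∃ w : Lp ℂ 2 (volume : Measure (Euc n)), ‖w‖ ≤ F * N ∧
      ∀ θ : 𝓓(Ω, ℂ), ∫ x, w x * conjLap hψ h θ x = ℓ θ := by
  obtain ⟨w, -, hw, hwl⟩ := exists_riesz_representative
    ((toL2conj volume).comp (conjLap hψ h : 𝓓(Ω, ℂ) →ₗ[ℂ] 𝓓(Ω, ℂ))) ℓ (mul_nonneg hF hN)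
    fun θ => by
      rw [LinearMap.comp_apply, norm_toL2conj, mul_assoc]
      exact (hℓ θ).trans (mul_le_mul_of_nonneg_left (est θ) hF)
  refine ⟨w, hw, fun θ => ?_⟩
  rw [hwl, LinearMap.comp_apply, inner_toL2conj]

lemma integrable_lp_mul {μ : Measure (Euc n)} (f : Lp ℂ 2 μ) {g : Euc n → ℂ} (hg : MemLp g 2 μ) :
    Integrable (fun x => f x * g x) μ := (Lp.memLp f).integrable_mul hg

lemma norm_integral_lp_mul_le {μ : Measure (Euc n)} (f : Lp ℂ 2 μ) {g : Euc n → ℂ}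
    (hg : MemLp g 2 μ) : ‖∫ x, f x * g x ∂μ‖ ≤ ‖f‖ * l2 μ g := by
  have h1 : ∫ x, f x * g x ∂μ = inner ℂ (hg.star.toLp) f := by
    rw [L2.inner_def]
    refine integral_congr_ae ?_
    filter_upwards [hg.star.coeFn_toLp] with x hx
    rw [hx, RCLike.inner_apply]
    simp
  have h2 : ‖hg.star.toLp‖ = l2 μ g := by
    rw [Lp.norm_def, l2]
    congr 1
    refine eLpNorm_congr_norm_ae ?_
    filter_upwards [hg.star.coeFn_toLp] with x hx
    rw [hx]
    simp
  rw [h1, mul_comm, ← h2]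
  exact norm_inner_le_norm _ _

lemma l2_vol_test (θ : 𝓓(Ω, ℂ)) : l2 (vol Ω) θ = l2 volume θ := by
  rw [l2, l2]
  congr 1
  refine eLpNorm_restrict_eq_of_support_subset ?_
  exact (subset_tsupport _).trans θ.tsupport_subset

lemma integral_vol_mul_test (f : Euc n → ℂ) (θ : 𝓓(Ω, ℂ)) :
    ∫ x, f x * θ x ∂(vol Ω) = ∫ x, f x * θ x := by
  refine setIntegral_eq_integral_of_forall_compl_eq_zero fun x hx => ?_
  rw [image_eq_zero_of_notMem_tsupport fun h => hx (θ.tsupport_subset h), mul_zero]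

/-- Membership in `H¹(Ω)` by duality. -/
lemma exists_H1_of_bound (u₀ : Lp ℂ 2 (vol Ω)) {h M : ℝ} (hh : 0 < h) (hM : 0 ≤ M)
    (H : ∀ j, ∀ θ : 𝓓(Ω, ℂ), ‖∫ x, u₀ x * (h * testD j θ x) ∂(vol Ω)‖ ≤ M * l2 (vol Ω) θ) :
    ∃ u : H1 Ω, u.fn = u₀ ∧ ∀ j, ‖(h : ℂ) • u.D j‖ ≤ M := by
  have hc : (h : ℂ) ≠ 0 := by exact_mod_cast hh.ne'
  have key : ∀ j, ∃ W : Lp ℂ 2 (vol Ω), ‖W‖ ≤ M ∧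
      ∀ θ : 𝓓(Ω, ℂ), (h : ℂ) * ofL2 u₀ (testD j θ) = ∫ x, W x * θ x ∂(vol Ω) := by
    intro j
    obtain ⟨W, -, hW, hWl⟩ := exists_riesz_representative (toL2conj (vol Ω))
      ((h : ℂ) • (ofL2 u₀ ∘ₗ testD j)) hM fun θ => by
        rw [norm_toL2conj]
        refine le_trans (le_of_eq ?_) (H j θ)
        rw [LinearMap.smul_apply, LinearMap.comp_apply, ofL2_apply, smul_eq_mul,
          ← integral_const_mul]
        congr 1
        exact integral_congr_ae (.of_forall fun x => mul_left_comm _ _ _)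
    refine ⟨W, hW, fun θ => ?_⟩
    rw [← inner_toL2conj, ← hWl]
    rfl
  choose W hW hWl using key
  refine ⟨⟨u₀, fun j => (-(h : ℂ)⁻¹) • W j, fun j => ?_⟩, rfl, fun j => ?_⟩
  · ext θ
    change -(ofL2 u₀ (testD j θ)) = ofL2 ((-(h : ℂ)⁻¹) • W j) θ
    have : ofL2 ((-(h : ℂ)⁻¹) • W j) θ = (-(h : ℂ)⁻¹) * ∫ x, W j x * θ x ∂(vol Ω) := by
      rw [ofL2_apply, ← integral_const_mul]
      refine integral_congr_ae ?_
      filter_upwards [Lp.coeFn_smul (-(h : ℂ)⁻¹) (W j)] with x hx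
      rw [hx, Pi.smul_apply, smul_eq_mul, mul_assoc]
    rw [this, ← hWl]
    field_simp
  · rw [smul_smul, mul_neg, mul_inv_cancel₀ hc, neg_smul, one_smul, norm_neg]
    exact hW j

/-- Extension by zero of test functions. -/
def extendTest (hle : (Ω : Set (Euc n)) ⊆ Ω') : 𝓓(Ω, ℂ) →ₗ[ℂ] 𝓓(Ω', ℂ) where
  toFun θ := ⟨θ, θ.contDiff, θ.hasCompactSupport, θ.tsupport_subset.trans hle⟩
  map_add' _ _ := rfl
  map_smul' _ _ := rfl

lemma extendTest_coe (hle : (Ω : Set (Euc n)) ⊆ Ω') (θ : 𝓓(Ω, ℂ)) :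
    (extendTest hle θ : Euc n → ℂ) = θ := rfl

/-- The product of a compactly supported smooth cutoff and a smooth function. -/
def cutoffTest {χ : Euc n → ℝ} (hχ : ContDiff ℝ ∞ χ) (hχc : HasCompactSupport χ)
    (hχs : tsupport χ ⊆ Ω) {η : Euc n → ℂ} (hη : ContDiff ℝ ∞ η) : 𝓓(Ω, ℂ) where
  toFun x := (χ x : ℂ) * η x
  contDiff' := (Complex.ofRealCLM.contDiff.comp hχ).mul hη
  hasCompactSupport' := by
    have : HasCompactSupport fun x => (χ x : ℂ) := hχc.comp_left Complex.ofReal_zero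
    exact this.mul_right
  tsupport_subset' := by
    refine (tsupport_mul_subset_left (f := fun x => (χ x : ℂ))).trans ?_
    exact (tsupport_comp_subset (g := ((↑) : ℝ → ℂ)) Complex.ofReal_zero χ).trans hχs

/-- The zeroth-order coefficient of the commutator of `-h²Δ + 1` with the cutoff `χ`, plus the
lower-order terms of the conjugated Laplacian. -/
def cutoffCoeff (ψ χ : Euc n → ℝ) (h : ℝ) (x : Euc n) : ℝ :=
  χ x + h ^ 2 * lap χ x + gradSq ψ x * χ x
    - h * (2 * (∑ j, pd j ψ x * pd j χ x) + lap ψ x * χ x)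

/-- The corresponding first-order coefficients. -/
def cutoffCoeffD (ψ χ : Euc n → ℝ) (h : ℝ) (k : Fin n) (x : Euc n) : ℝ :=
  2 * h * pd k χ x - 2 * pd k ψ x * χ x

lemma pd_ofReal {f : Euc n → ℝ} (hf : ContDiff ℝ ∞ f) (j : Fin n) (x : Euc n) :
    pd j (fun y => (f y : ℂ)) x = ((pd j f x : ℝ) : ℂ) := by
  have := (Complex.ofRealCLM.hasFDerivAt.comp x
    (differentiableAt_of_contDiff hf x).hasFDerivAt).fderiv
  change fderiv ℝ (Complex.ofRealCLM ∘ f) x _ = _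
  rw [this]
  rfl

/-- By the Leibniz rule, `P_ψ(χη)` has the second-order part -h²χΔη; everything else is a multiple
of η or of h∂_kη. Pairing with a weak solution turns `P_ψ(χη)` into its right-hand side and leaves
only terms bounded by the semiclassical H¹ norm of η. -/
lemma cutoff_mul_eq {ψ χ : Euc n → ℝ} (hψ : ContDiff ℝ ∞ ψ) (hχ : ContDiff ℝ ∞ χ)
    (hχc : HasCompactSupport χ) (hχs : tsupport χ ⊆ Ω) {η : Euc n → ℂ} (hη : ContDiff ℝ ∞ η)
    (h : ℝ) (x : Euc n) :
    (χ x : ℂ) * (η x - (h : ℂ) ^ 2 * lap η x)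
      = conjLap hψ h (cutoffTest hχ hχc hχs hη) x + (cutoffCoeff ψ χ h x : ℂ) * η x
        + ∑ k, (cutoffCoeffD ψ χ h k x : ℂ) * (h * pd k η x) := by
  have hχC : ContDiff ℝ ∞ fun y => (χ y : ℂ) := Complex.ofRealCLM.contDiff.comp hχ
  have hχj : ∀ j, ContDiff ℝ ∞ fun y => ((pd j χ y : ℝ) : ℂ) := fun j =>
    Complex.ofRealCLM.contDiff.comp (contDiff_pd hχ j)
  have e0 : (cutoffTest hχ hχc hχs hη : Euc n → ℂ) = fun y => (χ y : ℂ) * η y := rfl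
  have e1 : ∀ j, pd j (cutoffTest hχ hχc hχs hη : Euc n → ℂ)
      = fun y => ((pd j χ y : ℝ) : ℂ) * η y + χ y * pd j η y := fun j => by
    funext y
    rw [e0, pd_mul hχC hη, pd_ofReal hχ]
  have e2 : ∀ j, pd j (pd j (cutoffTest hχ hχc hχs hη : Euc n → ℂ)) x
      = ((pd j (pd j χ) x : ℝ) : ℂ) * η x + 2 * (((pd j χ x : ℝ) : ℂ) * pd j η x)
        + χ x * pd j (pd j η) x := fun j => by
    rw [e1, pd_add ((hχj j).mul hη) (hχC.mul (contDiff_pd hη j)), pd_mul (hχj j) hη,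
      pd_mul hχC (contDiff_pd hη j), pd_ofReal hχ, pd_ofReal (contDiff_pd hχ j)]
    ring
  have hl : lap (cutoffTest hχ hχc hχs hη : Euc n → ℂ) x = ((lap χ x : ℝ) : ℂ) * η x
      + 2 * (∑ j, ((pd j χ x : ℝ) : ℂ) * pd j η x) + χ x * lap η x := by
    simp only [lap, e2, Finset.sum_add_distrib, Finset.mul_sum, Finset.sum_mul,
      Complex.ofReal_sum]
  have hd : ∑ j, ((pd j ψ x : ℝ) : ℂ) * pd j (cutoffTest hχ hχc hχs hη : Euc n → ℂ) x
      = ((∑ j, pd j ψ x * pd j χ x : ℝ) : ℂ) * η x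
        + χ x * ∑ j, ((pd j ψ x : ℝ) : ℂ) * pd j η x := by
    simp only [e1, Finset.mul_sum, Finset.sum_mul, Complex.ofReal_sum, Complex.ofReal_mul,
      ← Finset.sum_add_distrib]
    exact Finset.sum_congr rfl fun j _ => by ring
  have hk : ∑ k, (cutoffCoeffD ψ χ h k x : ℂ) * (h * pd k η x)
      = 2 * (h : ℂ) ^ 2 * (∑ j, ((pd j χ x : ℝ) : ℂ) * pd j η x)
        - 2 * h * χ x * ∑ j, ((pd j ψ x : ℝ) : ℂ) * pd j η x := by
    simp only [cutoffCoeffD, Finset.mul_sum, ← Finset.sum_sub_distrib]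
    refine Finset.sum_congr rfl fun j _ => ?_
    push_cast
    ring
  rw [conjLap_apply, hl, hd, hk, e0, cutoffCoeff]
  push_cast
  ring

end WeakSolutions

/-! ### Interior regularity of weak solutions and solvability in H¹. -/

section Regularity

variable {n : ℕ} {Ω Ω' : Opens (Euc n)}

lemma contDiff_cutoffCoeff {ψ χ : Euc n → ℝ} (hψ : ContDiff ℝ ∞ ψ) (hχ : ContDiff ℝ ∞ χ) (h : ℝ) :
    ContDiff ℝ ∞ (cutoffCoeff ψ χ h) := by
  have h1 : ContDiff ℝ ∞ fun x => ∑ j, pd j ψ x * pd j χ x :=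
    ContDiff.sum fun j _ => (contDiff_pd hψ j).mul (contDiff_pd hχ j)
  exact ((hχ.add (contDiff_const.mul (contDiff_lap hχ))).add ((contDiff_gradSq hψ).mul hχ)).sub
    (contDiff_const.mul ((contDiff_const.mul h1).add ((contDiff_lap hψ).mul hχ)))

lemma contDiff_cutoffCoeffD {ψ χ : Euc n → ℝ} (hψ : ContDiff ℝ ∞ ψ) (hχ : ContDiff ℝ ∞ χ) (h : ℝ)
    (k : Fin n) : ContDiff ℝ ∞ (cutoffCoeffD ψ χ h k) :=
  (contDiff_const.mul (contDiff_pd hχ k)).sub ((contDiff_const.mul (contDiff_pd hψ k)).mul hχ)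

lemma memLp_bounded_mul {μ : Measure (Euc n)} {a : Euc n → ℝ} (ha : Continuous a) {B : ℝ}
    (hB : ∀ x, |a x| ≤ B) {g : Euc n → ℂ} (hg : MemLp g 2 μ) :
    MemLp (fun x => (a x : ℂ) * g x) 2 μ ∧ l2 μ (fun x => (a x : ℂ) * g x) ≤ B * l2 μ g := by
  have h1 : ∀ᵐ x ∂μ, ‖(a x : ℂ) * g x‖ ≤ B * ‖g x‖ := .of_forall fun x => by
    rw [norm_mul, Complex.norm_real]
    exact mul_le_mul_of_nonneg_right (hB x) (norm_nonneg _)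
  exact ⟨hg.of_le_mul ((Complex.continuous_ofReal.comp ha).aestronglyMeasurable.mul hg.1) h1,
    l2_le_of_norm_le hg ((abs_nonneg _).trans (hB 0)) h1⟩

/-- Interior regularity: the derivative of a weak `L²` solution, tested against `θ`. -/
lemma norm_integral_mul_testD_le {ψ χ : Euc n → ℝ} (hψ : ContDiff ℝ ∞ ψ) (hχ : ContDiff ℝ ∞ χ)
    (hχc : HasCompactSupport χ) (hχs : tsupport χ ⊆ Ω') (hχ1 : ∀ x, |χ x| ≤ 1)
    (hχΩ : ∀ x ∈ Ω, χ x = 1) {h F B : ℝ} (hF : 0 ≤ F)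
    (hB : ∀ x, |cutoffCoeff ψ χ h x| ≤ B) (hBD : ∀ k x, |cutoffCoeffD ψ χ h k x| ≤ B)
    {ℓ : 𝓓(Ω', ℂ) →ₗ[ℂ] ℂ} (hℓ : ∀ θ, ‖ℓ θ‖ ≤ F * l2 volume θ)
    {w : Lp ℂ 2 (volume : Measure (Euc n))}
    (hw : ∀ θ : 𝓓(Ω', ℂ), ∫ x, w x * conjLap hψ h θ x = ℓ θ) (j : Fin n) (θ : 𝓓(Ω, ℂ)) :
    ‖∫ x, w x * (h * testD j θ x)‖ ≤ (F + (n + 1) * B * ‖w‖) * l2 volume θ := by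
  have hB0 : 0 ≤ B := (abs_nonneg _).trans (hB 0)
  -- As χ = 1 on the support of θ, hD_jθ = χ(1 - h²Δ)η. The resolvent turns the derivative on θ into
  -- a function η controlled, with its h-derivatives, by θ in L²; η has no compact support, whence
  -- the cutoff.
  obtain ⟨η, hη, hη0, hηk⟩ := exists_resolvent
    (θ.hasCompactSupport.toSchwartzMap (contDiff_test θ)) h j
  have hηs : ContDiff ℝ ∞ η := η.smooth ⊤
  have hηm : MemLp η 2 volume := η.memLp 2 volume
  have hηkm : ∀ k, MemLp (fun x => (h : ℂ) * pd k η x) 2 volume := fun k => by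
    have : MemLp (LineDeriv.lineDerivOp (stdVec k) η : SchwartzMap (Euc n) ℂ) 2 volume :=
      SchwartzMap.memLp _ 2 volume
    have e : ((LineDeriv.lineDerivOp (stdVec k) η : SchwartzMap (Euc n) ℂ) : Euc n → ℂ) = pd k η :=
      funext fun x => lineDeriv_schwartz_apply η k x
    rw [e] at this
    exact this.const_mul (h : ℂ)
  set ζ : 𝓓(Ω', ℂ) := cutoffTest hχ hχc hχs hηs with hζ
  have hζ0 : l2 volume ζ ≤ l2 volume θ := by
    have := (memLp_bounded_mul hχ.continuous hχ1 hηm).2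
    rw [one_mul] at this
    exact this.trans hη0
  obtain ⟨am, al⟩ := memLp_bounded_mul (contDiff_cutoffCoeff hψ hχ h).continuous hB hηm
  have bm := fun k => memLp_bounded_mul (contDiff_cutoffCoeffD hψ hχ h k).continuous (hBD k)
    (hηkm k)
  have e1 : ∀ x, w x * (h * testD j θ x) = w x * conjLap hψ h ζ x
      + w x * ((cutoffCoeff ψ χ h x : ℂ) * η x)
      + ∑ k, w x * ((cutoffCoeffD ψ χ h k x : ℂ) * (h * pd k η x)) := by
    intro x
    rw [← Finset.mul_sum, ← mul_add, ← mul_add, hζ, ← cutoff_mul_eq, hη]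
    by_cases hx : x ∈ tsupport θ
    · rw [hχΩ x (θ.tsupport_subset hx), testD_apply']
      simp only [Complex.ofReal_one, one_mul]
      rfl
    · have h1 : pd j θ x = 0 := (apply_eq_zero_of_notMem hx).2.1 j
      have h2 : pd j (θ.hasCompactSupport.toSchwartzMap (contDiff_test θ)) x = 0 := h1
      rw [testD_apply', h1, h2]
      simp
  have i1 := integrable_lp_mul w (test_memLp volume (conjLap hψ h ζ))
  have i2 := integrable_lp_mul w am
  have i3 := fun k => integrable_lp_mul w (bm k).1
  have e2 : ∫ x, w x * (h * testD j θ x) = ℓ ζ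
      + (∫ x, w x * ((cutoffCoeff ψ χ h x : ℂ) * η x))
      + ∑ k, ∫ x, w x * ((cutoffCoeffD ψ χ h k x : ℂ) * (h * pd k η x)) := by
    rw [integral_congr_ae (.of_forall e1), ← hw, ← integral_finsetSum _ fun k _ => i3 k,
      ← integral_add i1 i2]
    exact integral_add (i1.add i2) (integrable_finsetSum _ fun k _ => i3 k)
  rw [e2]
  have b1 : ‖ℓ ζ‖ ≤ F * l2 volume θ := (hℓ ζ).trans (mul_le_mul_of_nonneg_left hζ0 hF)
  have b2 : ‖∫ x, w x * ((cutoffCoeff ψ χ h x : ℂ) * η x)‖ ≤ ‖w‖ * (B * l2 volume θ) :=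
    (norm_integral_lp_mul_le w am).trans (mul_le_mul_of_nonneg_left
      (al.trans (mul_le_mul_of_nonneg_left hη0 hB0)) (norm_nonneg _))
  have b3 : ∀ k, ‖∫ x, w x * ((cutoffCoeffD ψ χ h k x : ℂ) * (h * pd k η x))‖
      ≤ ‖w‖ * (B * l2 volume θ) := fun k =>
    (norm_integral_lp_mul_le w (bm k).1).trans (mul_le_mul_of_nonneg_left
      ((bm k).2.trans (mul_le_mul_of_nonneg_left (hηk k) hB0)) (norm_nonneg _))
  have b4 : ‖∑ k, ∫ x, w x * ((cutoffCoeffD ψ χ h k x : ℂ) * (h * pd k η x))‖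
      ≤ n * (‖w‖ * (B * l2 volume θ)) := by
    refine (norm_sum_le _ _).trans ((Finset.sum_le_sum fun k _ => b3 k).trans_eq ?_)
    simp
  calc _ ≤ F * l2 volume θ + ‖w‖ * (B * l2 volume θ) + n * (‖w‖ * (B * l2 volume θ)) :=
        norm_add₃_le.trans (by gcongr)
    _ = _ := by ring

/-- Solvability in `H¹(Ω)` for right-hand sides bounded in `L²(Ω')`. -/
lemma exists_H1_solution {ψ χ : Euc n → ℝ} (hψ : ContDiff ℝ ∞ ψ) (hχ : ContDiff ℝ ∞ χ)
    (hχc : HasCompactSupport χ) (hχs : tsupport χ ⊆ Ω') (hχ1 : ∀ x, |χ x| ≤ 1)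
    (hχΩ : ∀ x ∈ Ω, χ x = 1) (hle : (Ω : Set (Euc n)) ⊆ Ω') {h F B N : ℝ} (hh : 0 < h)
    (hF : 0 ≤ F) (hN : 0 ≤ N)
    (hB : ∀ x, |cutoffCoeff ψ χ h x| ≤ B) (hBD : ∀ k x, |cutoffCoeffD ψ χ h k x| ≤ B)
    (est : ∀ θ : 𝓓(Ω', ℂ), l2 volume θ ≤ N * l2 volume (conjLap hψ h θ))
    (ℓ : 𝓓(Ω', ℂ) →ₗ[ℂ] ℂ) (hℓ : ∀ θ, ‖ℓ θ‖ ≤ F * l2 volume θ) :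
    ∃ u : H1 Ω, ‖u.fn‖ ≤ F * N ∧ (∀ j, ‖(h : ℂ) • u.D j‖ ≤ F + (n + 1) * B * (F * N)) ∧
      ∀ θ : 𝓓(Ω, ℂ), ofL2 u.fn (conjLap hψ h θ) = ℓ (extendTest hle θ) := by
  have hB0 : 0 ≤ B := (abs_nonneg _).trans (hB 0)
  obtain ⟨w, hwn, hw⟩ := exists_weak_solution hψ hN hF est ℓ hℓ
  have hwm : MemLp w 2 (vol Ω) := (Lp.memLp w).restrict _
  set u₀ : Lp ℂ 2 (vol Ω) := hwm.toLp with hu₀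
  have hu₀n : ‖u₀‖ ≤ ‖w‖ := by
    rw [hu₀, Lp.norm_toLp, Lp.norm_def]
    exact ENNReal.toReal_mono (Lp.memLp w).2.ne
      (eLpNorm_mono_measure _ Measure.restrict_le_self)
  have hint : ∀ θ : 𝓓(Ω, ℂ), ∫ x, u₀ x * θ x ∂(vol Ω) = ∫ x, w x * θ x := fun θ => by
    rw [← integral_vol_mul_test]
    refine integral_congr_ae ?_
    filter_upwards [hwm.coeFn_toLp] with x hx
    rw [hu₀, hx]
  have hM0 : 0 ≤ F + (n + 1) * B * (F * N) := by positivity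
  obtain ⟨u, hu, hud⟩ := exists_H1_of_bound u₀ hh hM0 fun j θ => by
    have e : ∫ x, u₀ x * (h * testD j θ x) ∂(vol Ω) = ∫ x, w x * (h * testD j θ x) :=
      hint ((h : ℂ) • testD j θ)
    rw [e, l2_vol_test]
    refine (norm_integral_mul_testD_le hψ hχ hχc hχs hχ1 hχΩ hF hB hBD hℓ hw j θ).trans ?_
    have := l2_nonneg volume θ
    gcongr
  refine ⟨u, by rw [hu]; exact hu₀n.trans hwn, hud, fun θ => ?_⟩
  rw [hu, ofL2_apply, hint, ← hw]
  refine integral_congr_ae (.of_forall fun x => ?_)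
  simp only [conjLap_apply, extendTest_coe]

end Regularity

/-! ### Limiting Carleman weights -/

section Weights

variable {n : ℕ}

lemma hess_comm {g : Euc n → ℝ} (hg : ContDiff ℝ ∞ g) (x : Euc n) (p q : Fin n → ℝ) :
    hess g x p q = hess g x q p := by
  rw [hess, Finset.sum_comm, hess]
  refine Finset.sum_congr rfl fun j _ => Finset.sum_congr rfl fun k _ => ?_
  rw [pd_comm hg]
  ring

lemma hess_sub_mul {g : Euc n → ℝ} (hg : ContDiff ℝ ∞ g) (x : Euc n) (p q : Fin n → ℝ) (t : ℝ) :
    hess g x (fun j => p j - t * q j) (fun j => p j - t * q j)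
      = hess g x p p - 2 * t * hess g x q p + t ^ 2 * hess g x q q := by
  have h : hess g x (fun j => p j - t * q j) (fun j => p j - t * q j)
      = hess g x p p - t * hess g x q p - t * hess g x p q + t ^ 2 * hess g x q q := by
    simp only [hess, Finset.mul_sum, ← Finset.sum_sub_distrib, ← Finset.sum_add_distrib]
    refine Finset.sum_congr rfl fun j _ => Finset.sum_congr rfl fun k _ => ?_
    ring
  rw [h, hess_comm hg x p q]
  ring

/-- The bracket condition for a limiting Carleman weight in polarized form. -/
lemma lcwIdentity_of_bracket {g ν : Euc n → ℝ} (hg : ContDiff ℝ ∞ g) {x : Euc n}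
    (hx : 0 < gradSq g x)
    (hν : ν x * gradSq g x = hess g x (fun j => pd j g x) (fun j => pd j g x))
    (H : ∀ p : Fin n → ℝ, ∑ j, p j ^ 2 = gradSq g x → ∑ j, pd j g x * p j = 0 →
      hess g x p p + hess g x (fun j => pd j g x) (fun j => pd j g x) = 0) :
    LCWIdentity g ν x := by
  intro p
  set G := gradSq g x with hG
  set N : Fin n → ℝ := fun j => pd j g x with hN
  -- The vector p is split into its component along ∇g and the orthogonal remainder p', to which the
  -- bracket hypothesis applies after scaling.
  set t : ℝ := (∑ j, pd j g x * p j) / G with ht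
  have htG : t * G = ∑ j, pd j g x * p j := by rw [ht]; field_simp
  set p' : Fin n → ℝ := fun j => p j - t * N j with hp'
  have hNN : ∑ j, N j * N j = G := by simp [hG, gradSq, hN, sq]
  have horth : ∑ j, pd j g x * p' j = 0 := by
    have : ∑ j, pd j g x * p' j = (∑ j, pd j g x * p j) - t * ∑ j, N j * N j := by
      rw [Finset.mul_sum, ← Finset.sum_sub_distrib]
      exact Finset.sum_congr rfl fun j _ => by simp only [hp', hN]; ring
    rw [this, hNN, htG, sub_self]
  have hnorm : ∑ j, p' j ^ 2 = (∑ j, p j ^ 2) - t ^ 2 * G := by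
    have : ∑ j, p' j ^ 2 = (∑ j, p j ^ 2) - 2 * t * (∑ j, pd j g x * p j)
        + t ^ 2 * ∑ j, N j * N j := by
      rw [Finset.mul_sum, Finset.mul_sum, ← Finset.sum_sub_distrib, ← Finset.sum_add_distrib]
      exact Finset.sum_congr rfl fun j _ => by simp only [hp', hN]; ring
    rw [this, hNN, ← htG]
    ring
  have hQ' : hess g x p' p' = -ν x * ∑ j, p' j ^ 2 := by
    rcases (Finset.sum_nonneg fun j _ => sq_nonneg (p' j) : 0 ≤ ∑ j, p' j ^ 2).eq_or_lt with h0 | h0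
    · have hz : ∀ j, p' j = 0 := fun j => by
        have := (Finset.sum_eq_zero_iff_of_nonneg fun j _ => sq_nonneg (p' j)).1 h0.symm j
          (Finset.mem_univ j)
        exact pow_eq_zero_iff (two_ne_zero) |>.1 this
      rw [← h0, mul_zero]
      simp [hess, hz]
    · set S := ∑ j, p' j ^ 2 with hS
      -- The hypothesis concerns vectors of length |∇g| only; s rescales p' to this length, and the
      -- Hessian form is homogeneous of degree two.
      set s : ℝ := Real.sqrt (G / S) with hs
      have hs2 : s ^ 2 = G / S := Real.sq_sqrt (by positivity)
      have h1 := H (fun j => s * p' j)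
        (by simp only [mul_pow, ← Finset.mul_sum]; rw [← hS, hs2]; field_simp)
        (by
          have : ∑ j, pd j g x * (s * p' j) = s * ∑ j, pd j g x * p' j := by
            rw [Finset.mul_sum]; exact Finset.sum_congr rfl fun j _ => by ring
          rw [this, horth, mul_zero])
      rw [hess_smul, hs2, ← hν] at h1
      have h2 : G * (hess g x p' p' + ν x * S) = 0 := by
        field_simp at h1
        rw [mul_zero] at h1
        have h3 : hess g x p' p' + S * ν x = 0 := by
          rcases mul_eq_zero.1 h1 with h | h
          · exact absurd h hx.ne'
          · exact h
        linear_combination G * h3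
      rcases mul_eq_zero.1 h2 with h | h
      · exact absurd h hx.ne'
      · linarith
  rw [hp', hess_sub_mul hg, ← hp', hnorm, ← hν] at hQ'
  rw [← htG]
  linear_combination G * hQ'

/-- A smooth Urysohn function between two nested relatively compact neighbourhoods of K. The value 1
on an open set, rather than on K alone, makes derivatives agree on K when the cutoff is used to
extend functions. -/
lemma exists_cutoff {K V : Set (Euc n)} (hK : IsCompact K) (hV : IsOpen V) (hKV : K ⊆ V) :
    ∃ χ : Euc n → ℝ, ContDiff ℝ ∞ χ ∧ HasCompactSupport χ ∧ tsupport χ ⊆ V ∧ (∀ x, |χ x| ≤ 1) ∧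
      ∃ W : Set (Euc n), IsOpen W ∧ K ⊆ W ∧ ∀ x ∈ W, χ x = 1 := by
  obtain ⟨W₂, hW₂, hKW₂, hW₂V, hW₂c⟩ := exists_open_between_and_isCompact_closure hK hV hKV
  obtain ⟨W₁, hW₁, hKW₁, hW₁W₂, hW₁c⟩ := exists_open_between_and_isCompact_closure hK hW₂ hKW₂
  obtain ⟨χ, h0, h1, h01⟩ := exists_contMDiffMap_zero_one_of_isClosed (n := ⊤)
    (modelWithCornersSelf ℝ (Euc n)) hW₂.isClosed_compl isClosed_closure
    (disjoint_compl_left_iff_subset.2 hW₁W₂)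
  have hs : tsupport χ ⊆ closure W₂ := closure_mono fun x hx => by
    by_contra h
    exact hx (h0 h)
  refine ⟨χ, χ.contMDiff.contDiff, hW₂c.of_isClosed_subset (isClosed_tsupport _) hs,
    hs.trans hW₂V, fun x => abs_le.2 ⟨by linarith [(h01 x).1], (h01 x).2⟩, W₁, hW₁, hKW₁,
    fun x hx => h1 (subset_closure hx)⟩

/-- A function smooth near a compact set agrees near it with a smooth function of compact
support. -/
lemma exists_smooth_extension {K V : Set (Euc n)} (hK : IsCompact K) (hV : IsOpen V) (hKV : K ⊆ V)
    {g : Euc n → ℝ} (hg : ContDiffOn ℝ ∞ g V) :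
    ∃ f : Euc n → ℝ, ContDiff ℝ ∞ f ∧ HasCompactSupport f ∧
      ∃ W : Set (Euc n), IsOpen W ∧ K ⊆ W ∧ W ⊆ V ∧ ∀ x ∈ W, f x = g x := by
  obtain ⟨χ, hχ, hχc, hχs, -, W, hW, hKW, hW1⟩ := exists_cutoff hK hV hKV
  refine ⟨fun x => χ x * g x, ?_, hχc.mul_right, W, hW, hKW, fun x hx => hχs ?_, fun x hx => by
    beta_reduce; rw [hW1 x hx, one_mul]⟩
  · refine contDiff_iff_contDiffAt.2 fun x => ?_
    by_cases hx : x ∈ tsupport χ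
    · exact hχ.contDiffAt.mul (hg.contDiffAt (hV.mem_nhds (hχs hx)))
    · refine (contDiffAt_const (c := (0 : ℝ))).congr_of_eventuallyEq ?_
      filter_upwards [notMem_tsupport_iff_eventuallyEq.1 hx] with y hy
      rw [hy, Pi.zero_apply, zero_mul]
  · refine subset_tsupport _ ?_
    rw [Function.mem_support, hW1 x hx]
    exact one_ne_zero

lemma inner_gradient (φ : Euc n → ℝ) (x v : Euc n) : inner ℝ (gradient φ x) v = fderiv ℝ φ x v :=
  InnerProductSpace.toDual_symm_apply

lemma fderiv_eq_sum_pd (φ : Euc n → ℝ) (x v : Euc n) :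
    fderiv ℝ φ x v = ∑ j, v j * pd j φ x := by
  conv_lhs => rw [← (EuclideanSpace.basisFun (Fin n) ℝ).sum_repr v, map_sum]
  refine Finset.sum_congr rfl fun j _ => ?_
  rw [map_smul, smul_eq_mul, EuclideanSpace.basisFun_repr, EuclideanSpace.basisFun_apply]
  rfl

lemma gradient_apply (φ : Euc n → ℝ) (x : Euc n) (j : Fin n) : gradient φ x j = pd j φ x := by
  have := inner_gradient φ x (stdVec j)
  rw [EuclideanSpace.inner_single_right] at this
  simpa [pd] using this

lemma norm_gradient_sq (φ : Euc n → ℝ) (x : Euc n) : ‖gradient φ x‖ ^ 2 = gradSq φ x := by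
  rw [EuclideanSpace.norm_sq_eq]
  simp only [gradient_apply, Real.norm_eq_abs, sq_abs, gradSq]

lemma carlemanSymbol_re (φ : Euc n → ℝ) (x ξ : Euc n) :
    (carlemanSymbol φ x ξ).re = ‖ξ‖ ^ 2 - gradSq φ x := by
  rw [← norm_gradient_sq]
  simp [carlemanSymbol, -Complex.ofReal_pow]

lemma carlemanSymbol_im (φ : Euc n → ℝ) (x ξ : Euc n) :
    (carlemanSymbol φ x ξ).im = 2 * ∑ j, ξ j * pd j φ x := by
  rw [← fderiv_eq_sum_pd, ← inner_gradient]
  simp [carlemanSymbol, -Complex.ofReal_pow]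

/-- With Re p = |ξ|² - |∇φ|² and Im p = 2∇φ·ξ, the ξ-derivatives are 2ξ and 2∇φ, while every
x-derivative contributes one Hessian. The characteristic set p = 0 consists of the ξ orthogonal to
∇φ with |ξ| = |∇φ|, so the weight condition concerns the Hessian on that sphere. -/
lemma poissonBracket_carlemanSymbol {φ : Euc n → ℝ} (hφ : ContDiff ℝ ∞ φ) (x ξ : Euc n) :
    poissonBracket (fun y η => (carlemanSymbol φ y η).re) (fun y η => (carlemanSymbol φ y η).im) x ξ
      = 4 * (hess φ x ξ ξ + hess φ x (fun j => pd j φ x) (fun j => pd j φ x)) := by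
  simp only [carlemanSymbol_re, carlemanSymbol_im, poissonBracket]
  have h1 : ∀ j, fderiv ℝ (fun η : Euc n => ‖η‖ ^ 2 - gradSq φ x) ξ (stdVec j) = 2 * ξ j := by
    intro j
    rw [fderiv_sub_const, fderiv_norm_sq_apply]
    simp [EuclideanSpace.inner_single_right]
  have h2 : ∀ j, fderiv ℝ (fun y : Euc n => 2 * ∑ k, ξ k * pd k φ y) x (stdVec j)
      = 2 * ∑ k, ξ k * pd j (pd k φ) x := by
    intro j
    have hs : ∀ k, ContDiff ℝ ∞ fun y => ξ k * pd k φ y := fun k =>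
      contDiff_const.mul (contDiff_pd hφ k)
    change pd j (fun y : Euc n => 2 * ∑ k, ξ k * pd k φ y) x = _
    rw [pd_const_mul (ContDiff.sum fun k _ => hs k), pd_sum _ hs]
    congr 1
    exact Finset.sum_congr rfl fun k _ => pd_const_mul (contDiff_pd hφ k) _ _ _
  have h3 : ∀ j, fderiv ℝ (fun y : Euc n => ‖ξ‖ ^ 2 - gradSq φ y) x (stdVec j)
      = -(2 * ∑ k, pd k φ x * pd k (pd j φ) x) := by
    intro j
    change pd j (fun y : Euc n => ‖ξ‖ ^ 2 - gradSq φ y) x = _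
    rw [pd_sub contDiff_const (contDiff_gradSq hφ), pd_gradSq hφ]
    simp [pd]
  have h4 : ∀ j, fderiv ℝ (fun η : Euc n => 2 * ∑ k, η k * pd k φ x) ξ (stdVec j)
      = 2 * pd j φ x := by
    intro j
    have : (fun η : Euc n => 2 * ∑ k, η k * pd k φ x) = fun η => ((2 : ℝ) • fderiv ℝ φ x) η := by
      funext η
      rw [smul_apply, fderiv_eq_sum_pd, smul_eq_mul]
    rw [this, ContinuousLinearMap.fderiv]
    rfl
  simp only [h1, h2, h3, h4]
  rw [Finset.sum_sub_distrib, mul_add, sub_eq_add_neg, ← Finset.sum_neg_distrib]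
  congr 1
  · simp only [hess, Finset.mul_sum]
    refine Finset.sum_congr rfl fun j _ => Finset.sum_congr rfl fun k _ => ?_
    ring
  · rw [hess, Finset.sum_comm]
    simp only [Finset.mul_sum, Finset.sum_mul, ← Finset.sum_neg_distrib]
    refine Finset.sum_congr rfl fun j _ => Finset.sum_congr rfl fun k _ => ?_
    ring

lemma gradSq_neg (g : Euc n → ℝ) (x : Euc n) : gradSq (fun y => -g y) x = gradSq g x := by
  simp only [gradSq, pd_neg, neg_sq]

lemma hess_neg (g : Euc n → ℝ) (x : Euc n) (p q : Fin n → ℝ) :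
    hess (fun y => -g y) x p q = -hess g x p q := by
  have : ∀ k, pd k (fun y => -g y) = fun y => -pd k g y := fun k => funext fun y => pd_neg g k y
  simp only [hess, this, pd_neg, neg_mul, Finset.sum_neg_distrib]

/-- Everything that is used about a limiting Carleman weight near the closure of a bounded set:
`-φ` is given near `Ω` by a function `f` of compact support to which the Carleman estimate applies
on the slightly larger set `Ω'`. -/
lemma exists_global_weight {Ω U : Opens (Euc n)} (hΩ : Bornology.IsBounded (Ω : Set (Euc n)))
    (hU : closure (Ω : Set (Euc n)) ⊆ U) {φ : Euc n → ℝ} (hφ : IsLimitingCarlemanWeight U φ) :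
    ∃ f ν χ : Euc n → ℝ, ∃ Ω' : Opens (Euc n), ContDiff ℝ ∞ f ∧ ContDiff ℝ ∞ ν ∧ ContDiff ℝ ∞ χ ∧
      HasCompactSupport f ∧ HasCompactSupport χ ∧ tsupport χ ⊆ Ω' ∧ (∀ x, |χ x| ≤ 1) ∧
      (∀ x ∈ Ω, χ x = 1) ∧ (Ω : Set (Euc n)) ⊆ Ω' ∧ IsCompact (closure (Ω' : Set (Euc n))) ∧
      (∃ c : ℝ, 0 < c ∧ ∀ x ∈ closure (Ω' : Set (Euc n)), c ≤ gradSq f x) ∧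
      (∀ x ∈ closure (Ω' : Set (Euc n)), LCWIdentity f ν x) ∧
      ∃ W : Set (Euc n), IsOpen W ∧ closure (Ω : Set (Euc n)) ⊆ W ∧ ∀ x ∈ W, f x = -φ x := by
  obtain ⟨O, hO, hΩO, hOU, hOc⟩ :=
    exists_open_between_and_isCompact_closure hΩ.isCompact_closure U.isOpen hU
  -- The sign is reversed because transposition exchanges the weights φ and -φ.
  obtain ⟨f, hf, hfc, W, hW, hOW, hWU, hfW⟩ :=
    exists_smooth_extension hOc U.isOpen hOU hφ.smooth.neg
  have hev : ∀ x ∈ W, ∀ᶠ y in nhds x, φ y = -f y := fun x hx => by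
    filter_upwards [hW.mem_nhds hx] with y hy
    rw [hfW y hy, neg_neg]
  have hpos : ∀ x ∈ W, 0 < gradSq f x := fun x hx => by
    have h1 : gradient φ x ≠ 0 := hφ.gradient_ne_zero x (hWU hx)
    have h2 : fderiv ℝ φ x = fderiv ℝ (fun y => -f y) x :=
      Filter.EventuallyEq.fderiv_eq (hev x hx)
    have h3 : gradSq φ x = gradSq f x := by
      rw [← gradSq_neg f]
      simp only [gradSq, pd, h2]
    rw [← h3, ← norm_gradient_sq]
    exact pow_pos (norm_pos_iff.2 h1) 2
  have hQ : ContDiffOn ℝ ∞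
      (fun x => hess f x (fun j => pd j f x) (fun j => pd j f x) / gradSq f x) W := by
    refine ContDiffOn.div (ContDiff.contDiffOn ?_) (contDiff_gradSq hf).contDiffOn
      fun x hx => (hpos x hx).ne'
    exact ContDiff.sum fun j _ => ContDiff.sum fun k _ =>
      ((contDiff_pd (contDiff_pd hf k) j).mul (contDiff_pd hf j)).mul (contDiff_pd hf k)
  -- The quotient f''(∇f, ∇f)/|∇f|² is smooth only near points where ∇f ≠ 0; its extension agrees
  -- with it on the closure of Ω'.
  obtain ⟨ν, hν, -, W', hW', hOW', hW'W, hνW⟩ := exists_smooth_extension hOc hW hOW hQ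
  obtain ⟨χ, hχ, hχc, hχs, hχ1, Wχ, -, hΩWχ, hχW⟩ :=
    exists_cutoff hΩ.isCompact_closure hO hΩO
  have hmin : ∃ c : ℝ, 0 < c ∧ ∀ x ∈ closure O, c ≤ gradSq f x := by
    rcases (closure O).eq_empty_or_nonempty with he | hne
    · exact ⟨1, one_pos, fun x hx => by rw [he] at hx; exact hx.elim⟩
    · obtain ⟨x₀, hx₀, hm⟩ :=
        hOc.exists_isMinOn hne (contDiff_gradSq hf).continuous.continuousOn
      exact ⟨gradSq f x₀, hpos x₀ (hOW hx₀), fun x hx => hm hx⟩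
  refine ⟨f, ν, χ, ⟨O, hO⟩, hf, hν, hχ, hfc, hχc, hχs, hχ1,
    fun x hx => hχW x (hΩWχ (subset_closure hx)), subset_closure.trans hΩO, hOc, hmin,
    fun x hx => ?_, W, hW, (hΩO.trans subset_closure).trans hOW, hfW⟩
  have hxW := hOW hx
  refine lcwIdentity_of_bracket hf (hpos x hxW) ?_ fun p hp hpo => ?_
  · rw [hνW x (hOW' hx)]
    field_simp [(hpos x hxW).ne']
  -- Near x the functions φ and -f coincide, so their symbols have the same derivatives and the
  -- bracket condition passes to -f, for which the global formula is available. Replacing -f by f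
  -- only changes the sign of the vanishing expression.
  · have hsym : ∀ η : Euc n, (fun y => carlemanSymbol φ y η)
        =ᶠ[nhds x] fun y => carlemanSymbol (fun z => -f z) y η := fun η => by
      filter_upwards [hW.mem_nhds hxW] with y hy
      have : gradient φ y = gradient (fun z => -f z) y := by
        simp only [gradient, Filter.EventuallyEq.fderiv_eq (hev y hy)]
      simp only [carlemanSymbol, this]
    set ξ : Euc n := WithLp.toLp 2 p with hξ
    have hnf : ContDiff ℝ ∞ fun z => -f z := hf.neg
    have h0 : carlemanSymbol φ x ξ = 0 := by
      rw [(hsym ξ).eq_of_nhds]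
      apply Complex.ext
      · rw [carlemanSymbol_re, gradSq_neg, EuclideanSpace.norm_sq_eq]
        simp only [Real.norm_eq_abs, sq_abs, hξ]
        rw [hp, sub_self]
        rfl
      · rw [carlemanSymbol_im]
        simp only [pd_neg, hξ]
        have : ∑ j, p j * -pd j f x = -∑ j, pd j f x * p j := by
          rw [← Finset.sum_neg_distrib]
          exact Finset.sum_congr rfl fun j _ => by ring
        rw [this, hpo]
        simp
    have hb := hφ.poissonBracket_eq_zero x (hWU hxW) ξ h0
    have heq : poissonBracket (fun y η => (carlemanSymbol φ y η).re)
        (fun y η => (carlemanSymbol φ y η).im) x ξ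
        = poissonBracket (fun y η => (carlemanSymbol (fun z => -f z) y η).re)
          (fun y η => (carlemanSymbol (fun z => -f z) y η).im) x ξ := by
      have e1 : (fun η => carlemanSymbol φ x η) = fun η => carlemanSymbol (fun z => -f z) x η :=
        funext fun η => (hsym η).eq_of_nhds
      have e2 : fderiv ℝ (fun y => (carlemanSymbol φ y ξ).re) x
          = fderiv ℝ (fun y => (carlemanSymbol (fun z => -f z) y ξ).re) x :=
        Filter.EventuallyEq.fderiv_eq ((hsym ξ).fun_comp Complex.re)
      have e3 : fderiv ℝ (fun y => (carlemanSymbol φ y ξ).im) x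
          = fderiv ℝ (fun y => (carlemanSymbol (fun z => -f z) y ξ).im) x :=
        Filter.EventuallyEq.fderiv_eq ((hsym ξ).fun_comp Complex.im)
      have e4 : (fun η => (carlemanSymbol φ x η).re)
        = fun η => (carlemanSymbol (fun z => -f z) x η).re :=
        congrArg (fun g : Euc n → ℂ => fun η => (g η).re) e1
      have e5 : (fun η => (carlemanSymbol φ x η).im)
        = fun η => (carlemanSymbol (fun z => -f z) x η).im :=
        congrArg (fun g : Euc n → ℂ => fun η => (g η).im) e1
      simp only [poissonBracket, e4, e5, e2, e3]
    rw [heq, poissonBracket_carlemanSymbol hnf] at hb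
    have e6 : (fun j => pd j (fun z => -f z) x) = fun j => (-1) * pd j f x :=
      funext fun j => by rw [pd_neg]; ring
    rw [e6, hess_smul, hess_neg, hess_neg] at hb
    change 4 * (-hess f x p p + _) = 0 at hb
    linarith

end Weights

/-! ### `H¹(Ω)` as a closed subspace -/

section SobolevSpace

variable {n : ℕ} {Ω Ω' : Opens (Euc n)}

/-- Pairing of an `L²` function on `Ω` with test functions on a larger set. -/
def pairL2 (Ω' : Opens (Euc n)) (f : Lp ℂ 2 (vol Ω)) : 𝓓(Ω', ℂ) →ₗ[ℂ] ℂ where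
  toFun θ := ∫ x, f x * θ x ∂(vol Ω)
  map_add' θ η := by
    rw [← integral_add (integrable_lp_mul f (test_memLp _ θ))
      (integrable_lp_mul f (test_memLp _ η))]
    exact integral_congr_ae (.of_forall fun x => mul_add _ _ _)
  map_smul' c θ := by
    rw [RingHom.id_apply, smul_eq_mul, ← integral_const_mul]
    exact integral_congr_ae (.of_forall fun x => mul_left_comm _ _ _)

lemma ofL2_eq_inner (f : Lp ℂ 2 (vol Ω)) (θ : 𝓓(Ω, ℂ)) :
    ofL2 f θ = inner ℂ (toL2conj (vol Ω) θ) f := (inner_toL2conj (vol Ω) θ f).symm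

lemma ofL2_add (f g : Lp ℂ 2 (vol Ω)) (θ : 𝓓(Ω, ℂ)) : ofL2 (f + g) θ = ofL2 f θ + ofL2 g θ := by
  simp only [ofL2_eq_inner, inner_add_right]

lemma ofL2_sub (f g : Lp ℂ 2 (vol Ω)) (θ : 𝓓(Ω, ℂ)) : ofL2 (f - g) θ = ofL2 f θ - ofL2 g θ := by
  simp only [ofL2_eq_inner, inner_sub_right]

lemma ofL2_smul (c : ℂ) (f : Lp ℂ 2 (vol Ω)) (θ : 𝓓(Ω, ℂ)) : ofL2 (c • f) θ = c * ofL2 f θ := by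
  simp only [ofL2_eq_inner, inner_smul_right]

lemma norm_pairL2_le (f : Lp ℂ 2 (vol Ω)) (θ : 𝓓(Ω', ℂ)) :
    ‖pairL2 Ω' f θ‖ ≤ ‖f‖ * l2 (vol Ω) θ :=
  norm_integral_lp_mul_le f (test_memLp _ θ)

lemma l2_vol_le (θ : 𝓓(Ω', ℂ)) : l2 (vol Ω) θ ≤ l2 volume θ :=
  ENNReal.toReal_mono (test_memLp volume θ).2.ne (eLpNorm_mono_measure _ Measure.restrict_le_self)

/-- The ambient Hilbert space of pairs `(u, (h D_j u)_j)`. -/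
abbrev SobAmbient (Ω : Opens (Euc n)) : Type :=
  PiLp 2 (fun _ : Option (Fin n) => Lp ℂ 2 (vol Ω))

/-- `u ↦ (u, (h D_j u)_j)`. -/
def H1.toAmbient (h : ℝ) (u : H1 Ω) : SobAmbient Ω :=
  WithLp.toLp 2 fun i => Option.elim i u.fn fun j => (h : ℂ) • u.D j

lemma H1.norm_toAmbient (h : ℝ) (u : H1 Ω) : ‖u.toAmbient h‖ = u.sclNorm h := by
  rw [PiLp.norm_eq_of_L2, Fintype.sum_option]
  rfl

lemma H1.sclNorm_nonneg (h : ℝ) (u : H1 Ω) : 0 ≤ u.sclNorm h := Real.sqrt_nonneg _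

lemma H1.norm_fn_le (h : ℝ) (u : H1 Ω) : ‖u.fn‖ ≤ u.sclNorm h := by
  rw [← u.norm_toAmbient h]
  exact PiLp.norm_apply_le (u.toAmbient h) none

lemma H1.norm_D_le (h : ℝ) (u : H1 Ω) (j : Fin n) : ‖(h : ℂ) • u.D j‖ ≤ u.sclNorm h := by
  rw [← u.norm_toAmbient h]
  exact PiLp.norm_apply_le (u.toAmbient h) (some j)

lemma H1.sclNorm_le {h a b : ℝ} {u : H1 Ω} (ha : ‖u.fn‖ ≤ a) (hb : ∀ j, ‖(h : ℂ) • u.D j‖ ≤ b) :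
    u.sclNorm h ≤ a + n * b := by
  have ha0 : 0 ≤ a := (norm_nonneg _).trans ha
  have hb0 : 0 ≤ n * b := by
    rcases n.eq_zero_or_pos with rfl | hn
    · simp
    · exact mul_nonneg (Nat.cast_nonneg _) ((norm_nonneg _).trans (hb ⟨0, hn⟩))
  have h1 : ∑ j, ‖(h : ℂ) • u.D j‖ ^ 2 ≤ (n * b) ^ 2 := by
    refine (Finset.sum_sq_le_sq_sum_of_nonneg fun j _ => norm_nonneg _).trans ?_
    refine pow_le_pow_left₀ (Finset.sum_nonneg fun j _ => norm_nonneg _) ?_ 2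
    refine (Finset.sum_le_sum fun j _ => hb j).trans_eq ?_
    simp
  refine Real.sqrt_le_iff.2 ⟨by positivity, ?_⟩
  nlinarith [norm_nonneg u.fn, mul_nonneg ha0 hb0, pow_le_pow_left₀ (norm_nonneg _) ha 2]

/-- The set of pairs `(u, (h D_j u)_j)` with `u ∈ H¹(Ω)`. -/
def sobGraph (Ω : Opens (Euc n)) (h : ℝ) : Submodule ℂ (SobAmbient Ω) where
  carrier := {W | ∀ (j : Fin n) (θ : 𝓓(Ω, ℂ)),
    -((h : ℂ) * ofL2 (W none) (testD j θ)) = ofL2 (W (some j)) θ}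
  add_mem' {W W'} hW hW' j θ := by
    have h1 := hW j θ
    have h2 := hW' j θ
    rw [PiLp.add_apply, PiLp.add_apply, ofL2_add, ofL2_add, ← h1, ← h2]
    ring
  zero_mem' j θ := by
    simp [ofL2_eq_inner]
  smul_mem' c W hW j θ := by
    have h1 := hW j θ
    rw [PiLp.smul_apply, PiLp.smul_apply, ofL2_smul, ofL2_smul, ← h1]
    ring

/-- Each defining condition equates two inner products with fixed vectors. Closedness keeps limits
of test functions and sums of convergent series in H¹. -/
lemma isClosed_sobGraph (h : ℝ) : IsClosed (sobGraph Ω h : Set (SobAmbient Ω)) := by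
  have : (sobGraph Ω h : Set (SobAmbient Ω)) = ⋂ (j : Fin n) (θ : 𝓓(Ω, ℂ)),
      {W | -((h : ℂ) * ofL2 (W none) (testD j θ)) = ofL2 (W (some j)) θ} := by
    ext W
    simp only [mem_iInter]
    rfl
  rw [this]
  refine isClosed_iInter fun j => isClosed_iInter fun θ => ?_
  simp only [ofL2_eq_inner]
  refine isClosed_eq ?_ ?_
  · exact (continuous_const.mul (continuous_const.inner (PiLp.continuous_apply 2 _ none))).neg
  · exact continuous_const.inner (PiLp.continuous_apply 2 _ (some j))

lemma H1.toAmbient_mem (h : ℝ) (u : H1 Ω) : u.toAmbient h ∈ sobGraph Ω h := by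
  intro j θ
  have h1 : -(ofL2 u.fn (testD j θ)) = ofL2 (u.D j) θ := LinearMap.congr_fun (u.distD_eq j) θ
  change -((h : ℂ) * ofL2 u.fn (testD j θ)) = ofL2 ((h : ℂ) • u.D j) θ
  rw [ofL2_smul, ← h1]
  ring

/-- The element of `H¹(Ω)` given by an element of the graph. -/
def H1.ofGraph {h : ℝ} (hh : h ≠ 0) {W : SobAmbient Ω} (hW : W ∈ sobGraph Ω h) : H1 Ω where
  fn := W none
  D j := (h : ℂ)⁻¹ • W (some j)
  distD_eq j := by
    ext θ
    change -(ofL2 (W none) (testD j θ)) = _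
    have h1 : -((h : ℂ) * ofL2 (W none) (testD j θ)) = ofL2 (W (some j)) θ := hW j θ
    have hc : (h : ℂ) ≠ 0 := by exact_mod_cast hh
    rw [ofL2_smul, ← h1]
    field_simp

lemma H1.toAmbient_ofGraph {h : ℝ} (hh : h ≠ 0) {W : SobAmbient Ω} (hW : W ∈ sobGraph Ω h) :
    (H1.ofGraph hh hW).toAmbient h = W := by
  have hc : (h : ℂ) ≠ 0 := by exact_mod_cast hh
  ext1 i
  cases i with
  | none => rfl
  | some j =>
    change (h : ℂ) • (h : ℂ)⁻¹ • W (some j) = W (some j)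
    rw [smul_smul, mul_inv_cancel₀ hc, one_smul]

/-- The complex conjugate of a test function. -/
def conjTest (θ : 𝓓(Ω, ℂ)) : 𝓓(Ω, ℂ) where
  toFun x := starRingEnd ℂ (θ x)
  contDiff' := Complex.conjCLE.contDiff.comp θ.contDiff
  hasCompactSupport' := θ.hasCompactSupport.comp_left (map_zero (starRingEnd ℂ))
  tsupport_subset' := (tsupport_comp_subset (g := starRingEnd ℂ) (map_zero _) θ).trans
    θ.tsupport_subset

lemma testD_conjTest (j : Fin n) (θ : 𝓓(Ω, ℂ)) (x : Euc n) :
    testD j (conjTest θ) x = -starRingEnd ℂ (testD j θ x) := by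
  have h1 : pd j (conjTest θ) x = starRingEnd ℂ (pd j θ x) := by
    have := ((Complex.conjCLE.toContinuousLinearMap).hasFDerivAt.comp x
      (differentiableAt_of_contDiff (contDiff_test θ) x).hasFDerivAt).fderiv
    change fderiv ℝ (Complex.conjCLE ∘ θ) x _ = _
    erw [this]
    rfl
  rw [testD_apply', testD_apply', h1, map_mul, Complex.inv_I, map_neg, Complex.conj_I]
  ring

/-- The conjugate-linear embedding of the test functions into `H¹`. -/
def testAmbient (h : ℝ) : 𝓓(Ω, ℂ) →ₛₗ[starRingEnd ℂ] SobAmbient Ω where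
  toFun θ := WithLp.toLp 2 fun i => Option.elim i (toL2conj (vol Ω) θ)
    fun j => toL2conj (vol Ω) (-((h : ℂ) • testD j θ))
  map_add' θ η := by
    ext1 i
    cases i with
    | none => exact map_add _ _ _
    | some j =>
      change toL2conj (vol Ω) _ = toL2conj (vol Ω) _ + toL2conj (vol Ω) _
      rw [← map_add, map_add, smul_add, neg_add]
  map_smul' c θ := by
    ext1 i
    cases i with
    | none => exact (toL2conj (vol Ω)).map_smulₛₗ c θ
    | some j =>
      have e : -((h : ℂ) • testD j (c • θ)) = c • -((h : ℂ) • testD j θ) := by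
        rw [(testD j).map_smul c θ, smul_neg, smul_comm (h : ℂ) c]
      change toL2conj (vol Ω) (-((h : ℂ) • testD j (c • θ))) = _
      rw [e]
      exact (toL2conj (vol Ω)).map_smulₛₗ c _

/-- Complex conjugation anticommutes with D_j = i⁻¹∂_j; this accounts for the minus sign in
`testAmbient` and shows that its values lie in the graph of H¹. -/
lemma testAmbient_eq (h : ℝ) (θ : 𝓓(Ω, ℂ)) :
    testAmbient h θ = (testH1 (conjTest θ)).toAmbient h := by
  ext1 i
  cases i with
  | none => rfl
  | some j =>
    change toL2conj (vol Ω) (-((h : ℂ) • testD j θ))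
      = (h : ℂ) • (testFunction_memLp (testD j (conjTest θ))).toLp _
    apply Lp.ext
    filter_upwards [coeFn_toL2conj (vol Ω) (-((h : ℂ) • testD j θ)),
      Lp.coeFn_smul (h : ℂ) ((testFunction_memLp (testD j (conjTest θ))).toLp _),
      (testFunction_memLp (testD j (conjTest θ))).coeFn_toLp] with x h1 h2 h3
    rw [h1, h2, Pi.smul_apply, h3, testD_conjTest]
    change starRingEnd ℂ (-((h : ℂ) * testD j θ x)) = (h : ℂ) * _
    rw [map_neg, map_mul, Complex.conj_ofReal]
    ring

lemma norm_testAmbient (h : ℝ) (θ : 𝓓(Ω, ℂ)) : ‖testAmbient h θ‖ = (testH1 θ).sclNorm h := by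
  have h1 : ∀ η : 𝓓(Ω, ℂ), ‖toL2conj (vol Ω) η‖ = ‖(testFunction_memLp η).toLp η‖ := fun η => by
    rw [norm_toL2conj, Lp.norm_toLp, l2]
  rw [← H1.norm_toAmbient, PiLp.norm_eq_of_L2, PiLp.norm_eq_of_L2, Fintype.sum_option,
    Fintype.sum_option]
  congr 2
  · exact congrArg (· ^ 2) (h1 θ)
  · refine Finset.sum_congr rfl fun j _ => congrArg (· ^ 2) ?_
    change ‖toL2conj (vol Ω) (-((h : ℂ) • testD j θ))‖
      = ‖(h : ℂ) • (testFunction_memLp (testD j θ)).toLp _‖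
    rw [map_neg, norm_neg, map_smulₛₗ, norm_smul, norm_smul, RCLike.norm_conj, h1]

/-- An element of `H⁻¹` is of the form `(1 - h²Δ) u` with `u ∈ H¹`. -/
lemma exists_H1_riesz {h : ℝ} (hh : 0 < h) {K : ℝ} (hK : 0 ≤ K) (v : Functional Ω)
    (hv : ∀ θ, ‖v θ‖ ≤ K * (testH1 θ).sclNorm h) :
    ∃ u : H1 Ω, u.sclNorm h ≤ K ∧
      ∀ θ, v θ = ofL2 u.fn θ - ∑ j, (h : ℂ) * ofL2 ((h : ℂ) • u.D j) (testD j θ) := by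
  obtain ⟨W, hWc, hWn, hW⟩ := exists_riesz_representative (testAmbient h) v hK fun θ => by
    rw [norm_testAmbient]
    exact hv θ
  -- An arbitrary representative is a tuple of unrelated L² functions. Being a limit of test
  -- functions forces its components to be u and hD_ju.
  have hWg : W ∈ sobGraph Ω h := by
    have : closure (Set.range (testAmbient (Ω := Ω) h)) ⊆ sobGraph Ω h := by
      refine closure_minimal ?_ (isClosed_sobGraph h)
      rintro _ ⟨θ, rfl⟩
      rw [testAmbient_eq]
      exact H1.toAmbient_mem h _
    exact this hWc
  refine ⟨H1.ofGraph hh.ne' hWg, ?_, fun θ => ?_⟩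
  · rw [← H1.norm_toAmbient, H1.toAmbient_ofGraph]
    exact hWn
  · have h1 : ∀ j, (h : ℂ) • (H1.ofGraph hh.ne' hWg).D j = W (some j) := fun j =>
      congrArg (fun Z : SobAmbient Ω => Z (some j)) (H1.toAmbient_ofGraph hh.ne' hWg)
    simp only [h1]
    rw [hW, PiLp.inner_apply, Fintype.sum_option, sub_eq_add_neg, ← Finset.sum_neg_distrib]
    congr 1
    · exact (ofL2_eq_inner _ _).symm
    · refine Finset.sum_congr rfl fun j _ => ?_
      change inner ℂ (toL2conj (vol Ω) (-((h : ℂ) • testD j θ))) (W (some j)) = _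
      rw [← ofL2_eq_inner, map_neg, map_smul, smul_eq_mul]

end SobolevSpace

/-! ### Solvability of the conjugated Laplace equation -/

section Solvability

variable {n : ℕ} {Ω Ω' : Opens (Euc n)}

lemma exists_common_bound {ι : Type*} [Fintype ι] {F : ι → Euc n → ℝ}
    (hF : ∀ i, Continuous (F i)) (hc : ∀ i, HasCompactSupport (F i)) :
    ∃ a : ℝ, 1 ≤ a ∧ ∀ i x, |F i x| ≤ a := by
  choose B hB using fun i => (hc i).exists_bound_of_continuous (hF i)
  refine ⟨1 + ∑ i, |B i|, le_add_of_nonneg_right (Finset.sum_nonneg fun _ _ => abs_nonneg _),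
    fun i x => ?_⟩
  have h1 : |B i| ≤ ∑ i, |B i| :=
    Finset.single_le_sum (f := fun i => |B i|) (fun _ _ => abs_nonneg _) (Finset.mem_univ i)
  have h2 : |F i x| ≤ B i := hB i x
  linarith [le_abs_self (B i)]

lemma hasCompactSupport_lap {g : Euc n → ℝ} (hg : HasCompactSupport g) :
    HasCompactSupport (lap g) :=
  hasCompactSupport_of_notMem hg fun x hx => by
    simp [lap, (apply_eq_zero_of_notMem hx).2.2]

lemma hasCompactSupport_gradSq {g : Euc n → ℝ} (hg : HasCompactSupport g) :
    HasCompactSupport (gradSq g) :=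
  hasCompactSupport_of_notMem hg fun x hx => by
    simp [gradSq, (apply_eq_zero_of_notMem hx).2.1]

/-- Bounds on the coefficients, uniform in the convexification parameter and in `h`. -/
lemma exists_uniform_coefficient_bound {f χ : Euc n → ℝ} (hf : ContDiff ℝ ∞ f)
    (hfc : HasCompactSupport f) (hχ : ContDiff ℝ ∞ χ) (hχc : HasCompactSupport χ) :
    ∃ b : ℝ, 1 ≤ b ∧ ∀ κ h : ℝ, 0 ≤ κ → κ ≤ 1 → 0 ≤ h → h ≤ 1 →
      (∀ j x, |pd j (convexify f κ) x| ≤ b) ∧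
      (∀ x, |-1 - gradSq (convexify f κ) x - h * lap (convexify f κ) x| ≤ b) ∧
      (∀ x, |cutoffCoeff (convexify f κ) χ h x| ≤ b) ∧
      ∀ k x, |cutoffCoeffD (convexify f κ) χ h k x| ≤ b := by
  set g : Euc n → ℝ := fun x => 1 / 2 * (f x * f x) with hg
  have hgs : ContDiff ℝ ∞ g := contDiff_const.mul (hf.mul hf)
  have hgc : HasCompactSupport g := (hfc.mul_right (f' := f)).mul_left (f := fun _ => 1 / 2)
  obtain ⟨a₁, ha₁, hA₁⟩ := exists_common_bound
    (F := ![f, gradSq f, lap f, lap g, χ, lap χ])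
    (fun i => by
      fin_cases i
      exacts [hf.continuous, (contDiff_gradSq hf).continuous, (contDiff_lap hf).continuous,
        (contDiff_lap hgs).continuous, hχ.continuous, (contDiff_lap hχ).continuous])
    (fun i => by
      fin_cases i
      exacts [hfc, hasCompactSupport_gradSq hfc, hasCompactSupport_lap hfc,
        hasCompactSupport_lap hgc, hχc, hasCompactSupport_lap hχc])
  obtain ⟨a₂, ha₂, hA₂⟩ := exists_common_bound (F := fun j => pd j f)
    (fun j => (contDiff_pd hf j).continuous) (fun j => hasCompactSupport_pd hfc j)
  obtain ⟨a₃, ha₃, hA₃⟩ := exists_common_bound (F := fun j => pd j χ)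
    (fun j => (contDiff_pd hχ j).continuous) (fun j => hasCompactSupport_pd hχc j)
  set a := a₁ + a₂ + a₃ with ha
  have ha1 : 1 ≤ a := by linarith
  have hfa : ∀ x, |f x| ≤ a := fun x => (hA₁ 0 x).trans (by linarith)
  have hGa : ∀ x, gradSq f x ≤ a := fun x =>
    (le_abs_self _).trans ((hA₁ 1 x).trans (by linarith))
  have hla : ∀ x, |lap f x| ≤ a := fun x => (hA₁ 2 x).trans (by linarith)
  have hlga : ∀ x, |lap g x| ≤ a := fun x => (hA₁ 3 x).trans (by linarith)
  have hχa : ∀ x, |χ x| ≤ a := fun x => (hA₁ 4 x).trans (by linarith)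
  have hlχa : ∀ x, |lap χ x| ≤ a := fun x => (hA₁ 5 x).trans (by linarith)
  have hja : ∀ j x, |pd j f x| ≤ a := fun j x => (hA₂ j x).trans (by linarith)
  have hχja : ∀ j x, |pd j χ x| ≤ a := fun j x => (hA₃ j x).trans (by linarith)
  have ha0 : 0 ≤ a := by linarith
  have p2 : a ≤ a ^ 4 := le_self_pow₀ ha1 (by norm_num)
  have p3 : a ^ 2 ≤ a ^ 4 := pow_le_pow_right₀ ha1 (by norm_num)
  have p4 : a ^ 3 ≤ a ^ 4 := pow_le_pow_right₀ ha1 (by norm_num)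
  have p1 : 1 ≤ a ^ 4 := one_le_pow₀ ha1
  have hn0 : (0 : ℝ) ≤ n := Nat.cast_nonneg n
  have pn : (n : ℝ) * a ^ 3 ≤ n * a ^ 4 := mul_le_mul_of_nonneg_left p4 hn0
  have pn4 : (0 : ℝ) ≤ n * a ^ 4 := by positivity
  -- The largest of the four bounds is that of `cutoffCoeff`: a + a + 4a⁴ + 4na³ + 2a², with a ≥ 1.
  refine ⟨(8 + 4 * n) * a ^ 4, by nlinarith, fun κ h hκ0 hκ1 hh0 hh1 => ?_⟩
  have hψ1 : ∀ x, |1 + κ * f x| ≤ 2 * a := fun x => by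
    calc |1 + κ * f x| ≤ |1| + |κ * f x| := abs_add_le _ _
      _ = 1 + κ * |f x| := by rw [abs_one, abs_mul, abs_of_nonneg hκ0]
      _ ≤ a + 1 * a := by
          have := hfa x
          gcongr
      _ = 2 * a := by ring
  have hψj : ∀ j x, |pd j (convexify f κ) x| ≤ 2 * a ^ 2 := fun j x => by
    rw [pd_convexify hf, abs_mul]
    calc |1 + κ * f x| * |pd j f x| ≤ 2 * a * a :=
          mul_le_mul (hψ1 x) (hja j x) (abs_nonneg _) (by positivity)
      _ = _ := by ring
  have hψG : ∀ x, |gradSq (convexify f κ) x| ≤ 4 * a ^ 3 := fun x => by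
    rw [abs_of_nonneg (gradSq_nonneg _ _), gradSq_convexify hf, ← sq_abs]
    calc |1 + κ * f x| ^ 2 * gradSq f x ≤ (2 * a) ^ 2 * a := by
          have := hψ1 x
          have := hGa x
          have := gradSq_nonneg f x
          gcongr
      _ = _ := by ring
  have hψl : ∀ x, |lap (convexify f κ) x| ≤ 2 * a := fun x => by
    have e : lap (convexify f κ) x = lap f x + κ * lap g x :=
      congrFun (lap_add_const_mul hf hgs κ) x
    rw [e]
    calc |lap f x + κ * lap g x| ≤ |lap f x| + |κ * lap g x| := abs_add_le _ _
      _ = |lap f x| + κ * |lap g x| := by rw [abs_mul κ, abs_of_nonneg hκ0]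
      _ ≤ a + 1 * a := by
          have := hla x
          have := hlga x
          gcongr
      _ = 2 * a := by ring
  have hhl : ∀ x, |h * lap (convexify f κ) x| ≤ 2 * a := fun x => by
    rw [abs_mul, abs_of_nonneg hh0]
    calc h * |lap (convexify f κ) x| ≤ 1 * (2 * a) :=
          mul_le_mul hh1 (hψl x) (abs_nonneg _) zero_le_one
      _ = _ := one_mul _
  refine ⟨fun j x => (hψj j x).trans (by nlinarith), fun x => ?_, fun x => ?_, fun k x => ?_⟩
  · have h1 := abs_le.1 (hψG x)
    have h2 := abs_le.1 (hhl x)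
    exact abs_le.2 ⟨by linarith, by linarith⟩
  · have t1 := abs_le.1 (hχa x)
    have t2 : |h ^ 2 * lap χ x| ≤ a := by
      rw [abs_mul, abs_of_nonneg (sq_nonneg h)]
      calc h ^ 2 * |lap χ x| ≤ 1 * a :=
            mul_le_mul (pow_le_one₀ hh0 hh1) (hlχa x) (abs_nonneg _) zero_le_one
        _ = a := one_mul a
    have t3 : |gradSq (convexify f κ) x * χ x| ≤ 4 * a ^ 4 := by
      rw [abs_mul]
      calc _ ≤ 4 * a ^ 3 * a := mul_le_mul (hψG x) (hχa x) (abs_nonneg _) (by positivity)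
        _ = _ := by ring
    have t4 : |∑ j, pd j (convexify f κ) x * pd j χ x| ≤ n * (2 * a ^ 3) := by
      have hj : ∀ j, |pd j (convexify f κ) x * pd j χ x| ≤ 2 * a ^ 3 := fun j => by
        rw [abs_mul]
        calc _ ≤ 2 * a ^ 2 * a := mul_le_mul (hψj j x) (hχja j x) (abs_nonneg _) (by positivity)
          _ = 2 * a ^ 3 := by ring
      refine (Finset.abs_sum_le_sum_abs _ _).trans
        ((Finset.sum_le_sum fun j _ => hj j).trans_eq ?_)
      simp
    have t5 : |h * (2 * ∑ j, pd j (convexify f κ) x * pd j χ x)| ≤ 4 * (n * a ^ 3) := by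
      rw [abs_mul, abs_of_nonneg hh0, abs_mul, abs_two]
      calc _ ≤ 1 * (2 * (n * (2 * a ^ 3))) := by gcongr
        _ = _ := by ring
    have t6 : |h * lap (convexify f κ) x * χ x| ≤ 2 * a ^ 2 := by
      rw [abs_mul]
      calc _ ≤ 2 * a * a := mul_le_mul (hhl x) (hχa x) (abs_nonneg _) (by positivity)
        _ = _ := by ring
    have e : cutoffCoeff (convexify f κ) χ h x = χ x + h ^ 2 * lap χ x
        + gradSq (convexify f κ) x * χ x
        - h * (2 * ∑ j, pd j (convexify f κ) x * pd j χ x)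
        - h * lap (convexify f κ) x * χ x := by
      rw [cutoffCoeff]; ring
    rw [e]
    have t2' := abs_le.1 t2
    have t3' := abs_le.1 t3
    have t5' := abs_le.1 t5
    have t6' := abs_le.1 t6
    exact abs_le.2 ⟨by linarith, by linarith⟩
  · have t1 : |h * pd k χ x| ≤ a := by
      rw [abs_mul, abs_of_nonneg hh0]
      calc h * |pd k χ x| ≤ 1 * a := mul_le_mul hh1 (hχja k x) (abs_nonneg _) zero_le_one
        _ = a := one_mul a
    have t2 : |pd k (convexify f κ) x * χ x| ≤ 2 * a ^ 3 := by
      rw [abs_mul]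
      calc _ ≤ 2 * a ^ 2 * a := mul_le_mul (hψj k x) (hχa x) (abs_nonneg _) (by positivity)
        _ = _ := by ring
    have t1' := abs_le.1 t1
    have t2' := abs_le.1 t2
    rw [cutoffCoeffD]
    exact abs_le.2 ⟨by linarith, by linarith⟩

lemma contDiff_ofReal {a : Euc n → ℝ} (ha : ContDiff ℝ ∞ a) : ContDiff ℝ ∞ fun x => (a x : ℂ) :=
  Complex.ofRealCLM.contDiff.comp ha

/-- Multiplication of test functions by a smooth real function. -/
def mulReal {a : Euc n → ℝ} (ha : ContDiff ℝ ∞ a) : 𝓓(Ω, ℂ) →ₗ[ℂ] 𝓓(Ω, ℂ) :=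
  mulTest (fun x => (a x : ℂ)) (smoothNear_of_contDiff (contDiff_ofReal ha))

lemma mulReal_apply {a : Euc n → ℝ} (ha : ContDiff ℝ ∞ a) (θ : 𝓓(Ω, ℂ)) (x : Euc n) :
    mulReal ha θ x = a x * θ x := rfl

lemma contDiff_remainderCoeff {ψ : Euc n → ℝ} (hψ : ContDiff ℝ ∞ ψ) (h : ℝ) :
    ContDiff ℝ ∞ fun x => -1 - gradSq ψ x - h * lap ψ x :=
  (contDiff_const.sub (contDiff_gradSq hψ)).sub (contDiff_const.mul (contDiff_lap hψ))

/-- The lower-order part `(P_ψ - (1 - h²Δ)) u` of the conjugated Laplacian. -/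
def remainder (Ω' : Opens (Euc n)) {ψ : Euc n → ℝ} (hψ : ContDiff ℝ ∞ ψ) (h : ℝ) (u : H1 Ω) :
    𝓓(Ω', ℂ) →ₗ[ℂ] ℂ :=
  pairL2 Ω' u.fn ∘ₗ mulReal (contDiff_remainderCoeff hψ h)
    - ∑ j, (2 * Complex.I) • (pairL2 Ω' ((h : ℂ) • u.D j) ∘ₗ mulReal (contDiff_pd hψ j))

lemma weak_deriv (u : H1 Ω) (j : Fin n) (θ : 𝓓(Ω, ℂ)) :
    ofL2 u.fn (testD j θ) = -ofL2 (u.D j) θ := by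
  have h1 : -(ofL2 u.fn (testD j θ)) = ofL2 (u.D j) θ := LinearMap.congr_fun (u.distD_eq j) θ
  rw [← h1, neg_neg]

/-- The derivatives are placed outermost so that they can be moved onto u in a pairing. Writing
2h∇ψ·∇θ in this form produces an extra 2hΔψ θ, which is why Δψ has the opposite sign in the
remainder; adding and subtracting θ isolates 1 - h²Δ. -/
lemma conjLap_eq {ψ : Euc n → ℝ} (hψ : ContDiff ℝ ∞ ψ) (h : ℝ) (θ : 𝓓(Ω, ℂ)) :
    conjLap hψ h θ = (∑ j, (h : ℂ) ^ 2 • testD j (testD j θ))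
      + (mulReal (contDiff_remainderCoeff hψ h) θ + θ)
      + ∑ j, (2 * Complex.I * h) • testD j (mulReal (contDiff_pd hψ j) θ) := by
  ext x
  have hθ := contDiff_test θ
  have e1 : ∀ j, testD j (testD j θ) x = -pd j (pd j θ) x := fun j => by
    have : (testD j θ : Euc n → ℂ) = fun y => (Complex.I)⁻¹ * pd j θ y := funext (testD_apply' j θ)
    rw [testD_apply', this, pd_const_mul (contDiff_pd hθ j), Complex.inv_I]
    linear_combination pd j (pd j θ) x * Complex.I_sq
  have e2 : ∀ j, testD j (mulReal (contDiff_pd hψ j) θ) x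
      = -Complex.I * (((pd j (pd j ψ) x : ℝ) : ℂ) * θ x + (pd j ψ x : ℝ) * pd j θ x) := fun j => by
    have : (mulReal (contDiff_pd hψ j) θ : Euc n → ℂ) = fun y => ((pd j ψ y : ℝ) : ℂ) * θ y := rfl
    rw [testD_apply', this, pd_mul (contDiff_ofReal (contDiff_pd hψ j)) hθ,
      pd_ofReal (contDiff_pd hψ j), Complex.inv_I]
  have e3 : ((∑ j, (h : ℂ) ^ 2 • testD j (testD j θ))
      + (mulReal (contDiff_remainderCoeff hψ h) θ + θ)
      + ∑ j, (2 * Complex.I * h) • testD j (mulReal (contDiff_pd hψ j) θ) : 𝓓(Ω, ℂ)) x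
      = (∑ j, (h : ℂ) ^ 2 * testD j (testD j θ) x)
      + (((-1 - gradSq ψ x - h * lap ψ x : ℝ) : ℂ) * θ x + θ x)
      + ∑ j, (2 * Complex.I * h) * testD j (mulReal (contDiff_pd hψ j) θ) x := by
    simp only [add_apply, sum_apply, smul_apply, smul_eq_mul, mulReal_apply]
  rw [e3, conjLap_apply]
  have s1 : ∑ j, (h : ℂ) ^ 2 * testD j (testD j θ) x = -(h : ℂ) ^ 2 * lap θ x := by
    simp only [e1, lap, Finset.mul_sum]
    exact Finset.sum_congr rfl fun j _ => by ring
  have s2 : ∑ j, (2 * Complex.I * h) * testD j (mulReal (contDiff_pd hψ j) θ) x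
      = 2 * h * ((lap ψ x : ℝ) : ℂ) * θ x + 2 * h * ∑ j, ((pd j ψ x : ℝ) : ℂ) * pd j θ x := by
    simp only [e2, lap, Finset.mul_sum, Finset.sum_mul, Complex.ofReal_sum,
      ← Finset.sum_add_distrib]
    refine Finset.sum_congr rfl fun j _ => ?_
    linear_combination (-2 * h * (((pd j (pd j ψ) x : ℝ) : ℂ) * θ x
      + (pd j ψ x : ℝ) * pd j θ x)) * Complex.I_sq
  rw [s1, s2]
  push_cast
  ring

/-- After integration by parts the remainder contains u and hD_ju but no derivative of θ. It is
therefore bounded in L² and makes sense on test functions of the larger set Ω', where u is in effect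
extended by zero. -/
lemma ofL2_conjLap {ψ : Euc n → ℝ} (hψ : ContDiff ℝ ∞ ψ) (h : ℝ)
    (hle : (Ω : Set (Euc n)) ⊆ Ω') (u : H1 Ω) (θ : 𝓓(Ω, ℂ)) :
    ofL2 u.fn (conjLap hψ h θ)
      = (ofL2 u.fn θ - ∑ j, (h : ℂ) * ofL2 ((h : ℂ) • u.D j) (testD j θ))
        + remainder Ω' hψ h u (extendTest hle θ) := by
  have e : remainder Ω' hψ h u (extendTest hle θ)
      = ofL2 u.fn (mulReal (contDiff_remainderCoeff hψ h) θ)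
        - ∑ j, (2 * Complex.I) * ofL2 ((h : ℂ) • u.D j) (mulReal (contDiff_pd hψ j) θ) := by
    rw [remainder, LinearMap.sub_apply, LinearMap.sum_apply]
    rfl
  rw [e, conjLap_eq hψ h θ, map_add, map_add, map_add, map_sum, map_sum]
  simp only [map_smul, weak_deriv, ofL2_smul, smul_eq_mul]
  have s1 : ∑ j, (h : ℂ) ^ 2 * -ofL2 (u.D j) (testD j θ)
      = -∑ j, (h : ℂ) * ((h : ℂ) * ofL2 (u.D j) (testD j θ)) := by
    rw [← Finset.sum_neg_distrib]
    exact Finset.sum_congr rfl fun j _ => by ring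
  have s2 : ∑ j, 2 * Complex.I * h * -ofL2 (u.D j) (mulReal (contDiff_pd hψ j) θ)
      = -∑ j, 2 * Complex.I * (h * ofL2 (u.D j) (mulReal (contDiff_pd hψ j) θ)) := by
    rw [← Finset.sum_neg_distrib]
    exact Finset.sum_congr rfl fun j _ => by ring
  rw [s1, s2]
  ring

lemma norm_remainder_le {ψ : Euc n → ℝ} (hψ : ContDiff ℝ ∞ ψ) {h b : ℝ}
    (hb1 : ∀ j x, |pd j ψ x| ≤ b) (hb2 : ∀ x, |-1 - gradSq ψ x - h * lap ψ x| ≤ b) (u : H1 Ω)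
    (θ : 𝓓(Ω', ℂ)) :
    ‖remainder Ω' hψ h u θ‖ ≤ (2 * n + 1) * b * u.sclNorm h * l2 volume θ := by
  have hb0 : 0 ≤ b := (abs_nonneg _).trans (hb2 0)
  have hpair : ∀ (g : Lp ℂ 2 (vol Ω)) {a : Euc n → ℝ} (ha : ContDiff ℝ ∞ a),
      ‖g‖ ≤ u.sclNorm h → (∀ x, |a x| ≤ b) →
      ‖pairL2 Ω' g (mulReal ha θ)‖ ≤ b * u.sclNorm h * l2 volume θ := by
    intro g a ha hg hab
    have h1 : l2 (vol Ω) (mulReal ha θ) ≤ b * l2 volume θ :=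
      (memLp_bounded_mul ha.continuous hab (test_memLp (vol Ω) θ)).2.trans
        (mul_le_mul_of_nonneg_left (l2_vol_le θ) hb0)
    calc _ ≤ ‖g‖ * l2 (vol Ω) (mulReal ha θ) := norm_pairL2_le _ _
      _ ≤ u.sclNorm h * (b * l2 volume θ) :=
        mul_le_mul hg h1 (l2_nonneg _ _) (u.sclNorm_nonneg h)
      _ = _ := by ring
  have e : remainder Ω' hψ h u θ = pairL2 Ω' u.fn (mulReal (contDiff_remainderCoeff hψ h) θ)
        - ∑ j, (2 * Complex.I) * pairL2 Ω' ((h : ℂ) • u.D j) (mulReal (contDiff_pd hψ j) θ) := by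
    rw [remainder, LinearMap.sub_apply, LinearMap.sum_apply]
    rfl
  rw [e]
  have h1 := hpair u.fn (contDiff_remainderCoeff hψ h) (u.norm_fn_le h) hb2
  have h2 : ‖∑ j, (2 * Complex.I) * pairL2 Ω' ((h : ℂ) • u.D j) (mulReal (contDiff_pd hψ j) θ)‖
      ≤ n * (2 * (b * u.sclNorm h * l2 volume θ)) := by
    have hj : ∀ j, ‖(2 * Complex.I) * pairL2 Ω' ((h : ℂ) • u.D j) (mulReal (contDiff_pd hψ j) θ)‖
        ≤ 2 * (b * u.sclNorm h * l2 volume θ) := fun j => by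
      rw [norm_mul, norm_mul, Complex.norm_I, mul_one, Complex.norm_ofNat]
      exact mul_le_mul_of_nonneg_left
        (hpair _ (contDiff_pd hψ j) (u.norm_D_le h j) (hb1 j)) zero_le_two
    refine (norm_sum_le _ _).trans ((Finset.sum_le_sum fun j _ => hj j).trans_eq ?_)
    simp
  calc _ ≤ _ := norm_sub_le _ _
    _ ≤ b * u.sclNorm h * l2 volume θ + n * (2 * (b * u.sclNorm h * l2 volume θ)) :=
      add_le_add h1 h2
    _ = _ := by ring

/-- Solvability of the conjugated Laplace equation in `H¹(Ω)`, with a gain `√ε` from the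
convexification of the weight. -/
theorem exists_conjLap_solution {f ν χ : Euc n → ℝ} (hf : ContDiff ℝ ∞ f) (hν : ContDiff ℝ ∞ ν)
    (hχ : ContDiff ℝ ∞ χ) (hfc : HasCompactSupport f) (hχc : HasCompactSupport χ)
    (hχs : tsupport χ ⊆ Ω') (hχ1 : ∀ x, |χ x| ≤ 1) (hχΩ : ∀ x ∈ Ω, χ x = 1)
    (hle : (Ω : Set (Euc n)) ⊆ Ω') (hΩc : IsCompact (closure (Ω' : Set (Euc n))))
    {c : ℝ} (hc : 0 < c) (hG : ∀ x ∈ closure (Ω' : Set (Euc n)), c ≤ gradSq f x)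
    (hid : ∀ x ∈ closure (Ω' : Set (Euc n)), LCWIdentity f ν x) :
    ∃ C : ℝ, 0 < C ∧ ∃ ε₀ : ℝ, 0 < ε₀ ∧ ∀ ε : ℝ, 0 < ε → ε ≤ ε₀ → ∃ h₀ : ℝ, 0 < h₀ ∧
      h₀ ≤ 1 ∧ h₀ ≤ ε ∧ ∀ h : ℝ, 0 < h → h ≤ h₀ → ∀ K : ℝ, 0 ≤ K → ∀ v : Functional Ω,
        (∀ θ, ‖v θ‖ ≤ K * (testH1 θ).sclNorm h) →
        ∃ u : H1 Ω, u.sclNorm h ≤ C * (Real.sqrt ε / h) * K ∧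
          ∀ θ, ofL2 u.fn (conjLap (contDiff_convexify hf (h / ε)) h θ) = v θ := by
  obtain ⟨C₀, hC₀, ε₀, hε₀, HC⟩ := carleman_estimate_real hf hν hΩc hc hG hid
  obtain ⟨b, hb1, hb⟩ := exists_uniform_coefficient_bound hf hfc hχ hχc
  set s := Real.sqrt C₀ with hs
  have hs0 : 0 < s := Real.sqrt_pos.2 hC₀
  have hb0 : 0 < b := by linarith
  refine ⟨1 + ((2 * n + 1) * b * s * (1 + n * (n + 1) * b) + n * ((2 * n + 1) * b)), by positivity,
    min ε₀ 1, by positivity, fun ε hε hεε => ?_⟩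
  have hε1 : ε ≤ 1 := hεε.trans (min_le_right _ _)
  obtain ⟨h₀, hh₀, H⟩ := HC ε hε (hεε.trans (min_le_left _ _))
  refine ⟨min h₀ ε, by positivity, (min_le_right _ _).trans hε1, min_le_right _ _,
    fun h hh hhh K hK v hv => ?_⟩
  have hhε : h ≤ ε := hhh.trans (min_le_right _ _)
  have hh1 : h ≤ 1 := hhε.trans hε1
  have hκ0 : 0 ≤ h / ε := by positivity
  have hκ1 : h / ε ≤ 1 := (div_le_one hε).2 hhε
  obtain ⟨b1, b2, b3, b4⟩ := hb (h / ε) h hκ0 hκ1 hh.le hh1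
  set hψ := contDiff_convexify hf (h / ε) with hψdef
  set r := Real.sqrt ε / h with hr
  -- From h ≤ ε ≤ 1 follows h² ≤ ε. So r ≥ 1, and the contributions without a factor r, such as the
  -- norm of u₀, fit under the same bound.
  have hr1 : 1 ≤ r := by
    rw [hr, one_le_div hh]
    refine hhε.trans (Real.le_sqrt_of_sq_le ?_)
    nlinarith
  have hr0 : 0 < r := by linarith
  have est : ∀ θ : 𝓓(Ω', ℂ), l2 volume θ ≤ (s * r) * l2 volume (conjLap hψ h θ) := fun θ => by
    have h1 := carleman_estimate_complex hψ
      (fun u hu huc hus => H h hh (hhh.trans (min_le_left _ _)) u hu huc hus) θ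
    have hsq : (s * r) ^ 2 = C₀ * (ε / h ^ 2) := by
      rw [mul_pow, hs, hr, Real.sq_sqrt hC₀.le, div_pow, Real.sq_sqrt hε.le]
    have hh2 : 0 < h ^ 2 := by positivity
    have h2 : l2 volume θ ^ 2 ≤ C₀ * (ε / h ^ 2) * l2 volume (conjLap hψ h θ) ^ 2 := by
      calc l2 volume θ ^ 2 = ε / h ^ 2 * (h ^ 2 / ε * l2 volume θ ^ 2) := by field_simp
        _ ≤ ε / h ^ 2 * (C₀ * l2 volume (conjLap hψ h θ) ^ 2) :=
          mul_le_mul_of_nonneg_left h1 (by positivity)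
        _ = _ := by ring
    rw [← hsq, ← mul_pow] at h2
    have := l2_nonneg volume (conjLap hψ h θ)
    exact (pow_le_pow_iff_left₀ (l2_nonneg _ _) (by positivity) two_ne_zero).1 h2
  obtain ⟨u₀, hu₀, hu₀v⟩ := exists_H1_riesz hh hK v hv
  set F := (2 * n + 1) * b * K with hF
  have hF0 : 0 ≤ F := by positivity
  obtain ⟨w, hw1, hw2, hw⟩ := exists_H1_solution hψ hχ hχc hχs hχ1 hχΩ hle hh hF0
    (by positivity : 0 ≤ s * r) b3 b4 est (remainder Ω' hψ h u₀) fun θ => by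
      refine (norm_remainder_le hψ b1 b2 u₀ θ).trans ?_
      have := l2_nonneg volume θ
      rw [hF]
      gcongr
  -- The function u₀ solves the equation up to the remainder, and w solves the equation whose
  -- right-hand side is that remainder.
  have hW : u₀.toAmbient h - w.toAmbient h ∈ sobGraph Ω h :=
    sub_mem (u₀.toAmbient_mem h) (w.toAmbient_mem h)
  refine ⟨H1.ofGraph hh.ne' hW, ?_, fun θ => ?_⟩
  · rw [← H1.norm_toAmbient, H1.toAmbient_ofGraph]
    refine (norm_sub_le _ _).trans ?_
    rw [H1.norm_toAmbient, H1.norm_toAmbient]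
    have h1 := H1.sclNorm_le hw1 hw2
    have h2 : K ≤ r * K := le_mul_of_one_le_left hK hr1
    have h3 : n * F ≤ n * F * r := le_mul_of_one_le_right (by positivity) hr1
    calc _ ≤ K + (F * (s * r) + n * (F + (n + 1) * b * (F * (s * r)))) := add_le_add hu₀ h1
      _ = K + F * (s * r) * (1 + n * (n + 1) * b) + n * F := by ring
      _ ≤ r * K + F * (s * r) * (1 + n * (n + 1) * b) + n * F * r := by linarith
      _ = _ := by rw [hF]; ring
  · have e : (H1.ofGraph hh.ne' hW).fn = u₀.fn - w.fn := rfl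
    rw [e, ofL2_sub, hw, ofL2_conjLap hψ h hle, hu₀v]
    ring

end Solvability

/-! ### Multiplication in `H¹(Ω)` -/

section Multiplication

variable {n : ℕ} {Ω : Opens (Euc n)}

lemma mulH1_fn_ae (hΩ : Bornology.IsBounded (Ω : Set (Euc n))) {a : Euc n → ℂ}
    (ha : SmoothNear Ω a) (u : H1 Ω) :
    (mulH1 hΩ a ha u).fn =ᵐ[vol Ω] fun x => a x * u.fn x := by
  filter_upwards [Lp.coeFn_lpSMul (r := 2) ((ha.memLp_top hΩ).toLp a) u.fn,
    (ha.memLp_top hΩ).coeFn_toLp] with x h1 h2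
  refine h1.trans ?_
  rw [Pi.smul_apply', h2, smul_eq_mul]

lemma mulH1_D_ae (hΩ : Bornology.IsBounded (Ω : Set (Euc n))) {a : Euc n → ℂ}
    (ha : SmoothNear Ω a) (u : H1 Ω) (j : Fin n) :
    (mulH1 hΩ a ha u).D j =ᵐ[vol Ω] fun x =>
      a x * u.D j x + (Complex.I)⁻¹ * fderiv ℝ a x (stdVec j) * u.fn x := by
  filter_upwards [Lp.coeFn_lpSMul (r := 2) ((ha.memLp_top hΩ).toLp a) (u.D j),
    (ha.memLp_top hΩ).coeFn_toLp,
    Lp.coeFn_lpSMul (r := 2) ((ha.memLp_top_deriv hΩ j).toLp _) u.fn,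
    (ha.memLp_top_deriv hΩ j).coeFn_toLp,
    Lp.coeFn_add ((ha.memLp_top hΩ).toLp a • u.D j : Lp ℂ 2 (vol Ω))
      ((ha.memLp_top_deriv hΩ j).toLp _ • u.fn : Lp ℂ 2 (vol Ω))] with x h1 h2 h3 h4 h5
  refine h5.trans ?_
  rw [Pi.add_apply, h1, h3, Pi.smul_apply', Pi.smul_apply', h2, h4, smul_eq_mul, smul_eq_mul]

lemma H1.ext_ae {u w : H1 Ω} (h0 : u.fn =ᵐ[vol Ω] w.fn) (h1 : ∀ j, u.D j =ᵐ[vol Ω] w.D j) :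
    u = w := by
  obtain ⟨f, D, hD⟩ := u
  obtain ⟨f', D', hD'⟩ := w
  obtain rfl : f = f' := Lp.ext h0
  obtain rfl : D = D' := funext fun j => Lp.ext (h1 j)
  rfl

/-- Multiplication by a fixed smooth function is bounded on `H¹_scl`, uniformly in `h ≤ 1`. -/
lemma exists_mulH1_bound (hΩ : Bornology.IsBounded (Ω : Set (Euc n))) {a : Euc n → ℂ}
    (ha : SmoothNear Ω a) : ∃ M : ℝ, 0 < M ∧ ∀ h : ℝ, 0 < h → h ≤ 1 → ∀ u : H1 Ω,
      (mulH1 hΩ a ha u).sclNorm h ≤ M * u.sclNorm h := by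
  set a₀ := (ha.memLp_top hΩ).toLp a
  set a₁ := fun j => (ha.memLp_top_deriv hΩ j).toLp _
  set S := ∑ j, ‖a₁ j‖
  have hS0 : 0 ≤ S := Finset.sum_nonneg fun _ _ => norm_nonneg _
  refine ⟨1 + (‖a₀‖ + n * (‖a₀‖ + S)), by positivity, fun h hh hh1 u => ?_⟩
  set N := u.sclNorm h
  have hN0 : 0 ≤ N := u.sclNorm_nonneg h
  have hfn : ‖(mulH1 hΩ a ha u).fn‖ ≤ ‖a₀‖ * N := (Lp.norm_smul_le a₀ u.fn).trans
    (mul_le_mul_of_nonneg_left (u.norm_fn_le h) (norm_nonneg _))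
  have hD : ∀ j, ‖(h : ℂ) • (mulH1 hΩ a ha u).D j‖ ≤ (‖a₀‖ + S) * N := fun j => by
    have e : (mulH1 hΩ a ha u).D j
      = (a₀ • u.D j : Lp ℂ 2 (vol Ω)) + (a₁ j • u.fn : Lp ℂ 2 (vol Ω)) := rfl
    have h1 : ‖(h : ℂ) • (a₀ • u.D j : Lp ℂ 2 (vol Ω))‖ ≤ ‖a₀‖ * N := by
      have hD := u.norm_D_le h j
      rw [norm_smul] at hD ⊢
      calc _ ≤ ‖(h : ℂ)‖ * (‖a₀‖ * ‖u.D j‖) :=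
            mul_le_mul_of_nonneg_left (Lp.norm_smul_le a₀ (u.D j)) (norm_nonneg _)
        _ = ‖a₀‖ * (‖(h : ℂ)‖ * ‖u.D j‖) := by ring
        _ ≤ _ := mul_le_mul_of_nonneg_left hD (norm_nonneg _)
    have h2 : ‖(h : ℂ) • (a₁ j • u.fn : Lp ℂ 2 (vol Ω))‖ ≤ S * N := by
      rw [norm_smul, Complex.norm_real, Real.norm_of_nonneg hh.le]
      have h3 : ‖a₁ j‖ ≤ S := Finset.single_le_sum (f := fun j => ‖a₁ j‖)
        (fun _ _ => norm_nonneg _) (Finset.mem_univ j)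
      calc _ ≤ 1 * ‖(a₁ j • u.fn : Lp ℂ 2 (vol Ω))‖ :=
            mul_le_mul_of_nonneg_right hh1 (norm_nonneg _)
        _ ≤ ‖a₁ j‖ * ‖u.fn‖ := by rw [one_mul]; exact Lp.norm_smul_le (a₁ j) u.fn
        _ ≤ S * N := mul_le_mul h3 (u.norm_fn_le h) (norm_nonneg _) hS0
    rw [e, smul_add]
    calc _ ≤ _ := norm_add_le _ _
      _ ≤ ‖a₀‖ * N + S * N := add_le_add h1 h2
      _ = _ := by ring
  calc _ ≤ ‖a₀‖ * N + n * ((‖a₀‖ + S) * N) := H1.sclNorm_le hfn hD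
    _ = (‖a₀‖ + n * (‖a₀‖ + S)) * N := by ring
    _ ≤ _ := mul_le_mul_of_nonneg_right (by linarith) hN0

lemma testH1_mulTest (hΩ : Bornology.IsBounded (Ω : Set (Euc n))) {a : Euc n → ℂ}
    (ha : SmoothNear Ω a) (θ : 𝓓(Ω, ℂ)) :
    testH1 (mulTest a ha θ) = mulH1 hΩ a ha (testH1 θ) := by
  have hc : ∀ η : 𝓓(Ω, ℂ), ((testFunction_memLp η).toLp η : Lp ℂ 2 (vol Ω)) =ᵐ[vol Ω] η := fun η =>
    (testFunction_memLp η).coeFn_toLp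
  refine H1.ext_ae ?_ fun j => ?_
  · filter_upwards [hc θ, hc (mulTest a ha θ), mulH1_fn_ae hΩ ha (testH1 θ)] with x h1 h2 h3
    refine h2.trans (Eq.trans ?_ h3.symm)
    rw [mulTest_apply]
    exact congrArg _ h1.symm
  · filter_upwards [hc θ, hc (testD j θ), hc (testD j (mulTest a ha θ)),
      mulH1_D_ae hΩ ha (testH1 θ) j, ae_restrict_mem Ω.isOpen.measurableSet] with x h1 h2 h3 h4 hx
    refine h3.trans (Eq.trans ?_ h4.symm)
    have h1' : (testH1 θ).fn x = θ x := h1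
    have h2' : (testH1 θ).D j x = testD j θ x := h2
    have hfd : fderiv ℝ (mulTest a ha θ) x = a x • fderiv ℝ θ x + θ x • fderiv ℝ a x :=
      fderiv_mul ((ha.contDiffAt (subset_closure hx)).differentiableAt (by simp))
        (testFunction_differentiableAt θ x)
    rw [h1', h2', testD_apply, testD_apply, hfd]
    simp only [add_apply, smul_apply, smul_eq_mul]
    ring

end Multiplication

/-! ### The bilinear pairing on `L²` -/

section Pairing

variable {n : ℕ} {μ : Measure (Euc n)}

/-- The bilinear pairing `∫ f g`. -/
def lpPair (f g : Lp ℂ 2 μ) : ℂ := inner ℂ (star g) f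

lemma lpPair_apply (f g : Lp ℂ 2 μ) : lpPair f g = ∫ x, f x * g x ∂μ := by
  rw [lpPair, L2.inner_def]
  refine integral_congr_ae ?_
  filter_upwards [Lp.coeFn_star g] with x hx
  rw [hx, RCLike.inner_apply]
  simp

lemma norm_lpPair_le (f g : Lp ℂ 2 μ) : ‖lpPair f g‖ ≤ ‖f‖ * ‖g‖ := by
  have : ‖(star g : Lp ℂ 2 μ)‖ = ‖g‖ := by
    rw [Lp.norm_def, Lp.norm_def]
    congr 1
    refine eLpNorm_congr_norm_ae ?_
    filter_upwards [Lp.coeFn_star g] with x hx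
    rw [hx, Pi.star_apply, norm_star]
  rw [lpPair, mul_comm, ← this]
  exact norm_inner_le_norm _ _

end Pairing

/-! ### Solving by successive approximation -/

/-- Each application solves up to a residual of half the size, so the corrections are dominated by a
geometric series of sum 2RK. The equation consists of inner products with fixed vectors and passes
to the limit. The approximate solutions are merely known to exist and need not depend linearly on
the data, so residuals are iterated in place of a Neumann series of operators. -/
lemma exists_solution_of_approximate {V E : Type*} [AddCommGroup V] [Module ℂ V]
    [NormedAddCommGroup E] [InnerProductSpace ℂ E] [CompleteSpace E] {S : Submodule ℂ E}
    (hS : IsClosed (S : Set E)) {N : V → ℝ} {G : V → E} {R : ℝ}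
    (H : ∀ K : ℝ, 0 ≤ K → ∀ v : V →ₗ[ℂ] ℂ, (∀ θ, ‖v θ‖ ≤ K * N θ) →
      ∃ W ∈ S, ‖W‖ ≤ R * K ∧ ∃ v' : V →ₗ[ℂ] ℂ, (∀ θ, ‖v' θ‖ ≤ K / 2 * N θ) ∧
        ∀ θ, inner ℂ (G θ) W = v θ - v' θ)
    {K : ℝ} (hK : 0 ≤ K) (v : V →ₗ[ℂ] ℂ) (hv : ∀ θ, ‖v θ‖ ≤ K * N θ) :
    ∃ W ∈ S, ‖W‖ ≤ 2 * R * K ∧ ∀ θ, inner ℂ (G θ) W = v θ := by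
  have H' : ∀ k : ℕ, ∀ w : {w : V →ₗ[ℂ] ℂ // ∀ θ, ‖w θ‖ ≤ K / 2 ^ k * N θ},
      ∃ W ∈ S, ‖W‖ ≤ R * (K / 2 ^ k) ∧ ∃ w' : {w : V →ₗ[ℂ] ℂ // ∀ θ, ‖w θ‖ ≤ K / 2 ^ (k + 1) * N θ},
        ∀ θ, inner ℂ (G θ) W = w.1 θ - w'.1 θ := by
    rintro k ⟨w, hw⟩
    obtain ⟨W, hWS, hW, w', hw', hWw⟩ := H (K / 2 ^ k) (by positivity) w hw
    refine ⟨W, hWS, hW, ⟨w', fun θ => ?_⟩, hWw⟩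
    rw [pow_succ, ← div_div]
    exact hw' θ
  choose X hXS hXn Y hY using H'
  -- The successive residuals, each carrying the bound that permits the next step.
  let vs : (k : ℕ) → {w : V →ₗ[ℂ] ℂ // ∀ θ, ‖w θ‖ ≤ K / 2 ^ k * N θ} := fun k =>
    Nat.rec ⟨v, fun θ => by simpa using hv θ⟩ (fun k w => Y k w) k
  set W : ℕ → E := fun k => X k (vs k) with hW
  have hsum : HasSum (fun k : ℕ => R * (K / 2 ^ k)) (2 * R * K) := by
    refine (hasSum_geometric_two' (2 * R * K)).congr_fun fun k => ?_
    ring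
  have hWn : ∀ k, ‖W k‖ ≤ R * (K / 2 ^ k) := fun k => hXn k (vs k)
  have hWs : Summable W := Summable.of_norm_bounded hsum.summable hWn
  refine ⟨∑' k, W k, ?_, tsum_of_norm_bounded hsum hWn, fun θ => ?_⟩
  · exact hS.mem_of_tendsto hWs.hasSum.tendsto_sum_nat
      (.of_forall fun m => sum_mem fun k _ => hXS k (vs k))
  -- The partial sums telescope to v minus the current residual.
  have h1 : ∀ m, inner ℂ (G θ) (∑ k ∈ Finset.range m, W k) = v θ - (vs m).1 θ := fun m => by
    induction m with
    | zero => simp [vs]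
    | succ m ih =>
      rw [Finset.sum_range_succ, inner_add_right, ih]
      have := hY m (vs m) θ
      rw [hW, this]
      change _ = v θ - (Y m (vs m)).1 θ
      ring
  have h2 : Filter.Tendsto (fun m => (vs m).1 θ) Filter.atTop (nhds 0) := by
    have h3 : Filter.Tendsto (fun m : ℕ => K / 2 ^ m * N θ) Filter.atTop (nhds 0) := by
      have := (tendsto_pow_atTop_nhds_zero_of_lt_one (r := (1 / 2 : ℝ)) (by norm_num)
        (by norm_num)).const_mul (K * N θ)
      rw [mul_zero] at this
      refine this.congr fun m => ?_
      rw [div_pow, one_pow]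
      ring
    exact squeeze_zero_norm (fun m => (vs m).2 θ) h3
  have h4 : Filter.Tendsto (fun m => inner ℂ (G θ) (∑ k ∈ Finset.range m, W k)) Filter.atTop
      (nhds (inner ℂ (G θ) (∑' k, W k))) :=
    tendsto_const_nhds.inner hWs.hasSum.tendsto_sum_nat
  refine tendsto_nhds_unique h4 ?_
  simp only [h1]
  simpa using h2.const_sub (v θ)

/-! ### The conjugated magnetic operator -/

section MagneticForm

variable {n : ℕ} {Ω : Opens (Euc n)}

lemma contDiff_expReal {ψ : Euc n → ℝ} (hψ : ContDiff ℝ ∞ ψ) (t : ℝ) :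
    ContDiff ℝ ∞ fun x => Real.exp (t * ψ x) :=
  Real.contDiff_exp.comp (contDiff_const.mul hψ)

lemma contDiff_expWeight {ψ : Euc n → ℝ} (hψ : ContDiff ℝ ∞ ψ) (t : ℝ) :
    ContDiff ℝ ∞ (expWeight ψ t) :=
  contDiff_ofReal (contDiff_expReal hψ t)

lemma pd_expWeight {ψ : Euc n → ℝ} (hψ : ContDiff ℝ ∞ ψ) (t : ℝ) (j : Fin n) (x : Euc n) :
    pd j (expWeight ψ t) x = t * ((pd j ψ x : ℝ) : ℂ) * expWeight ψ t x := by
  have h1 : pd j (expWeight ψ t) x = ((pd j (fun y => Real.exp (t * ψ y)) x : ℝ) : ℂ) :=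
    pd_ofReal (contDiff_expReal hψ t) j x
  have h2 : pd j (fun y => Real.exp (t * ψ y)) x = Real.exp (t * ψ x) * (t * pd j ψ x) := by
    have hd := ((differentiableAt_of_contDiff hψ x).hasFDerivAt.const_mul t).exp
    change fderiv ℝ (fun y => Real.exp (t * ψ y)) x _ = _
    rw [hd.fderiv]
    rfl
  rw [h1, h2, expWeight]
  push_cast
  ring

/-- The operator `e^{-ψ/h} (h² L_{A,q}) e^{ψ/h}` on `H¹(Ω)`. -/
def conjMagneticOp (hΩ : Bornology.IsBounded (Ω : Set (Euc n))) {ψ : Euc n → ℝ}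
    (hψ : ContDiff ℝ ∞ ψ) (A : Fin n → Lp ℂ ∞ (vol Ω)) (q : Lp ℂ ∞ (vol Ω)) (h : ℝ) (u : H1 Ω) :
    Functional Ω :=
  mulDist (expWeight ψ (-1 / h)) (smoothNear_of_contDiff (contDiff_expWeight hψ _))
    ((h ^ 2 : ℂ) • magneticOp A q
      (mulH1 hΩ (expWeight ψ (1 / h)) (smoothNear_of_contDiff (contDiff_expWeight hψ _)) u))

/-- A test function as an element of `L²(Ω)`. -/
def testL2 : 𝓓(Ω, ℂ) →ₗ[ℂ] Lp ℂ 2 (vol Ω) where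
  toFun θ := (testFunction_memLp θ).toLp
  map_add' θ η := MemLp.toLp_add (testFunction_memLp θ) (testFunction_memLp η)
  map_smul' c θ := MemLp.toLp_const_smul c (testFunction_memLp θ)

lemma coeFn_testL2 (θ : 𝓓(Ω, ℂ)) : testL2 θ =ᵐ[vol Ω] θ := (testFunction_memLp θ).coeFn_toLp

/-- The pairing of `h A_j θ` with `h D_j u` in the weak form of the conjugated operator. -/
def pertD (A : Fin n → Lp ℂ ∞ (vol Ω)) (h : ℝ) (j : Fin n) (θ : 𝓓(Ω, ℂ)) : Lp ℂ 2 (vol Ω) :=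
  (h : ℂ) • (A j • testL2 θ : Lp ℂ 2 (vol Ω))

/-- The first-order test function `-h D_j θ - 2i ∂_jψ θ`. -/
def pertTest {ψ : Euc n → ℝ} (hψ : ContDiff ℝ ∞ ψ) (h : ℝ) (j : Fin n) (θ : 𝓓(Ω, ℂ)) : 𝓓(Ω, ℂ) :=
  -((h : ℂ) • testD j θ) - (2 * Complex.I) • mulReal (contDiff_pd hψ j) θ

/-- The factor pairing with `u` in the `j`-th magnetic term of the weak form. -/
def pertFn {ψ : Euc n → ℝ} (hψ : ContDiff ℝ ∞ ψ) (A : Fin n → Lp ℂ ∞ (vol Ω)) (h : ℝ) (j : Fin n)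
    (θ : 𝓓(Ω, ℂ)) : Lp ℂ 2 (vol Ω) :=
  (h : ℂ) • (A j • (testL2 (pertTest hψ h j θ) + pertD A h j θ : Lp ℂ 2 (vol Ω)) : Lp ℂ 2 (vol Ω))

/-- The lower-order terms of the weak form of the conjugated magnetic operator. -/
def pertForm {ψ : Euc n → ℝ} (hψ : ContDiff ℝ ∞ ψ) (A : Fin n → Lp ℂ ∞ (vol Ω))
    (q : Lp ℂ ∞ (vol Ω)) (h : ℝ) (θ : 𝓓(Ω, ℂ)) (W : SobAmbient Ω) : ℂ :=
  (∑ j, (lpPair (W (some j)) (pertD A h j θ) + lpPair (W none) (pertFn hψ A h j θ)))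
    + lpPair (W none) ((h ^ 2 : ℂ) • (q • testL2 θ : Lp ℂ 2 (vol Ω)))

lemma integrable_lpPair {μ : Measure (Euc n)} (f g : Lp ℂ 2 μ) :
    Integrable (fun x => f x * g x) μ := integrable_lp_mul f (Lp.memLp g)

/-- The minus sign in `conjD` cancels that of the integration by parts: the transpose is hD_j -
i∂_jψ, which is `e^{-ψ/h} hD_j e^{ψ/h}`. -/
lemma ofL2_conjD {ψ : Euc n → ℝ} (hψ : ContDiff ℝ ∞ ψ) (h : ℝ) (j : Fin n) (u : H1 Ω)
    (χ : 𝓓(Ω, ℂ)) : ofL2 u.fn (conjD hψ h j χ)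
      = ∫ x, (h * u.D j x - Complex.I * ((pd j ψ x : ℝ) : ℂ) * u.fn x) * χ x ∂(vol Ω) := by
  have e : conjD hψ h j χ = -((h : ℂ) • testD j χ + Complex.I • mulReal (contDiff_pd hψ j) χ) := by
    ext x
    change -((h : ℂ) * testD j χ x + Complex.I * ((pd j ψ x : ℝ) : ℂ) * χ x)
      = -((h : ℂ) * testD j χ x + Complex.I * (((pd j ψ x : ℝ) : ℂ) * χ x))
    ring
  rw [e, map_neg, map_add, map_smul, map_smul, weak_deriv, smul_eq_mul, smul_eq_mul]
  have e2 : -((h : ℂ) * -ofL2 (u.D j) χ + Complex.I * ofL2 u.fn (mulReal (contDiff_pd hψ j) χ))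
      = (h : ℂ) * ofL2 (u.D j) χ - Complex.I * ofL2 u.fn (mulReal (contDiff_pd hψ j) χ) := by ring
  rw [e2, ofL2_apply, ofL2_apply, ← integral_const_mul, ← integral_const_mul,
    ← integral_sub ((integrable_mul_test _ _).const_mul _) ((integrable_mul_test _ _).const_mul _)]
  refine integral_congr_ae (.of_forall fun x => ?_)
  simp only [mulReal_apply]
  ring

lemma coeFn_topSMul (a : Lp ℂ ∞ (vol Ω)) (f : Lp ℂ 2 (vol Ω)) :
    (a • f : Lp ℂ 2 (vol Ω)) =ᵐ[vol Ω] fun x => a x * f x :=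
  Lp.coeFn_lpSMul (r := 2) a f

/-- Conjugation turns h(D_j + A_j) into hD_j - i∂_jψ + hA_j. As A_j is only bounded, the outer
derivative is never applied to A_j u but is moved onto the test function; what remains is a
pointwise identity of integrands, in which the exponentials cancel. -/
lemma conjMagneticOp_term (hΩ : Bornology.IsBounded (Ω : Set (Euc n))) {ψ : Euc n → ℝ}
    (hψ : ContDiff ℝ ∞ ψ) (A : Fin n → Lp ℂ ∞ (vol Ω)) {h : ℝ} (hh : h ≠ 0) (u w : H1 Ω)
    (hw : w = mulH1 hΩ (expWeight ψ (1 / h))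
      (smoothNear_of_contDiff (contDiff_expWeight hψ _)) u) (θ η : 𝓓(Ω, ℂ))
    (hη : ∀ x, η x = expWeight ψ (-1 / h) x * θ x) (j : Fin n) (g : Lp ℂ 2 (vol Ω))
    (hg : g = w.D j + (A j • w.fn : Lp ℂ 2 (vol Ω))) :
    (h ^ 2 : ℂ) * (distD j (ofL2 g) η + ofL2 (A j • g : Lp ℂ 2 (vol Ω)) η)
      = ofL2 u.fn (conjD hψ h j (conjD hψ h j θ))
        + (lpPair ((h : ℂ) • u.D j) (pertD A h j θ) + lpPair u.fn (pertFn hψ A h j θ)) := by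
  have hc : (h : ℂ) ≠ 0 := by exact_mod_cast hh
  have e1 : distD j (ofL2 g) η = -ofL2 g (testD j η) := rfl
  have i2 : Integrable (fun x => (h * u.D j x - Complex.I * ((pd j ψ x : ℝ) : ℂ) * u.fn x)
      * conjD hψ h j θ x) (vol Ω) := by
    refine (((integrable_mul_test (u.D j) (conjD hψ h j θ)).const_mul (h : ℂ)).sub
      ((integrable_mul_test u.fn (mulReal (contDiff_pd hψ j) (conjD hψ h j θ))).const_mul
        Complex.I)).congr (.of_forall fun x => ?_)
    simp only [Pi.sub_apply, mulReal_apply]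
    ring
  have i3 := integrable_lpPair ((h : ℂ) • u.D j) (pertD A h j θ)
  have i4 := integrable_lpPair u.fn (pertFn hψ A h j θ)
  have l : (h ^ 2 : ℂ) * (distD j (ofL2 g) η + ofL2 (A j • g : Lp ℂ 2 (vol Ω)) η)
      = ∫ x, (h ^ 2 : ℂ) * ((A j • g : Lp ℂ 2 (vol Ω)) x * η x - g x * testD j η x) ∂(vol Ω) := by
    rw [e1, neg_add_eq_sub, ofL2_apply, ofL2_apply, ← integral_sub
      (integrable_mul_test (A j • g : Lp ℂ 2 (vol Ω)) η) (integrable_mul_test g (testD j η)),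
      ← integral_const_mul]
  have r : ofL2 u.fn (conjD hψ h j (conjD hψ h j θ))
        + (lpPair ((h : ℂ) • u.D j) (pertD A h j θ) + lpPair u.fn (pertFn hψ A h j θ))
      = ∫ x, ((h * u.D j x - Complex.I * ((pd j ψ x : ℝ) : ℂ) * u.fn x) * conjD hψ h j θ x
        + (((h : ℂ) • u.D j) x * pertD A h j θ x + u.fn x * pertFn hψ A h j θ x)) ∂(vol Ω) := by
    rw [ofL2_conjD, lpPair_apply, lpPair_apply, ← integral_add i3 i4]
    exact (integral_add i2 (i3.add i4)).symm
  rw [l, r]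
  refine integral_congr_ae ?_
  have a1 := coeFn_topSMul (A j) g
  have a2 : g =ᵐ[vol Ω] fun x => w.D j x + A j x * w.fn x := by
    filter_upwards [Lp.coeFn_add (w.D j) (A j • w.fn : Lp ℂ 2 (vol Ω)), coeFn_topSMul (A j) w.fn]
      with x h1 h2
    rw [hg, h1, Pi.add_apply, h2]
  have a3 : w.fn =ᵐ[vol Ω] fun x => expWeight ψ (1 / h) x * u.fn x := hw ▸ mulH1_fn_ae hΩ _ u
  have a4 : w.D j =ᵐ[vol Ω] fun x => expWeight ψ (1 / h) x * u.D j x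
      + (Complex.I)⁻¹ * pd j (expWeight ψ (1 / h)) x * u.fn x := hw ▸ mulH1_D_ae hΩ _ u j
  have a5 : pertD A h j θ =ᵐ[vol Ω] fun x => h * (A j x * θ x) := by
    filter_upwards [Lp.coeFn_smul (h : ℂ) (A j • testL2 θ : Lp ℂ 2 (vol Ω)),
      coeFn_topSMul (A j) (testL2 θ), coeFn_testL2 θ] with x h1 h2 h3
    rw [pertD, h1, Pi.smul_apply, h2, h3, smul_eq_mul]
  have a6 : pertFn hψ A h j θ =ᵐ[vol Ω] fun x =>
      h * (A j x * (pertTest hψ h j θ x + h * (A j x * θ x))) := by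
    filter_upwards [Lp.coeFn_smul (h : ℂ)
      (A j • (testL2 (pertTest hψ h j θ) + pertD A h j θ : Lp ℂ 2 (vol Ω)) : Lp ℂ 2 (vol Ω)),
      coeFn_topSMul (A j) (testL2 (pertTest hψ h j θ) + pertD A h j θ : Lp ℂ 2 (vol Ω)),
      Lp.coeFn_add (testL2 (pertTest hψ h j θ)) (pertD A h j θ),
      coeFn_testL2 (pertTest hψ h j θ), a5] with x h1 h2 h3 h4 h5
    rw [pertFn, h1, Pi.smul_apply, h2, h3, Pi.add_apply, h4, h5, smul_eq_mul]
  filter_upwards [a1, a2, a3, a4, a5, a6, Lp.coeFn_smul (h : ℂ) (u.D j)]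
    with x b1 b2 b3 b4 b5 b6 b7
  have hηf : (η : Euc n → ℂ) = fun y => expWeight ψ (-1 / h) y * θ y := funext hη
  have c1 : testD j η x = (Complex.I)⁻¹ * (((-1 / h : ℝ) : ℂ) * ((pd j ψ x : ℝ) : ℂ)
      * expWeight ψ (-1 / h) x * θ x + expWeight ψ (-1 / h) x * pd j θ x) := by
    rw [testD_apply', hηf, pd_mul (contDiff_expWeight hψ _) (contDiff_test θ), pd_expWeight hψ]
  have c2 : expWeight ψ (1 / h) x * expWeight ψ (-1 / h) x = 1 := by
    rw [expWeight, expWeight, ← Complex.ofReal_mul, ← Real.exp_add]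
    norm_num [neg_div]
  have c3 : pertTest hψ h j θ x
      = -(h * ((Complex.I)⁻¹ * pd j θ x)) - 2 * Complex.I * (((pd j ψ x : ℝ) : ℂ) * θ x) := by
    rw [← testD_apply']
    rfl
  rw [b1, b2, b3, b4, b5, b6, b7, Pi.smul_apply, smul_eq_mul, c1, hη, c3, conjD_apply,
    pd_expWeight hψ, Complex.inv_I]
  generalize expWeight ψ (1 / h) x = E at c2 ⊢
  generalize expWeight ψ (-1 / h) x = E' at c2 ⊢
  generalize (pd j ψ x : ℝ) = p
  generalize u.fn x = U
  generalize u.D j x = V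
  generalize A j x = a
  generalize pd j θ x = t'
  generalize θ x = t
  push_cast
  have hI := Complex.I_sq
  -- The integrand factors into the conjugated first-order operator applied to u times its transpose
  -- applied to θ. The terms without a are the conjugated Laplacian, those with a are `pertD` and
  -- `pertFn`.
  have l1 : (h ^ 2 : ℂ) * (a * (E * V + -Complex.I * (1 / h * p * E) * U + a * (E * U)) * (E' * t)
      - (E * V + -Complex.I * (1 / h * p * E) * U + a * (E * U))
      * (-Complex.I * (-1 / h * p * E' * t + E' * t')))
      = (E * E') * ((h * V - Complex.I * p * U + h * a * U)
        * (h * a * t + Complex.I * (h * t' - p * t))) := by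
    field_simp
    ring
  rw [l1, c2]
  linear_combination (0 : ℂ) * hI

lemma conjMagneticOp_apply (hΩ : Bornology.IsBounded (Ω : Set (Euc n))) {ψ : Euc n → ℝ}
    (hψ : ContDiff ℝ ∞ ψ) (A : Fin n → Lp ℂ ∞ (vol Ω)) (q : Lp ℂ ∞ (vol Ω)) {h : ℝ} (hh : h ≠ 0)
    (u : H1 Ω) (θ : 𝓓(Ω, ℂ)) : conjMagneticOp hΩ hψ A q h u θ
      = ofL2 u.fn (conjLap hψ h θ) + pertForm hψ A q h θ (u.toAmbient h) := by
  set w := mulH1 hΩ (expWeight ψ (1 / h)) (smoothNear_of_contDiff (contDiff_expWeight hψ _)) u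
    with hw
  set η := mulTest (expWeight ψ (-1 / h)) (smoothNear_of_contDiff (contDiff_expWeight hψ _)) θ
    with hη
  have e : conjMagneticOp hΩ hψ A q h u θ
      = (∑ j, (h ^ 2 : ℂ) * (distD j (ofL2 (w.D j + (A j • w.fn : Lp ℂ 2 (vol Ω)))) η
        + ofL2 (A j • (w.D j + (A j • w.fn : Lp ℂ 2 (vol Ω))) : Lp ℂ 2 (vol Ω)) η))
        + (h ^ 2 : ℂ) * ofL2 (q • w.fn : Lp ℂ 2 (vol Ω)) η := by
    rw [← Finset.mul_sum, ← mul_add]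
    change (h ^ 2 : ℂ) * magneticOp A q w η = _
    simp only [magneticOp, LinearMap.add_apply, LinearMap.sum_apply]
  rw [e, Finset.sum_congr rfl fun j _ => conjMagneticOp_term hΩ hψ A hh u w hw θ η
    (fun x => rfl) j _ rfl, Finset.sum_add_distrib, pertForm, add_assoc]
  congr 1
  · rw [conjLap, LinearMap.sum_apply, map_sum]
    rfl
  · refine congrArg₂ (· + ·) rfl ?_
    change _ = lpPair u.fn _
    rw [lpPair_apply, ofL2_apply, ← integral_const_mul]
    refine integral_congr_ae ?_
    filter_upwards [coeFn_topSMul q w.fn, mulH1_fn_ae hΩ (smoothNear_of_contDiff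
      (contDiff_expWeight hψ (1 / h))) u, coeFn_topSMul q (testL2 θ), coeFn_testL2 θ,
      Lp.coeFn_smul (h ^ 2 : ℂ) (q • testL2 θ : Lp ℂ 2 (vol Ω))] with x h1 h2 h3 h4 h5
    have c2 : expWeight ψ (1 / h) x * expWeight ψ (-1 / h) x = 1 := by
      rw [expWeight, expWeight, ← Complex.ofReal_mul, ← Real.exp_add]
      norm_num [neg_div]
    have h6 : η x = expWeight ψ (-1 / h) x * θ x := rfl
    rw [h1, hw, h2, h5, Pi.smul_apply, h3, h4, h6, smul_eq_mul]
    linear_combination (h ^ 2 * q x * u.fn x * θ x : ℂ) * c2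

/-- Every term carries a factor h beyond the one belonging to hD_j. The constant depends on ψ only
through the bound b on its first derivatives, hence not on the convexification parameter; this
permits ε to be chosen after M. -/
lemma exists_pertForm_bound (A : Fin n → Lp ℂ ∞ (vol Ω)) (q : Lp ℂ ∞ (vol Ω)) {b : ℝ}
    (hb0 : 0 ≤ b) : ∃ M : ℝ, 0 < M ∧ ∀ {ψ : Euc n → ℝ} (hψ : ContDiff ℝ ∞ ψ),
      (∀ j x, |pd j ψ x| ≤ b) → ∀ h : ℝ, 0 < h → h ≤ 1 → ∀ (θ : 𝓓(Ω, ℂ)) (W : SobAmbient Ω),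
        ‖pertForm hψ A q h θ W‖ ≤ M * h * ‖W‖ * (testH1 θ).sclNorm h := by
  set a := ∑ j, ‖A j‖ with ha
  have ha0 : 0 ≤ a := Finset.sum_nonneg fun _ _ => norm_nonneg _
  have haj : ∀ j, ‖A j‖ ≤ a := fun j => Finset.single_le_sum (f := fun j => ‖A j‖)
    (fun _ _ => norm_nonneg _) (Finset.mem_univ j)
  refine ⟨1 + (n * (a + a * (1 + 2 * b + a)) + ‖q‖), by positivity,
    fun {ψ} hψ hψb h hh hh1 θ W => ?_⟩
  set N := (testH1 θ).sclNorm h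
  have hN0 : 0 ≤ N := (testH1 θ).sclNorm_nonneg h
  have hθ : ‖(testL2 θ : Lp ℂ 2 (vol Ω))‖ ≤ N := (testH1 θ).norm_fn_le h
  have hDθ : ∀ j, ‖(h : ℂ) • (testL2 (testD j θ) : Lp ℂ 2 (vol Ω))‖ ≤ N :=
    (testH1 θ).norm_D_le h
  have hnh : ‖(h : ℂ)‖ = h := by rw [Complex.norm_real, Real.norm_of_nonneg hh.le]
  have hsm : ∀ (c : Lp ℂ ∞ (vol Ω)) (f : Lp ℂ 2 (vol Ω)) (c₀ f₀ : ℝ), ‖c‖ ≤ c₀ → ‖f‖ ≤ f₀ →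
      ‖(h : ℂ) • (c • f : Lp ℂ 2 (vol Ω))‖ ≤ h * (c₀ * f₀) := fun c f c₀ f₀ hc hf => by
    rw [norm_smul, hnh]
    exact mul_le_mul_of_nonneg_left ((Lp.norm_smul_le c f).trans
      (mul_le_mul hc hf (norm_nonneg _) ((norm_nonneg _).trans hc))) hh.le
  have h1 : ∀ j, ‖pertD A h j θ‖ ≤ h * (a * N) := fun j => hsm _ _ _ _ (haj j) hθ
  have h1' : ∀ j, ‖pertD A h j θ‖ ≤ a * N := fun j =>
    (h1 j).trans (mul_le_of_le_one_left (by positivity) hh1)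
  have h2 : ∀ j, ‖(testL2 (pertTest hψ h j θ) : Lp ℂ 2 (vol Ω))‖ ≤ (1 + 2 * b) * N := fun j => by
    have hm : ‖(testL2 (mulReal (contDiff_pd hψ j) θ) : Lp ℂ 2 (vol Ω))‖ ≤ b * N := by
      have := (memLp_bounded_mul (contDiff_pd hψ j).continuous (hψb j) (testFunction_memLp θ)).2
      have e : ∀ η : 𝓓(Ω, ℂ), ‖(testL2 η : Lp ℂ 2 (vol Ω))‖ = l2 (vol Ω) η := fun η =>
        Lp.norm_toLp _ (testFunction_memLp η)
      rw [e] at hθ ⊢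
      exact this.trans (mul_le_mul_of_nonneg_left hθ hb0)
    rw [pertTest, map_sub, map_neg, map_smul, map_smul]
    refine (norm_sub_le _ _).trans ?_
    rw [norm_neg, norm_smul (2 * Complex.I), norm_mul, Complex.norm_I, mul_one, Complex.norm_ofNat]
    calc _ ≤ N + 2 * (b * N) := add_le_add (hDθ j) (mul_le_mul_of_nonneg_left hm zero_le_two)
      _ = _ := by ring
  have h3 : ∀ j, ‖pertFn hψ A h j θ‖ ≤ h * (a * ((1 + 2 * b) * N + a * N)) := fun j =>
    hsm _ _ _ _ (haj j) ((norm_add_le _ _).trans (add_le_add (h2 j) (h1' j)))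
  have h4 : ‖(h ^ 2 : ℂ) • (q • testL2 θ : Lp ℂ 2 (vol Ω))‖ ≤ h * (‖q‖ * N) := by
    rw [pow_two, mul_smul, norm_smul, hnh]
    refine mul_le_mul_of_nonneg_left ((hsm q _ _ _ le_rfl hθ).trans ?_) hh.le
    exact mul_le_of_le_one_left (by positivity) hh1
  have hp : ∀ (i : Option (Fin n)) (f : Lp ℂ 2 (vol Ω)) (c : ℝ), ‖f‖ ≤ c →
      ‖lpPair (W i) f‖ ≤ ‖W‖ * c := fun i f c hf => (norm_lpPair_le _ _).trans
    (mul_le_mul (PiLp.norm_apply_le W i) hf (norm_nonneg _) (norm_nonneg _))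
  have h5 : ∀ j, ‖lpPair (W (some j)) (pertD A h j θ) + lpPair (W none) (pertFn hψ A h j θ)‖
      ≤ h * ‖W‖ * N * (a + a * (1 + 2 * b + a)) := fun j =>
    (norm_add_le _ _).trans ((add_le_add (hp _ _ _ (h1 j)) (hp _ _ _ (h3 j))).trans_eq (by ring))
  have h6 : ‖∑ j, (lpPair (W (some j)) (pertD A h j θ) + lpPair (W none) (pertFn hψ A h j θ))‖
      ≤ n * (h * ‖W‖ * N * (a + a * (1 + 2 * b + a))) := by
    refine (norm_sum_le _ _).trans ((Finset.sum_le_sum fun j _ => h5 j).trans_eq ?_)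
    simp
  calc ‖pertForm hψ A q h θ W‖
      ≤ n * (h * ‖W‖ * N * (a + a * (1 + 2 * b + a))) + ‖W‖ * (h * (‖q‖ * N)) :=
        (norm_add_le _ _).trans (add_le_add h6 (hp _ _ _ h4))
    _ = (n * (a + a * (1 + 2 * b + a)) + ‖q‖) * (h * ‖W‖ * N) := by ring
    _ ≤ (1 + (n * (a + a * (1 + 2 * b + a)) + ‖q‖)) * (h * ‖W‖ * N) :=
      mul_le_mul_of_nonneg_right (le_add_of_nonneg_left zero_le_one) (by positivity)
    _ = _ := by ring

/-- The Riesz representative of the weak form of the conjugated magnetic operator. -/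
def formVec {ψ : Euc n → ℝ} (hψ : ContDiff ℝ ∞ ψ) (A : Fin n → Lp ℂ ∞ (vol Ω))
    (q : Lp ℂ ∞ (vol Ω)) (h : ℝ) (θ : 𝓓(Ω, ℂ)) : SobAmbient Ω :=
  WithLp.toLp 2 fun i => Option.elim i
    (toL2conj (vol Ω) (conjLap hψ h θ) + ((∑ j, star (pertFn hψ A h j θ))
      + star ((h ^ 2 : ℂ) • (q • testL2 θ : Lp ℂ 2 (vol Ω)))))
    fun j => star (pertD A h j θ)

/-- As an inner product with a fixed vector, the weak form is defined and continuous on all of the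
ambient space, as successive approximation requires. -/
lemma inner_formVec {ψ : Euc n → ℝ} (hψ : ContDiff ℝ ∞ ψ) (A : Fin n → Lp ℂ ∞ (vol Ω))
    (q : Lp ℂ ∞ (vol Ω)) (h : ℝ) (θ : 𝓓(Ω, ℂ)) (W : SobAmbient Ω) :
    inner ℂ (formVec hψ A q h θ) W
      = ofL2 (W none) (conjLap hψ h θ) + pertForm hψ A q h θ W := by
  rw [PiLp.inner_apply, Fintype.sum_option]
  change inner ℂ (toL2conj (vol Ω) (conjLap hψ h θ) + ((∑ j, star (pertFn hψ A h j θ))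
      + star ((h ^ 2 : ℂ) • (q • testL2 θ : Lp ℂ 2 (vol Ω))))) (W none)
    + ∑ j, lpPair (W (some j)) (pertD A h j θ) = _
  rw [inner_add_left, inner_add_left, sum_inner, ← ofL2_eq_inner, pertForm, Finset.sum_add_distrib]
  simp only [lpPair]
  ring

end MagneticForm

/-! ### The magnetic perturbation, the change of weight, and the dual norm. -/

section Main

variable {n : ℕ} {Ω : Opens (Euc n)}

/-- Solvability of the conjugated magnetic equation, given solvability for the conjugated
Laplacian with a small constant. -/
lemma exists_conjMagneticOp_solution (hΩ : Bornology.IsBounded (Ω : Set (Euc n))) {ψ : Euc n → ℝ}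
    (hψ : ContDiff ℝ ∞ ψ) (A : Fin n → Lp ℂ ∞ (vol Ω)) (q : Lp ℂ ∞ (vol Ω)) {h R M : ℝ}
    (hh : h ≠ 0) (hM : 0 ≤ M) (hRM : M * R ≤ 1 / 2)
    (hpert : ∀ (θ : 𝓓(Ω, ℂ)) (W : SobAmbient Ω),
      ‖pertForm hψ A q h θ W‖ ≤ M * ‖W‖ * (testH1 θ).sclNorm h)
    (hsol : ∀ K : ℝ, 0 ≤ K → ∀ v : Functional Ω, (∀ θ, ‖v θ‖ ≤ K * (testH1 θ).sclNorm h) →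
      ∃ u : H1 Ω, u.sclNorm h ≤ R * K ∧ ∀ θ, ofL2 u.fn (conjLap hψ h θ) = v θ)
    {K : ℝ} (hK : 0 ≤ K) (v : Functional Ω) (hv : ∀ θ, ‖v θ‖ ≤ K * (testH1 θ).sclNorm h) :
    ∃ u : H1 Ω, u.sclNorm h ≤ 2 * R * K ∧ ∀ θ, conjMagneticOp hΩ hψ A q h u θ = v θ := by
  obtain ⟨W, hW, hWn, hWv⟩ := exists_solution_of_approximate (isClosed_sobGraph (Ω := Ω) h)
    (N := fun θ => (testH1 θ).sclNorm h) (G := formVec hψ A q h) (R := R)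
    (fun K hK v hv => by
      obtain ⟨u, hu, huv⟩ := hsol K hK v hv
      refine ⟨u.toAmbient h, u.toAmbient_mem h, by rwa [H1.norm_toAmbient],
        -- The residual is minus the perturbation form, of size at most M R K, that is, at most K/2.
        v - conjMagneticOp hΩ hψ A q h u, fun θ => ?_, fun θ => ?_⟩
      · have e : (v - conjMagneticOp hΩ hψ A q h u) θ
            = -pertForm hψ A q h θ (u.toAmbient h) := by
          rw [LinearMap.sub_apply, conjMagneticOp_apply hΩ hψ A q hh, huv]
          ring
        have hN := (testH1 θ).sclNorm_nonneg h
        rw [e, norm_neg]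
        refine (hpert θ _).trans (mul_le_mul_of_nonneg_right ?_ hN)
        rw [H1.norm_toAmbient]
        calc M * u.sclNorm h ≤ M * (R * K) := mul_le_mul_of_nonneg_left hu hM
          _ = M * R * K := by ring
          _ ≤ 1 / 2 * K := mul_le_mul_of_nonneg_right hRM hK
          _ = K / 2 := by ring
      · rw [inner_formVec, LinearMap.sub_apply, sub_sub_cancel,
          conjMagneticOp_apply hΩ hψ A q hh]
        rfl) hK v hv
  refine ⟨H1.ofGraph hh hW, ?_, fun θ => ?_⟩
  · rwa [← H1.norm_toAmbient, H1.toAmbient_ofGraph]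
  · rw [conjMagneticOp_apply hΩ hψ A q hh, H1.toAmbient_ofGraph, ← hWv, inner_formVec]
    rfl

lemma mulH1_mulH1 (hΩ : Bornology.IsBounded (Ω : Set (Euc n))) {a b c : Euc n → ℂ}
    (ha : SmoothNear Ω a) (hb : SmoothNear Ω b) (hc : SmoothNear Ω c)
    (habc : ∀ x ∈ Ω, c x = a x * b x) (u : H1 Ω) :
    mulH1 hΩ a ha (mulH1 hΩ b hb u) = mulH1 hΩ c hc u := by
  refine H1.ext_ae ?_ fun j => ?_
  · filter_upwards [mulH1_fn_ae hΩ ha (mulH1 hΩ b hb u), mulH1_fn_ae hΩ hb u,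
      mulH1_fn_ae hΩ hc u, ae_restrict_mem Ω.isOpen.measurableSet] with x h1 h2 h3 hx
    rw [h1, h2, h3, habc x hx, mul_assoc]
  · filter_upwards [mulH1_D_ae hΩ ha (mulH1 hΩ b hb u) j, mulH1_fn_ae hΩ hb u,
      mulH1_D_ae hΩ hb u j, mulH1_D_ae hΩ hc u j, ae_restrict_mem Ω.isOpen.measurableSet]
      with x h1 h2 h3 h4 hx
    have hd : ∀ {e : Euc n → ℂ}, SmoothNear Ω e → DifferentiableAt ℝ e x := fun he =>
      (he.contDiffAt (subset_closure hx)).differentiableAt (by simp)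
    have hfd : fderiv ℝ c x = a x • fderiv ℝ b x + b x • fderiv ℝ a x := by
      have : c =ᶠ[nhds x] fun y => a y * b y := by
        filter_upwards [Ω.isOpen.mem_nhds hx] with y hy using habc y hy
      rw [this.fderiv_eq]
      exact fderiv_mul (hd ha) (hd hb)
    rw [h1, h2, h3, h4, habc x hx, hfd]
    simp only [add_apply, smul_apply, smul_eq_mul]
    ring

/-- Change of weight in the conjugated operator. -/
lemma conjugatedOp_mulH1 (hΩ : Bornology.IsBounded (Ω : Set (Euc n))) {U : Opens (Euc n)}
    (hU : closure (Ω : Set (Euc n)) ⊆ U) {φ : Euc n → ℝ} (hφ : ContDiffOn ℝ ∞ φ U)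
    (A : Fin n → Lp ℂ ∞ (vol Ω)) (q : Lp ℂ ∞ (vol Ω)) {h : ℝ} (hh : h ≠ 0) {ψ σ : Euc n → ℝ}
    (hψ : ContDiff ℝ ∞ ψ) (hσ : ContDiff ℝ ∞ σ) (hψσ : ∀ x ∈ Ω, ψ x = h * σ x - φ x) (u : H1 Ω)
    (θ : 𝓓(Ω, ℂ)) :
    conjugatedOp hΩ hU hφ A q h
      (mulH1 hΩ (expWeight σ 1) (smoothNear_of_contDiff (contDiff_expWeight hσ _)) u)
      (mulTest (expWeight σ (-1)) (smoothNear_of_contDiff (contDiff_expWeight hσ _)) θ)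
      = conjMagneticOp hΩ hψ A q h u θ := by
  have e1 : mulH1 hΩ (expWeight φ (-1 / h)) (smoothNear_expWeight hU hφ _)
      (mulH1 hΩ (expWeight σ 1) (smoothNear_of_contDiff (contDiff_expWeight hσ _)) u)
      = mulH1 hΩ (expWeight ψ (1 / h)) (smoothNear_of_contDiff (contDiff_expWeight hψ _)) u := by
    refine mulH1_mulH1 hΩ _ _ _ (fun x hx => ?_) u
    simp only [expWeight]
    rw [← Complex.ofReal_mul, ← Real.exp_add, hψσ x hx]
    congr 2
    field_simp
    ring
  have e2 : mulTest (expWeight φ (1 / h)) (smoothNear_expWeight hU hφ _)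
      (mulTest (expWeight σ (-1)) (smoothNear_of_contDiff (contDiff_expWeight hσ _)) θ)
      = mulTest (expWeight ψ (-1 / h)) (smoothNear_of_contDiff (contDiff_expWeight hψ _)) θ := by
    ext x
    rw [mulTest_apply, mulTest_apply, mulTest_apply, ← mul_assoc]
    by_cases hx : x ∈ Ω
    · congr 1
      simp only [expWeight]
      rw [← Complex.ofReal_mul, ← Real.exp_add, hψσ x hx]
      congr 2
      field_simp
      ring
    · rw [image_eq_zero_of_notMem_tsupport fun hm => hx (θ.tsupport_subset hm), mul_zero, mul_zero]
  rw [conjugatedOp, conjMagneticOp, e1, mulDist, mulDist, LinearMap.comp_apply,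
    LinearMap.comp_apply, e2]

lemma sclNorm_testH1_pos {h : ℝ} {θ : 𝓓(Ω, ℂ)} (hθ : θ ≠ 0) : 0 < (testH1 θ).sclNorm h := by
  refine lt_of_lt_of_le (norm_pos_iff.2 fun h0 => hθ ?_) ((testH1 θ).norm_fn_le h)
  have h1 : θ =ᵐ[vol Ω] (0 : Euc n → ℂ) := by
    have h2 := coeFn_testL2 θ
    have h3 : testL2 θ = (0 : Lp ℂ 2 (vol Ω)) := h0
    rw [h3] at h2
    exact h2.symm.trans (Lp.coeFn_zero _ _ _)
  have h2 : EqOn θ (0 : Euc n → ℂ) Ω :=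
    Measure.eqOn_open_of_ae_eq h1 Ω.isOpen θ.continuous.continuousOn continuousOn_const
  ext x
  by_cases hx : x ∈ Ω
  · exact h2 hx
  · exact image_eq_zero_of_notMem_tsupport fun hm => hx (θ.tsupport_subset hm)

/-- Membership in H⁻¹ is expressed with h = 1. This comparison, not uniform in h, shows that the
quotients defining the dual norm are bounded for each h. -/
lemma H1.sclNorm_one_le {h : ℝ} (hh : 0 < h) (u : H1 Ω) :
    u.sclNorm 1 ≤ (1 + n * (1 / h)) * u.sclNorm h := by
  have h2 : ∀ j, ‖((1 : ℝ) : ℂ) • u.D j‖ ≤ 1 / h * u.sclNorm h := fun j => by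
    have := u.norm_D_le h j
    rw [norm_smul, Complex.norm_real, Real.norm_of_nonneg hh.le] at this
    rw [Complex.ofReal_one, one_smul, one_div, ← div_eq_inv_mul, le_div_iff₀ hh]
    linarith
  refine (H1.sclNorm_le (u.norm_fn_le h) h2).trans_eq ?_
  ring

lemma norm_le_sclNormNegOne {v : Functional Ω} (hv : MemHNegOne v) {h : ℝ} (hh : 0 < h)
    (θ : 𝓓(Ω, ℂ)) : ‖v θ‖ ≤ sclNormNegOne h v * (testH1 θ).sclNorm h := by
  obtain ⟨K, hK⟩ := hv
  by_cases hθ : θ = 0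
  · rw [hθ, map_zero, norm_zero]
    refine mul_nonneg (Real.iSup_nonneg fun η => ?_) (H1.sclNorm_nonneg _ _)
    exact div_nonneg (norm_nonneg _) (H1.sclNorm_nonneg _ _)
  rw [← div_le_iff₀ (sclNorm_testH1_pos hθ)]
  -- A real supremum of an unbounded family would take the default value 0, so an explicit bound for
  -- the quotients has to be supplied.
  refine le_ciSup (f := fun ψ : {ψ : 𝓓(Ω, ℂ) // ψ ≠ 0} => ‖v ψ.1‖ / (testH1 ψ.1).sclNorm h)
    ⟨|K| * (1 + n * (1 / h)), ?_⟩ ⟨θ, hθ⟩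
  rintro _ ⟨η, rfl⟩
  rw [div_le_iff₀ (sclNorm_testH1_pos η.2), mul_assoc]
  calc ‖v η.1‖ ≤ K * (testH1 η.1).sclNorm 1 := hK _
    _ ≤ |K| * (testH1 η.1).sclNorm 1 :=
      mul_le_mul_of_nonneg_right (le_abs_self K) (H1.sclNorm_nonneg _ _)
    _ ≤ _ := mul_le_mul_of_nonneg_left (H1.sclNorm_one_le hh _) (abs_nonneg K)

lemma sclNormNegOne_nonneg (h : ℝ) (v : Functional Ω) : 0 ≤ sclNormNegOne h v :=
  Real.iSup_nonneg fun _ => div_nonneg (norm_nonneg _) (H1.sclNorm_nonneg _ _)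

end Main

end MagneticSchrodinger
end

/-! ### The proposition. -/

open MagneticSchrodinger in
theorem proposition2p3 (n : ℕ) (hn : 3 ≤ n)
    (Ω U : TopologicalSpace.Opens (EuclideanSpace ℝ (Fin n)))
    (hΩ : Bornology.IsBounded (Ω : Set (EuclideanSpace ℝ (Fin n))))
    (hU : closure (Ω : Set (EuclideanSpace ℝ (Fin n))) ⊆ U)
    (φ : EuclideanSpace ℝ (Fin n) → ℝ)
    (hφ : MagneticSchrodinger.IsLimitingCarlemanWeight U φ)
    (A : Fin n → MeasureTheory.Lp ℂ ∞ (MagneticSchrodinger.vol Ω))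
    (q : MeasureTheory.Lp ℂ ∞ (MagneticSchrodinger.vol Ω)) :
    ∃ C : ℝ, 0 < C ∧ ∃ h₀ : ℝ, 0 < h₀ ∧ ∀ h : ℝ, 0 < h → h ≤ h₀ →
      ∀ v : MagneticSchrodinger.Functional Ω, MagneticSchrodinger.MemHNegOne v →
        ∃ u : MagneticSchrodinger.H1 Ω,
          MagneticSchrodinger.conjugatedOp hΩ hU hφ.smooth A q h u = v ∧
          u.sclNorm h ≤ C / h * MagneticSchrodinger.sclNormNegOne h v := by
  obtain ⟨f, ν, χ, Ω', hf, hν, hχ, hfc, hχc, hχs, hχ1, hχΩ, hle, hΩc, ⟨c, hc, hG⟩, hid, W, -, hΩW,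
    hfφ⟩ := exists_global_weight hΩ hU hφ
  obtain ⟨C, hC, ε₀, hε₀, HS⟩ := exists_conjLap_solution hf hν hχ hfc hχc hχs hχ1 hχΩ hle hΩc hc
    hG hid
  obtain ⟨b, hb1, hb⟩ := exists_uniform_coefficient_bound hf hfc hχ hχc
  obtain ⟨M, hM, HM⟩ := exists_pertForm_bound A q (by linarith : 0 ≤ b)
  -- Neither C nor M depends on ε. The choice gives (M h)(C√ε/h) = MC√ε ≤ 1/2, the contraction
  -- condition, for every h; from here on ε is fixed.
  obtain ⟨ε, hε, hεε, hεM⟩ : ∃ ε : ℝ, 0 < ε ∧ ε ≤ ε₀ ∧ Real.sqrt ε ≤ 1 / (2 * C * M) :=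
    ⟨min ε₀ ((1 / (2 * C * M)) ^ 2), by positivity, min_le_left _ _,
      Real.sqrt_le_iff.2 ⟨by positivity, min_le_right _ _⟩⟩
  obtain ⟨h₀, hh₀, hh₀1, hh₀ε, HE⟩ := HS ε hε hεε
  -- The convexified weight is f + hσ, which on Ω equals hσ - φ; thus `e^{ψ/h} = e^{-φ/h} e^{σ}`
  -- there, with a factor `e^{σ}` independent of h.
  set σ : Euc n → ℝ := fun x => 1 / (2 * ε) * (f x * f x) with hσdef
  have hσ : ContDiff ℝ ∞ σ := contDiff_const.mul (hf.mul hf)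
  have hs : ∀ t, SmoothNear Ω (expWeight σ t) := fun t =>
    smoothNear_of_contDiff (contDiff_expWeight hσ t)
  obtain ⟨M₁, hM₁, HM₁⟩ := exists_mulH1_bound hΩ (hs 1)
  obtain ⟨M₂, hM₂, HM₂⟩ := exists_mulH1_bound hΩ (hs (-1))
  have hsε : 0 < Real.sqrt ε := Real.sqrt_pos.2 hε
  refine ⟨M₁ * (2 * (C * Real.sqrt ε) * M₂), by positivity, h₀, hh₀, fun h hh hhh v hv => ?_⟩
  have hh1 : h ≤ 1 := hhh.trans hh₀1
  have hψ := contDiff_convexify hf (h / ε)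
  obtain ⟨b1, -⟩ := hb (h / ε) h (by positivity) ((div_le_one hε).2 (hhh.trans hh₀ε)) hh.le hh1
  set K := sclNormNegOne h v
  have hK : 0 ≤ K := sclNormNegOne_nonneg h v
  obtain ⟨u, hu, huv⟩ := exists_conjMagneticOp_solution hΩ hψ A q hh.ne' (R := C * (√ε / h))
    (M := M * h) (by positivity)
    (by
      rw [le_div_iff₀ (by positivity)] at hεM
      have : M * h * (C * (√ε / h)) = √ε * (2 * C * M) / 2 := by
        field_simp
      linarith)
    (HM hψ b1 h hh hh1) (HE h hh hhh) (mul_nonneg hM₂.le hK)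
    -- The datum is multiplied by `e^{-σ}` to compensate for the factor `e^{σ}` in the final
    -- solution.
    (v ∘ₗ mulTest (expWeight σ (-1)) (hs _)) fun θ => by
      refine (norm_le_sclNormNegOne hv hh _).trans ?_
      rw [testH1_mulTest hΩ]
      calc _ ≤ K * (M₂ * (testH1 θ).sclNorm h) :=
            mul_le_mul_of_nonneg_left (HM₂ h hh hh1 _) hK
        _ = _ := by ring
  refine ⟨mulH1 hΩ (expWeight σ 1) (hs 1) u, ?_, ?_⟩
  · ext θ
    -- The change-of-weight identity concerns test functions `e^{-σ}θ`; applying it to `e^{σ}θ`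
    -- reaches every θ.
    have e : mulTest (expWeight σ (-1)) (hs _) (mulTest (expWeight σ 1) (hs _) θ) = θ := by
      ext x
      rw [mulTest_apply, mulTest_apply, ← mul_assoc, expWeight, expWeight, ← Complex.ofReal_mul,
        ← Real.exp_add]
      norm_num
    have hc := conjugatedOp_mulH1 hΩ hU hφ.smooth A q hh.ne' hψ hσ (fun x hx => ?_) u
      (mulTest (expWeight σ 1) (hs _) θ)
    · rw [e, huv, LinearMap.comp_apply, e] at hc
      exact hc
    · have hx := hfφ x (hΩW (subset_closure hx))
      rw [convexify, hσdef]
      beta_reduce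
      rw [hx]
      field_simp
      ring
  · calc _ ≤ M₁ * u.sclNorm h := HM₁ h hh hh1 u
      _ ≤ M₁ * (2 * (C * (√ε / h)) * (M₂ * K)) := mul_le_mul_of_nonneg_left hu hM₁.le
      _ = _ := by ring
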